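/- Fix constants $\hbar,k,T>0$. A finite-dimensional system $u$ of dimension $d$ has Hamiltonian $H_u=\sum_n E^u_n|E^u_n\rangle\langle E^u_n|$. Let $\rho_u=\sum_n p_n|\psi_n\rangle\langle\psi_n|$ be any initial state and $\sigma_u=\sum_n q_n|\phi_n\rangle\langle\phi_n|$ any full-rank target state of $u$, where $\{|E^u_n\rangle\},\{|\psi_n\rangle\},\{|\phi_n\rangle\}$ are orthonormal eigenbases in any labelling. Write $F(\rho)=\mathrm{Tr}(H_u\rho)-T\,S(\rho)$ with $S(\rho)=-k\,\mathrm{Tr}(\rho\ln\rho)$, and $\Delta F_u=F(\sigma_u)-F(\rho_u)$. Then for every $\epsilon'>0$ and every sufficiently small $\delta p>0$ there is a bath $b$ of $N=\lceil 1/\delta p\rceil$ non-interacting $d$-dimensional systems with the following properties. Its total Hamiltonian is $H_b$ and it is initially in the thermal state $\rho_b=e^{-H_b/kT}/\mathrm{Tr}\,e^{-H_b/kT}$. Let $r^{(j)}$ ($1\le j\le N$) be the vector of thermal probabilities of the $j$-th bath system, and let $r^{(0)}=p$. Then $|r^{(j)}_n-r^{(j-1)}_n|<\delta p$ and $r^{(j)}_n$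 lies between $p_n$ and $q_n$, for all $n$ and all $1\le j\le N$, and $r^{(N)}=q$. Let $V=V^{(3)}V^{(2)}V^{(1)}$ act on $u\otimes b$, where $V^{(1)}=\sum_n|E^u_n\rangle\langle\psi_n|\otimes 1$, where $V^{(2)}$ consists of successively swapping $u$ with the bath systems $1,\dots,N$ (identifying their energy eigenbases), and where $V^{(3)}=\sum_n|\phi_n\rangle\langle E^u_n|\otimes 1$. Put $\rho_{ub}=\rho_u\otimes\rho_b$ and $H_s=H_u+H_b$. (1) $V$ is unitary, $\mathrm{Tr}_b[V\rho_{ub}V^\dagger]=\sigma_u$, and the energy change $\Delta E_{ub}=\mathrm{Tr}[H_s(V\rho_{ub}V^\dagger-\rho_{ub})]$ satisfies $\Delta F_u\le\Delta E_{ub}\le\Delta F_u+\epsilon'$. (2) Add a weight $w$ on $L^2(\mathbb R)$ with Hamiltonian its position operator, $H_w=X_w$, and a clock $c$ on $L^2(\mathbb R)$ with Hamiltonian its momentum operator, $H_c=P_c$ (in units in which the weight force and the clock velocity are $1$). Put $H_e=H_s+H_w$. For every $a,p_0\in\mathbb R$ and $K,L>0$ there is a bounded self-adjoint operator $H^{\mathrm{int}}$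 on $u\otimes b\otimes w\otimes c$ that commutes with $H_e$, $X_c$ and $P_w$ and acts only while the clock position is in $[a+K,a+K+L]$, and there is $\delta>0$, such that the time-independent Hamiltonian $H=H_e+H_c+H^{\mathrm{int}}$ generates a unitary group $e^{-iHt/\hbar}$ with the following property. Let $\rho_w$ be any state of the weight that has finite mean energy and whose momentum $p$ satisfies $|p-p_0|\ge\delta$ with probability at most $\delta$; such states exist. Let $\rho_c$ be any state of the clock with position support in $[a,a+K]$. If $\rho(0)=\rho_{ub}\otimes\rho_w\otimes\rho_c$ and $\rho(t)=e^{-iHt/\hbar}\rho(0)e^{iHt/\hbar}$, then for all $t\ge\tau:=K+L$ $$\big\|\mathrm{Tr}_{wc}\,\rho(t)-e^{-iH_st/\hbar}\,V\rho_{ub}V^\dagger\,e^{iH_st/\hbar}\big\|_1\le\epsilon',\qquad \big\|\mathrm{Tr}_{bwc}\,\rho(t)-e^{-iH_ut/\hbar}\,\sigma_u\,e^{iH_ut/\hbar}\big\|_1\le\epsilon',$$ and the extracted work, i.e. the gain in mean energy of the weight, $W=\mathrm{Tr}[H_w(\rho(t)-\rho(0))]$, is finite and satisfies $$W\ge-\Delta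 F_u-\epsilon'.$$ -/

import Mathlib

open MeasureTheory Matrix Complex
open scoped Kronecker ComplexOrder ContDiff ENNReal InnerProductSpace

noncomputable section

namespace ClockEngine

/-! ### Finite-dimensional quantum thermodynamics -/

section FiniteDim

variable {n : Type} [Fintype n] [DecidableEq n]

/-- Average energy `Tr (H ρ)`. -/
def energy (H ρ : Matrix n n ℂ) : ℝ := (trace (H * ρ)).re

/-- Von Neumann entropy `S(ρ) = -k Tr (ρ log ρ)`, with Boltzmann's constant `k`. -/
def entropy (k : ℝ) (ρ : Matrix n n ℂ) (hρ : ρ.IsHermitian) : ℝ :=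
  k * ∑ i, Real.negMulLog (hρ.eigenvalues i)

/-- Free energy `F(ρ) = Tr (H ρ) - T S(ρ)`. -/
def freeEnergy (k T : ℝ) (H ρ : Matrix n n ℂ) (hρ : ρ.IsHermitian) : ℝ :=
  energy H ρ - T * entropy k ρ hρ

/-- Thermal state `exp (-H / (k T)) / Tr exp (-H / (k T))`. -/
def thermalState (k T : ℝ) (H : Matrix n n ℂ) : Matrix n n ℂ :=
  (trace (NormedSpace.exp ((-(1 / (k * T)) : ℂ) • H)))⁻¹ •
    NormedSpace.exp ((-(1 / (k * T)) : ℂ) • H)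

/-- The free propagator `exp (-i H t / ħ)`. -/
def propagator (ħ : ℝ) (H : Matrix n n ℂ) (t : ℝ) : Matrix n n ℂ :=
  NormedSpace.exp ((-(I * t / ħ)) • H)

/-- Free evolution of a state, `exp (-i H t / ħ) ρ exp (i H t / ħ)`. -/
def freeEvolution (ħ : ℝ) (H : Matrix n n ℂ) (t : ℝ) (ρ : Matrix n n ℂ) : Matrix n n ℂ :=
  propagator ħ H t * ρ * (propagator ħ H t)ᴴ

/-- The trace norm `‖M‖₁`, i.e. the sum of the singular values of `M`. -/
def traceNorm (M : Matrix n n ℂ) : ℝ :=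
  ∑ i, Real.sqrt ((isHermitian_conjTranspose_mul_self M).eigenvalues i)

/-- `M` is diagonal in the orthonormal basis `v`, with eigenvalues `p`. -/
def IsEigenbasis (M : Matrix n n ℂ) (v : OrthonormalBasis n ℂ (EuclideanSpace ℂ n))
    (p : n → ℝ) : Prop :=
  ∀ i, Matrix.toEuclideanCLM (𝕜 := ℂ) M (v i) = (p i : ℂ) • v i

/-- The operator `|x⟩⟨y|`. -/
def ketBra (x y : EuclideanSpace ℂ n) : Matrix n n ℂ :=
  vecMulVec (fun i => x i) (fun i => star (y i))

/-- The partial trace over the second tensor factor. -/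
def partialTrace {m : Type} [Fintype m] (M : Matrix (n × m) (n × m) ℂ) : Matrix n n ℂ :=
  Matrix.of fun i j => ∑ b, M (i, b) (j, b)

end FiniteDim

/-! ### Subsystem, bath and the three stages of the protocol -/

section Protocol

variable {d N : ℕ}

/-- Labels of a basis of the bath, which consists of `N` systems of dimension `d`. -/
abbrev Bath (d N : ℕ) : Type := Fin N → Fin d

/-- Hamiltonian of the bath: its `j`-th system has energy levels `e j 0, …, e j (d - 1)`, and the
systems do not interact. The basis labelled by `Bath d N` is the energy eigenbasis. -/
def bathHamiltonian (e : Fin N → Fin d → ℝ) : Matrix (Bath d N) (Bath d N) ℂ :=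
  diagonal fun b => ((∑ j, e j (b j) : ℝ) : ℂ)

/-- `H_u ⊗ 1 + 1 ⊗ H_b`. -/
def systemHamiltonian (Hu : Matrix (Fin d) (Fin d) ℂ) (e : Fin N → Fin d → ℝ) :
    Matrix (Fin d × Bath d N) (Fin d × Bath d N) ℂ :=
  Hu ⊗ₖ (1 : Matrix (Bath d N) (Bath d N) ℂ) + (1 : Matrix (Fin d) (Fin d) ℂ) ⊗ₖ bathHamiltonian e

/-- Boltzmann probabilities at temperature `T` of a system with energy levels `e`. -/
def boltzmann (k T : ℝ) (e : Fin d → ℝ) (i : Fin d) : ℝ :=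
  Real.exp (-e i / (k * T)) / ∑ l, Real.exp (-e l / (k * T))

/-- The initial probabilities of the subsystem, followed by the thermal probabilities of the
successive bath systems. -/
def probabilityPath (k T : ℝ) (p : Fin d → ℝ) (e : Fin N → Fin d → ℝ) :
    Fin (N + 1) → Fin d → ℝ :=
  Fin.cons p fun j => boltzmann k T (e j)

/-- The thermal probabilities of the bath systems lead from `p` exactly to `q` in steps of size
less than `δp`, and stay between `p` and `q`. -/
def IsGradual (k T δp : ℝ) (p q : Fin d → ℝ) (e : Fin N → Fin d → ℝ) : Prop :=
  (∀ (j : Fin N) (i : Fin d),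
    |probabilityPath k T p e j.succ i - probabilityPath k T p e j.castSucc i| < δp ∧
    probabilityPath k T p e j.succ i ∈ Set.uIcc (p i) (q i)) ∧
  probabilityPath k T p e (Fin.last N) = q

/-- The unitary `∑ i, |w i⟩⟨v i| ⊗ 1` on subsystem and bath. -/
def rotation (v w : OrthonormalBasis (Fin d) ℂ (EuclideanSpace ℂ (Fin d))) :
    Matrix (Fin d × Bath d N) (Fin d × Bath d N) ℂ :=
  (∑ i, ketBra (w i) (v i)) ⊗ₖ (1 : Matrix (Bath d N) (Bath d N) ℂ)

/-- The swap of the subsystem with the `j`-th bath system. It identifies the energy eigenbasis `E`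
of the subsystem with that of the bath system:
`|E m⟩ ⊗ |b 0, …, b j, …⟩ ↦ |E (b j)⟩ ⊗ |b 0, …, m, …⟩`. -/
def swap (E : OrthonormalBasis (Fin d) ℂ (EuclideanSpace ℂ (Fin d))) (j : Fin N) :
    Matrix (Fin d × Bath d N) (Fin d × Bath d N) ℂ :=
  ∑ m : Fin d, ∑ b : Bath d N,
    ketBra (E (b j)) (E m) ⊗ₖ Matrix.single (Function.update b j m) b (1 : ℂ)

/-- The protocol: rotate the eigenbasis `ψ` of the initial state to the energy basis `E`, swap with
the bath systems `0, 1, …, N - 1` in this order, and rotate `E` to the eigenbasis `φ` of the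
target. -/
def protocolUnitary (N : ℕ) (ψ E φ : OrthonormalBasis (Fin d) ℂ (EuclideanSpace ℂ (Fin d))) :
    Matrix (Fin d × Bath d N) (Fin d × Bath d N) ℂ :=
  rotation E φ * (List.ofFn fun j : Fin N => swap E j).reverse.prod * rotation ψ E

end Protocol

/-! ### Density operators on a Hilbert space -/

section Trace

variable {K : Type} [NormedAddCommGroup K] [InnerProductSpace ℂ K]

/-- `A` has trace `z`: the diagonal sum in every Hilbert basis converges (unconditionally) to `z`.
-/
def HasTrace (A : K →L[ℂ] K) (z : ℂ) : Prop :=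
  ∀ (s : Set K) (b : HilbertBasis s ℂ K), HasSum (fun i => ⟪b i, A (b i)⟫_ℂ) z

/-- Density operators: positive operators with trace one. -/
def IsDensity [CompleteSpace K] (ρ : K →L[ℂ] K) : Prop :=
  ρ.IsPositive ∧ HasTrace ρ 1

end Trace

section Observables

variable {α F : Type} [MeasurableSpace α] {μ : Measure α}
  [NormedAddCommGroup F] [InnerProductSpace ℂ F]

open Classical in
/-- The projection `1_S` on `L²`: multiplication by the indicator function of the measurable
set `S`. (It is set to `0` when `S` is not measurable.) -/
def indicatorOp (μ : Measure α) (F : Type) [NormedAddCommGroup F] [InnerProductSpace ℂ F]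
    (S : Set α) : Lp F 2 μ →L[ℂ] Lp F 2 μ :=
  if hS : MeasurableSet S then
    LinearMap.mkContinuous
      { toFun := fun f => ((Lp.memLp f).indicator hS).toLp _
        map_add' := fun f g => by
          rw [← MemLp.toLp_add]
          refine MemLp.toLp_congr _ _ ?_
          filter_upwards [Lp.coeFn_add f g] with x hx
          by_cases h : x ∈ S
          · simpa only [Pi.add_apply, Set.indicator_of_mem h] using hx
          · simp only [Pi.add_apply, Set.indicator_of_notMem h, add_zero]
        map_smul' := fun c f => by
          rw [RingHom.id_apply, ← MemLp.toLp_const_smul]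
          refine MemLp.toLp_congr _ _ ?_
          filter_upwards [Lp.coeFn_smul c f] with x hx
          by_cases h : x ∈ S
          · simpa only [Pi.smul_apply, Set.indicator_of_mem h] using hx
          · simp only [Pi.smul_apply, Set.indicator_of_notMem h, smul_zero] }
      1 (fun f => by
        rw [one_mul]
        refine Lp.norm_le_norm_of_ae_le ?_
        filter_upwards [((Lp.memLp f).indicator hS).coeFn_toLp] with x hx
        rw [LinearMap.coe_mk, AddHom.coe_mk, hx]
        exact norm_indicator_le_norm_self _ _)
  else 0

/-- In the state `ρ` on `L²(α; F)`, the distribution of the observable "multiplication by the real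
function `f`" is `ν`: `Tr (1_{f ∈ B} ρ) = ν B` for Borel sets `B`. -/
def HasDistribution (f : α → ℝ) (ρ : Lp F 2 μ →L[ℂ] Lp F 2 μ) (ν : Measure ℝ) : Prop :=
  IsProbabilityMeasure ν ∧ ∀ B, MeasurableSet B →
    HasTrace (indicatorOp μ F (f ⁻¹' B) ∘L ρ) ((ν.real B : ℝ) : ℂ)

/-- In the state `ρ`, the (possibly unbounded) observable "multiplication by `f`" has the finite
mean value `m`. -/
def HasMean (f : α → ℝ) (ρ : Lp F 2 μ →L[ℂ] Lp F 2 μ) (m : ℝ) : Prop :=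
  ∃ ν : Measure ℝ, HasDistribution f ρ ν ∧ Integrable (fun y => y) ν ∧ ∫ y, y ∂ν = m

end Observables

/-! ### Weight, clock and the whole machine -/

section Machine

/-- The Hilbert space of the weight, and that of the clock, in position representation. -/
abbrev Line : Type := Lp ℂ 2 (volume : Measure ℝ)

/-- The spectral projection of the momentum operator `P = -i ħ d/dx` on the set `B`. In the Fourier
variable `ξ`, dual to `x` with kernel `exp (-2 π i x ξ)`, the momentum is `2 π ħ ξ`. -/
def momentumProjection (ħ : ℝ) (B : Set ℝ) : Line →L[ℂ] Line :=
  ((Lp.fourierTransformₗᵢ ℝ ℂ).symm.toContinuousLinearEquiv : Line →L[ℂ] Line) ∘L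
    indicatorOp volume ℂ {ξ : ℝ | 2 * Real.pi * ħ * ξ ∈ B} ∘L
      ((Lp.fourierTransformₗᵢ ℝ ℂ).toContinuousLinearEquiv : Line →L[ℂ] Line)

/-- Admissible states of the weight: density operators with finite mean energy (the weight's
Hamiltonian is its position operator) and momentum in the interval `(p₀ - δ, p₀ + δ)` up to
probability at most `δ`. -/
def IsNarrowWeight (ħ p₀ δ : ℝ) (ρ : Line →L[ℂ] Line) : Prop :=
  IsDensity ρ ∧ (∃ m, HasMean (fun y => y) ρ m) ∧
    ∃ r : ℝ, r ≤ δ ∧ HasTrace (momentumProjection ħ {p | δ ≤ |p - p₀|} ∘L ρ) r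

/-- States of the clock whose position is supported in the interval `[a, a + K]`. -/
def IsClockState (a K : ℝ) (ρ : Line →L[ℂ] Line) : Prop :=
  IsDensity ρ ∧ indicatorOp volume ℂ (Set.Icc a (a + K))ᶜ ∘L ρ = 0

variable {n : Type} [Fintype n]

/-- The Hilbert space `s ⊗ w ⊗ c` of system, weight and clock, as the space of square integrable
functions of the position `z.1` of the weight and `z.2` of the clock with values in `ℂⁿ`. -/
abbrev Total (n : Type) [Fintype n] : Type :=
  Lp (EuclideanSpace ℂ n) 2 (volume : Measure (ℝ × ℝ))

theorem memLp_productVector (v : EuclideanSpace ℂ n) (g h : Line) :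
    MemLp (fun z : ℝ × ℝ => (g z.1 * h z.2) • v) 2 (volume : Measure (ℝ × ℝ)) := by
  have hm : AEStronglyMeasurable (fun z : ℝ × ℝ => g z.1 * h z.2) (volume : Measure (ℝ × ℝ)) :=
    (Lp.aestronglyMeasurable g).comp_fst.mul (Lp.aestronglyMeasurable h).comp_snd
  have hs : MemLp (fun z : ℝ × ℝ => g z.1 * h z.2) 2 (volume : Measure (ℝ × ℝ)) := by
    rw [memLp_two_iff_integrable_sq_norm hm]
    simp only [norm_mul, mul_pow]
    exact Integrable.mul_prod
      ((memLp_two_iff_integrable_sq_norm (Lp.aestronglyMeasurable g)).1 (Lp.memLp g))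
      ((memLp_two_iff_integrable_sq_norm (Lp.aestronglyMeasurable h)).1 (Lp.memLp h))
  exact ContinuousLinearMap.comp_memLp'
    ((1 : ℂ →L[ℂ] ℂ).smulRight v) hs

/-- The product vector `v ⊗ g ⊗ h`. -/
def productVector (v : EuclideanSpace ℂ n) (g h : Line) : Total n :=
  (memLp_productVector v g h).toLp _

variable [DecidableEq n]

/-- `ρ = ρs ⊗ ρw ⊗ ρc`, expressed through matrix elements between product vectors (these span a
dense subspace). -/
def IsProductState (ρ : Total n →L[ℂ] Total n) (ρs : Matrix n n ℂ) (ρw ρc : Line →L[ℂ] Line) :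
    Prop :=
  ∀ (v v' : EuclideanSpace ℂ n) (g g' h h' : Line),
    ⟪productVector v g h, ρ (productVector v' g' h')⟫_ℂ =
      ⟪v, Matrix.toEuclideanCLM (𝕜 := ℂ) ρs v'⟫_ℂ * ⟪g, ρw g'⟫_ℂ * ⟪h, ρc h'⟫_ℂ

/-- `A ⊗ 1 ⊗ 1` for a matrix `A` acting on the system. -/
def systemOp (A : Matrix n n ℂ) : Total n →L[ℂ] Total n :=
  (Matrix.toEuclideanCLM (𝕜 := ℂ) A).compLpL 2 volume

/-- The reduced state of the system is `M`: `Tr (M A) = Tr ((A ⊗ 1 ⊗ 1) ρ)` for all `A`. -/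
def IsReducedState (ρ : Total n →L[ℂ] Total n) (M : Matrix n n ℂ) : Prop :=
  ∀ A : Matrix n n ℂ, HasTrace (systemOp A ∘L ρ) (trace (M * A))

/-- The operator `H_s + H_w + H_c` on smooth functions of compact support, where `H_w` is the
position operator of the weight and `H_c = -i ħ ∂` the momentum operator of the clock. -/
def freeHamiltonian (ħ : ℝ) (Hs : Matrix n n ℂ) (Φ : ℝ × ℝ → EuclideanSpace ℂ n) (z : ℝ × ℝ) :
    EuclideanSpace ℂ n :=
  Matrix.toEuclideanCLM (𝕜 := ℂ) Hs (Φ z) + (z.1 : ℂ) • Φ z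
    - (I * ħ) • fderiv ℝ Φ z ((0 : ℝ), (1 : ℝ))

/-- The graph of the total Hamiltonian `H_s + H_w + H_c + H_int` on the core of smooth functions of
compact support. For bounded self-adjoint `Hint` and Hermitian `Hs` it is essentially
self-adjoint there. -/
def hamiltonianGraph (ħ : ℝ) (Hs : Matrix n n ℂ) (Hint : Total n →L[ℂ] Total n) :
    Set (Total n × Total n) :=
  {x | ∃ (Φ : ℝ × ℝ → EuclideanSpace ℂ n) (χ : Total n),
    ContDiff ℝ ∞ Φ ∧ HasCompactSupport Φ ∧ x.1 =ᵐ[volume] Φ ∧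
      χ =ᵐ[volume] freeHamiltonian ħ Hs Φ ∧ x.2 = χ + Hint x.1}

/-- `U` is the strongly continuous one-parameter unitary group `exp (-i H t / ħ)` generated by the
total Hamiltonian. -/
def IsEvolution (ħ : ℝ) (Hs : Matrix n n ℂ) (Hint : Total n →L[ℂ] Total n)
    (U : ℝ → Total n ≃ₗᵢ[ℂ] Total n) : Prop :=
  (∀ s t ψ, U (s + t) ψ = U s (U t ψ)) ∧
  (∀ ψ, Continuous fun t => U t ψ) ∧
  ∀ x ∈ hamiltonianGraph ħ Hs Hint, HasDerivAt (fun t => U t x.1) (-(I / ħ) • x.2) 0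

/-- `U ρ U⁻¹`. -/
def evolve (U : Total n ≃ₗᵢ[ℂ] Total n) (ρ : Total n →L[ℂ] Total n) : Total n →L[ℂ] Total n :=
  (U.toContinuousLinearEquiv : Total n →L[ℂ] Total n) ∘L ρ ∘L
    (U.symm.toContinuousLinearEquiv : Total n →L[ℂ] Total n)

/-- `G` commutes with the bounded operator on `L²` that is given by `B` on functions. -/
def CommutesWith (G : Total n →L[ℂ] Total n)
    (B : (ℝ × ℝ → EuclideanSpace ℂ n) → ℝ × ℝ → EuclideanSpace ℂ n) : Prop :=
  ∀ Ψ Ψ' : Total n, Ψ' =ᵐ[volume] B Ψ → G Ψ' =ᵐ[volume] B (G Ψ)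

/-- Admissible interactions with interaction region `[b, b + L]`: bounded self-adjoint operators
that (strongly) commute with the engine Hamiltonian `H_e = H_s + H_w`, with the position of the
clock and with the momentum of the weight, and vanish while the clock is outside the region. -/
def IsInteraction (ħ : ℝ) (Hs : Matrix n n ℂ) (b L : ℝ) (Hint : Total n →L[ℂ] Total n) : Prop :=
  IsSelfAdjoint Hint ∧
  -- commutes with `exp (-i H_e t / ħ)`
  (∀ t : ℝ, CommutesWith Hint fun Ψ z =>
    cexp (-(I * t * z.1 / ħ)) • Matrix.toEuclideanCLM (𝕜 := ℂ) (propagator ħ Hs t) (Ψ z)) ∧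
  -- commutes with the translations `exp (-i P_w y / ħ)`
  (∀ y : ℝ, CommutesWith Hint fun Ψ z => Ψ (z.1 - y, z.2)) ∧
  -- commutes with the spectral projections of `X_c`
  (∀ S : Set ℝ, MeasurableSet S →
    Hint ∘L indicatorOp volume _ (Prod.snd ⁻¹' S) =
      indicatorOp volume _ (Prod.snd ⁻¹' S) ∘L Hint) ∧
  Hint ∘L indicatorOp volume _ (Prod.snd ⁻¹' (Set.Icc b (b + L))ᶜ) = 0

end Machine

end ClockEngine

end

open ClockEngine

/-! Part (1). The outer rotations make the state of `u` diagonal in the energy basis, so the swaps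
only permute energy labels. Subsystem and bath start in the product of the distributions r⁽⁰⁾ = p
and r⁽¹⁾, …, r⁽ᴺ⁾; each swap hands the current distribution of `u` to the next bath system. The
final state is therefore exactly σ ⊗ (r⁽⁰⁾, …, r⁽ᴺ⁻¹⁾) (`protocolUnitary_conj`). With bath levels
-kT log r⁽ʲ⁾ all partition functions are 1, and telescoping the entropies gives ΔE - ΔF = kT ∑ⱼ
D(r⁽ʲ⁻¹⁾ ‖ r⁽ʲ⁾), a sum of relative entropies (`energy_balance`). Each is nonnegative and at most
its χ² divergence. On the linear path r⁽ʲ⁾ = p + (j/N)(q - p) the steps are below 1/N and r⁽ʲ⁾ ≥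
(j/N) q, so the sum is O(log N / N), even if p has zeros (`dissipation_linearPath_le`).

Part (2) rests on an exactly solvable Hamiltonian. Let D = exp(-i H_s P_w / ħ), which moves the
weight by the energy of the system. Then D (H_s + X_w) D* = X_w, so for any self-adjoint G on the
system the interaction D* ħ f(X_c) G D commutes with H_e. If F' = f, then conjugation by exp(i G
F(X_c)) turns P_c + ħ f(X_c) G into P_c. Hence W = exp(i G F(X_c)) D conjugates the full Hamiltonian
to X_w + P_c, whose group is a phase times a clock translation (`isEvolution_machineGroup`). If F
goes from 0 to 1 across the interaction region, a clock that has passed it has applied exactly D*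
exp(-iG) D, up to free motion (`machineGroup_apply_of_support`).

On a weight of sharp momentum p₀, D acts as the system unitary Z = exp(-i H_s p₀ / ħ). Choosing G
with exp(-iG) = Z V Z* makes D* exp(-iG) D close to V for weights of narrow momentum
(`norm_machineGroup_sub_le`); the error is controlled in the Fourier representation
(`norm_shift_sub_sq_le`).

The work is not estimated from this approximation alone. In the frame of D the distribution of X_w
is exactly preserved, so the mean of H_s + X_w is conserved and the gain of the weight equals the
loss of H_s (`integral_ensembleDistribution_machineGroup`). Closeness of the reduced state then
compares this loss with -ΔE. Density operators are handled throughout as ensembles ∑ |uᵢ⟩⟨uᵢ| of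
vectors, so that traces and distributions become sums of vector quantities. -/

noncomputable section

set_option linter.unusedSectionVars false

namespace ClockEngine


/-! ### Multiplication operators and translations on `L²` -/

section Multiplication

variable {α F : Type} [MeasurableSpace α] {μ : Measure α}
  [NormedAddCommGroup F] [InnerProductSpace ℂ F]

/-- Bounded, strongly measurable families of operators. -/
def IsMultiplier (M : α → F →L[ℂ] F) : Prop :=
  StronglyMeasurable M ∧ ∃ C, ∀ z, ‖M z‖ ≤ C

theorem IsMultiplier.memLp {M : α → F →L[ℂ] F} (h : IsMultiplier M) (f : Lp F 2 μ) :
    MemLp (fun z => M z (f z)) 2 μ := by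
  obtain ⟨hM, C, hC⟩ := h
  refine MemLp.of_le_mul (Lp.memLp f) (c := C)
    ((ContinuousLinearMap.id ℂ (F →L[ℂ] F)).aestronglyMeasurable_comp₂
      hM.aestronglyMeasurable (Lp.aestronglyMeasurable f)) ?_
  exact .of_forall fun z => (M z).le_of_opNorm_le (hC z) _

open Classical in
/-- Multiplication by the operator-valued function `M`. -/
def multOp (μ : Measure α) (M : α → F →L[ℂ] F) : Lp F 2 μ →L[ℂ] Lp F 2 μ :=
  if h : IsMultiplier M then
    LinearMap.mkContinuous
      { toFun := fun f => (h.memLp f).toLp _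
        map_add' := fun f g => by
          rw [← MemLp.toLp_add]
          refine MemLp.toLp_congr _ _ ?_
          filter_upwards [Lp.coeFn_add f g] with x hx
          rw [hx, Pi.add_apply, map_add]; rfl
        map_smul' := fun c f => by
          rw [RingHom.id_apply, ← MemLp.toLp_const_smul]
          refine MemLp.toLp_congr _ _ ?_
          filter_upwards [Lp.coeFn_smul c f] with x hx
          rw [hx, Pi.smul_apply, map_smul]; rfl }
      h.2.choose (fun f => by
        refine Lp.norm_le_mul_norm_of_ae_le_mul ?_
        filter_upwards [(h.memLp f).coeFn_toLp] with x hx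
        rw [LinearMap.coe_mk, AddHom.coe_mk, hx]
        exact (M x).le_of_opNorm_le (h.2.choose_spec x) _)
  else 0

theorem coeFn_multOp {M : α → F →L[ℂ] F} (h : IsMultiplier M) (f : Lp F 2 μ) :
    multOp μ M f =ᵐ[μ] fun z => M z (f z) := by
  rw [multOp, dif_pos h]
  exact (h.memLp f).coeFn_toLp

theorem isMultiplier_const (A : F →L[ℂ] F) : IsMultiplier (fun _ : α => A) :=
  ⟨stronglyMeasurable_const, ‖A‖, fun _ => le_rfl⟩

theorem IsMultiplier.mul {M N : α → F →L[ℂ] F} (hM : IsMultiplier M) (hN : IsMultiplier N) :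
    IsMultiplier fun z => M z * N z := by
  obtain ⟨hM, C, hC⟩ := hM
  obtain ⟨hN, C', hC'⟩ := hN
  refine ⟨hM.mul hN, C * C', fun z => (norm_mul_le _ _).trans ?_⟩
  exact mul_le_mul (hC z) (hC' z) (norm_nonneg _) ((norm_nonneg _).trans (hC z))

theorem IsMultiplier.star [CompleteSpace F] {M : α → F →L[ℂ] F} (hM : IsMultiplier M) :
    IsMultiplier fun z => star (M z) := by
  obtain ⟨hM, C, hC⟩ := hM
  exact ⟨hM.star, C, fun z => by rw [norm_star]; exact hC z⟩

theorem IsMultiplier.comp {β : Type} [MeasurableSpace β] {M : α → F →L[ℂ] F}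
    (hM : IsMultiplier M) {τ : β → α} (hτ : Measurable τ) : IsMultiplier fun z => M (τ z) := by
  obtain ⟨hM, C, hC⟩ := hM
  exact ⟨hM.comp_measurable hτ, C, fun z => hC _⟩

theorem isMultiplier_smul_one {c : α → ℂ} (hc : StronglyMeasurable c) {C : ℝ}
    (hC : ∀ z, ‖c z‖ ≤ C) : IsMultiplier fun z => c z • (1 : F →L[ℂ] F) := by
  refine ⟨hc.smul_const _, C * ‖(1 : F →L[ℂ] F)‖, fun z => ?_⟩
  rw [norm_smul]
  exact mul_le_mul_of_nonneg_right (hC z) (norm_nonneg _)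

theorem multOp_mul {M N : α → F →L[ℂ] F} (hM : IsMultiplier M) (hN : IsMultiplier N) :
    multOp μ M * multOp μ N = multOp μ fun z => M z * N z := by
  ext1 f
  refine Lp.ext ?_
  filter_upwards [coeFn_multOp hM (multOp μ N f), coeFn_multOp hN f,
    coeFn_multOp (hM.mul hN) f] with z h1 h2 h3
  rw [mul_apply_eq_comp, h1, h2, h3, mul_apply_eq_comp]

theorem star_multOp [CompleteSpace F] {M : α → F →L[ℂ] F} (hM : IsMultiplier M) :
    star (multOp μ M) = multOp μ fun z => star (M z) := by
  rw [ContinuousLinearMap.star_eq_adjoint, eq_comm, ContinuousLinearMap.eq_adjoint_iff]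
  intro f g
  rw [L2.inner_def, L2.inner_def]
  refine integral_congr_ae ?_
  filter_upwards [coeFn_multOp hM.star f, coeFn_multOp hM g] with z h1 h2
  rw [h1, h2, ContinuousLinearMap.star_eq_adjoint, ContinuousLinearMap.adjoint_inner_left]

theorem multOp_one : multOp μ (fun _ => (1 : F →L[ℂ] F)) = 1 := by
  ext1 f
  refine Lp.ext ?_
  filter_upwards [coeFn_multOp (isMultiplier_const 1) f] with z h
  rw [h]; rfl

theorem multOp_add {M N : α → F →L[ℂ] F} (hM : IsMultiplier M) (hN : IsMultiplier N)
    (hMN : IsMultiplier fun z => M z + N z) :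
    multOp μ M + multOp μ N = multOp μ fun z => M z + N z := by
  ext1 f
  refine Lp.ext ?_
  rw [_root_.add_apply]
  filter_upwards [coeFn_multOp hM f, coeFn_multOp hN f, coeFn_multOp hMN f,
    Lp.coeFn_add (multOp μ M f) (multOp μ N f)] with z h1 h2 h3 h4
  rw [h4, Pi.add_apply, h1, h2, h3, _root_.add_apply]

theorem compLpL_eq_multOp (A : F →L[ℂ] F) : A.compLpL 2 μ = multOp μ fun _ => A := by
  ext1 f
  refine Lp.ext ?_
  filter_upwards [coeFn_multOp (isMultiplier_const A) f, A.coeFn_compLpL f] with z h h'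
  rw [h, h']

theorem isMultiplier_indicator {S : Set α} (hS : MeasurableSet S) :
    IsMultiplier (S.indicator fun _ => (1 : F →L[ℂ] F)) := by
  refine ⟨stronglyMeasurable_const.indicator hS, ‖(1 : F →L[ℂ] F)‖, fun z => ?_⟩
  exact norm_indicator_le_norm_self (fun _ => (1 : F →L[ℂ] F)) z

theorem indicatorOp_eq_multOp {S : Set α} (hS : MeasurableSet S) :
    indicatorOp μ F S = multOp μ (S.indicator fun _ => (1 : F →L[ℂ] F)) := by
  ext1 f
  refine Lp.ext ?_
  have : indicatorOp μ F S f = ((Lp.memLp f).indicator hS).toLp _ := by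
    rw [indicatorOp, dif_pos hS]; rfl
  rw [this]
  filter_upwards [coeFn_multOp (isMultiplier_indicator hS) f,
    ((Lp.memLp f).indicator hS).coeFn_toLp] with z h h'
  rw [h, h']
  by_cases hz : z ∈ S <;> simp [hz]

theorem coeFn_indicatorOp {S : Set α} (hS : MeasurableSet S) (f : Lp F 2 μ) :
    indicatorOp μ F S f =ᵐ[μ] S.indicator f := by
  rw [indicatorOp_eq_multOp hS]
  filter_upwards [coeFn_multOp (isMultiplier_indicator hS) f] with z h
  rw [h]
  by_cases hz : z ∈ S <;> simp [hz]

theorem norm_multOp_apply_le {M : α → F →L[ℂ] F} (hM : IsMultiplier M) {C : ℝ}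
    (hC : ∀ z, ‖M z‖ ≤ C) (f : Lp F 2 μ) : ‖multOp μ M f‖ ≤ C * ‖f‖ := by
  refine Lp.norm_le_mul_norm_of_ae_le_mul ?_
  filter_upwards [coeFn_multOp hM f] with z hz
  rw [hz]
  exact (M z).le_of_opNorm_le (hC z) _

theorem multOp_mem_unitary [CompleteSpace F] {M : α → F →L[ℂ] F} (hM : IsMultiplier M)
    (h : ∀ z, M z ∈ unitary (F →L[ℂ] F)) : multOp μ M ∈ unitary (Lp F 2 μ →L[ℂ] Lp F 2 μ) := by
  rw [Unitary.mem_iff, star_multOp hM, multOp_mul hM.star hM, multOp_mul hM hM.star]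
  simp only [Unitary.star_mul_self_of_mem (h _), Unitary.mul_star_self_of_mem (h _), multOp_one,
    and_self]

end Multiplication

/-! ### Translations of square integrable functions -/

section Shift

variable {α F : Type} [AddCommGroup α] [MeasurableSpace α] [MeasurableAdd α] {μ : Measure α} [μ.IsAddRightInvariant]
  [NormedAddCommGroup F] [InnerProductSpace ℂ F]

/-- Translation by `w`: `(shift w f) z = f (z - w)`. -/
def shift (μ : Measure α) [μ.IsAddRightInvariant] (F : Type) [NormedAddCommGroup F]
    [InnerProductSpace ℂ F] (w : α) : Lp F 2 μ →L[ℂ] Lp F 2 μ :=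
  (Lp.compMeasurePreservingₗᵢ ℂ (fun z => z - w)
    (measurePreserving_sub_right μ w)).toContinuousLinearMap

theorem coeFn_shift (w : α) (f : Lp F 2 μ) : shift μ F w f =ᵐ[μ] fun z => f (z - w) :=
  Lp.coeFn_compMeasurePreserving f (measurePreserving_sub_right μ w)

theorem ae_sub_right {p : α → Prop} (w : α) (h : ∀ᵐ z ∂μ, p z) : ∀ᵐ z ∂μ, p (z - w) :=
  (measurePreserving_sub_right μ w).quasiMeasurePreserving.ae h

theorem shift_add (v w : α) : shift μ F (v + w) = shift μ F v * shift μ F w := by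
  ext1 f
  refine Lp.ext ?_
  filter_upwards [coeFn_shift (v + w) f, coeFn_shift v (shift μ F w f),
    ae_sub_right v (coeFn_shift w f)] with z h1 h2 h3
  rw [h1, mul_apply_eq_comp, h2, h3, sub_sub]

theorem shift_zero : shift μ F 0 = 1 := by
  ext1 f
  refine Lp.ext ?_
  filter_upwards [coeFn_shift 0 f] with z h1
  rw [h1, sub_zero]; rfl

theorem norm_shift_apply (w : α) (f : Lp F 2 μ) : ‖shift μ F w f‖ = ‖f‖ :=
  LinearIsometry.norm_map _ _

theorem star_shift [CompleteSpace F] (w : α) : star (shift μ F w) = shift μ F (-w) := by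
  rw [ContinuousLinearMap.star_eq_adjoint, eq_comm, ContinuousLinearMap.eq_adjoint_iff]
  intro f g
  -- An isometry preserves inner products, so the adjoint is found by writing the left argument as a
  -- translate.
  have h : f = shift μ F w (shift μ F (-w) f) := by
    rw [← mul_apply_eq_comp, ← shift_add, add_neg_cancel, shift_zero]; rfl
  conv_rhs => rw [h]
  exact ((LinearMap.norm_map_iff_inner_map_map (shift μ F w)).1 (norm_shift_apply w) _ _).symm

/-- Source of the commutation relations between multipliers and translations: a multiplier passes a
translation with its argument moved, and so commutes with it as soon as it is invariant under it. -/
theorem shift_mul_multOp (w : α) {M : α → F →L[ℂ] F} (hM : IsMultiplier M) :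
    shift μ F w * multOp μ M = multOp μ (fun z => M (z - w)) * shift μ F w := by
  ext1 f
  refine Lp.ext ?_
  have hM' : IsMultiplier fun z => M (z - w) := hM.comp (measurable_sub_const' w)
  filter_upwards [coeFn_shift w (multOp μ M f), coeFn_shift w f,
    ae_sub_right w (coeFn_multOp hM f), coeFn_multOp hM' (shift μ F w f)] with z h1 h2 h3 h4
  rw [mul_apply_eq_comp, mul_apply_eq_comp, h1, h3, h4, h2]

end Shift

theorem continuous_shift {α F : Type} [NormedAddCommGroup α] [MeasurableSpace α] [BorelSpace α]
    [SecondCountableTopology α] [LocallyCompactSpace α]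
    {μ : Measure α} [μ.IsAddRightInvariant] [μ.Regular]
    [NormedAddCommGroup F] [InnerProductSpace ℂ F] (f : Lp F 2 μ) :
    Continuous fun w : α => shift μ F w f := by
  let g : α → C(α, α) := fun w => ⟨fun z => z - w, by fun_prop⟩
  have hg : Continuous g := ContinuousMap.continuous_of_continuous_uncurry _ (by
    simp only [g, Function.uncurry_def, ContinuousMap.coe_mk]; fun_prop)
  exact (continuous_const (y := f)).compMeasurePreservingLp hg
    (fun w => measurePreserving_sub_right μ w) ENNReal.ofNat_ne_top


/-! ### Matrices and orthonormal bases -/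

section Matrices

variable {n : Type} [Fintype n]

/-- The unitary matrix whose columns are the vectors of the orthonormal basis `v`. -/
def basisMatrix (v : OrthonormalBasis n ℂ (EuclideanSpace ℂ n)) : Matrix n n ℂ :=
  Matrix.of fun a i => v i a

theorem conjTranspose_basisMatrix_mul (v w : OrthonormalBasis n ℂ (EuclideanSpace ℂ n)) (i j : n) :
    ((basisMatrix v)ᴴ * basisMatrix w) i j = ⟪v i, w j⟫_ℂ := by
  simp [basisMatrix, Matrix.mul_apply, PiLp.inner_apply, mul_comm]

theorem ketBra_sum (v w : OrthonormalBasis n ℂ (EuclideanSpace ℂ n)) :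
    ∑ i, ketBra (w i) (v i) = basisMatrix w * (basisMatrix v)ᴴ := by
  ext a b
  simp [Matrix.sum_apply, ketBra, vecMulVec_apply, Matrix.mul_apply, basisMatrix]

variable [DecidableEq n]

theorem basisMatrix_mem_unitary (v : OrthonormalBasis n ℂ (EuclideanSpace ℂ n)) :
    basisMatrix v ∈ Matrix.unitaryGroup n ℂ := by
  rw [Matrix.mem_unitaryGroup_iff', star_eq_conjTranspose]
  ext i j
  rw [conjTranspose_basisMatrix_mul, orthonormal_iff_ite.1 v.orthonormal, Matrix.one_apply]

theorem basisMatrix_conjTranspose_mul_self (v : OrthonormalBasis n ℂ (EuclideanSpace ℂ n)) :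
    (basisMatrix v)ᴴ * basisMatrix v = 1 :=
  Matrix.mem_unitaryGroup_iff'.1 (basisMatrix_mem_unitary v)

theorem basisMatrix_mul_conjTranspose_self (v : OrthonormalBasis n ℂ (EuclideanSpace ℂ n)) :
    basisMatrix v * (basisMatrix v)ᴴ = 1 :=
  Matrix.mem_unitaryGroup_iff.1 (basisMatrix_mem_unitary v)

theorem eq_basisMatrix_mul_diagonal {M : Matrix n n ℂ}
    {v : OrthonormalBasis n ℂ (EuclideanSpace ℂ n)} {c : n → ℂ}
    (h : ∀ i, Matrix.toEuclideanCLM (𝕜 := ℂ) M (v i) = c i • v i) :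
    M = basisMatrix v * diagonal c * (basisMatrix v)ᴴ := by
  have h1 : M * basisMatrix v = basisMatrix v * diagonal c := by
    ext a i
    have := congrArg (fun x : EuclideanSpace ℂ n => x a) (h i)
    simp only [Matrix.ofLp_toEuclideanCLM, PiLp.smul_apply, smul_eq_mul] at this
    rw [Matrix.mul_diagonal, mul_comm]
    exact this
  rw [← h1, Matrix.mul_assoc, basisMatrix_mul_conjTranspose_self, Matrix.mul_one]

theorem toEuclideanCLM_basisMatrix_diagonal (v : OrthonormalBasis n ℂ (EuclideanSpace ℂ n))
    (c : n → ℂ) (i : n) :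
    Matrix.toEuclideanCLM (𝕜 := ℂ) (basisMatrix v * diagonal c * (basisMatrix v)ᴴ) (v i)
      = c i • v i := by
  have h1 : (basisMatrix v * diagonal c * (basisMatrix v)ᴴ) * basisMatrix v
      = basisMatrix v * diagonal c := by
    rw [Matrix.mul_assoc, basisMatrix_conjTranspose_mul_self, Matrix.mul_one]
  ext a
  have := congrFun (congrFun h1 a) i
  rw [Matrix.mul_diagonal, mul_comm _ (c i)] at this
  simp only [Matrix.ofLp_toEuclideanCLM, PiLp.smul_apply, smul_eq_mul]
  exact this

theorem exp_smul_of_eigenbasis {M : Matrix n n ℂ}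
    {v : OrthonormalBasis n ℂ (EuclideanSpace ℂ n)} {c : n → ℂ}
    (h : ∀ i, Matrix.toEuclideanCLM (𝕜 := ℂ) M (v i) = c i • v i) (s : ℂ) (i : n) :
    Matrix.toEuclideanCLM (𝕜 := ℂ) (NormedSpace.exp (s • M)) (v i) = cexp (s * c i) • v i := by
  have hB : (basisMatrix v)⁻¹ = (basisMatrix v)ᴴ :=
    Matrix.inv_eq_right_inv (basisMatrix_mul_conjTranspose_self v)
  have hU : IsUnit (basisMatrix v) :=
    (Matrix.isUnit_iff_isUnit_det _).2 (Matrix.isUnit_det_of_right_inverse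
      (basisMatrix_mul_conjTranspose_self v))
  have : s • M = basisMatrix v * diagonal (fun i => s * c i) * (basisMatrix v)⁻¹ := by
    rw [eq_basisMatrix_mul_diagonal h, hB, ← Matrix.smul_mul, ← Matrix.mul_smul,
      ← Matrix.diagonal_smul]
    rfl
  rw [this, Matrix.exp_conj _ _ hU, Matrix.exp_diagonal, hB, toEuclideanCLM_basisMatrix_diagonal,
    Pi.exp_def, Complex.exp_eq_exp_ℂ]

/-- The eigenvalues `hM.eigenvalues` carry their own ordering, whereas `p` is labelled by an
arbitrary eigenbasis. Both list the roots of the characteristic polynomial with multiplicity, so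
symmetric sums agree. -/
theorem sum_eigenvalues_eq {M : Matrix n n ℂ} (hM : M.IsHermitian)
    {v : OrthonormalBasis n ℂ (EuclideanSpace ℂ n)} {p : n → ℝ} (h : IsEigenbasis M v p)
    (f : ℝ → ℝ) : ∑ i, f (hM.eigenvalues i) = ∑ i, f (p i) := by
  have h1 : M = basisMatrix v * diagonal (fun i => (p i : ℂ)) * (basisMatrix v)ᴴ :=
    eq_basisMatrix_mul_diagonal h
  have h2 : M.charpoly = (diagonal (fun i => (p i : ℂ))).charpoly := by
    rw [h1, Matrix.charpoly_mul_comm, ← Matrix.mul_assoc, basisMatrix_conjTranspose_mul_self,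
      Matrix.one_mul]
  have h3 := hM.roots_charpoly_eq_eigenvalues
  rw [h2, Matrix.charpoly_diagonal, Polynomial.roots_prod _ _
    (by simp [Finset.prod_ne_zero_iff, Polynomial.X_sub_C_ne_zero])] at h3
  simp only [Polynomial.roots_X_sub_C, Multiset.bind_singleton] at h3
  have h4 := congrArg (fun s : Multiset ℂ => (s.map fun z => f z.re).sum) h3
  simpa [Multiset.map_map, Function.comp_def] using h4.symm

/-- A crude bound suffices in finite dimension: every singular value is at most the Frobenius norm,
hence at most `card n * η`. -/
theorem traceNorm_le_of_entries {M : Matrix n n ℂ} {η : ℝ} (hη : 0 ≤ η)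
    (h : ∀ a b, ‖M a b‖ ≤ η) : traceNorm M ≤ (Fintype.card n) ^ 2 * η := by
  set hH := isHermitian_conjTranspose_mul_self M
  have h0 : ∀ i, 0 ≤ hH.eigenvalues i := (posSemidef_conjTranspose_mul_self M).eigenvalues_nonneg
  have h1 : ∑ i, hH.eigenvalues i ≤ (Fintype.card n * η) ^ 2 := by
    have := hH.trace_eq_sum_eigenvalues
    have h2 : (trace (Mᴴ * M)).re = ∑ i, hH.eigenvalues i := by rw [this]; simp
    rw [← h2, Matrix.trace, Complex.re_sum]
    have h3 : ∀ i ∈ (Finset.univ : Finset n), ((Mᴴ * M).diag i).re ≤ Fintype.card n * η ^ 2 := by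
      intro i _
      rw [Matrix.diag_apply, Matrix.mul_apply, Complex.re_sum, ← nsmul_eq_mul,
        ← Finset.card_univ]
      refine Finset.sum_le_card_nsmul _ _ _ fun a _ => ?_
      rw [conjTranspose_apply, RCLike.star_def, ← Complex.normSq_eq_conj_mul_self, ofReal_re,
        Complex.normSq_eq_norm_sq]
      exact pow_le_pow_left₀ (norm_nonneg _) (h a i) 2
    refine (Finset.sum_le_card_nsmul _ _ _ h3).trans (le_of_eq ?_)
    rw [nsmul_eq_mul, Finset.card_univ]; ring
  have h2 : ∀ i ∈ (Finset.univ : Finset n), √(hH.eigenvalues i) ≤ Fintype.card n * η := by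
    intro i _
    rw [Real.sqrt_le_left (by positivity)]
    exact (Finset.single_le_sum (fun i _ => h0 i) (Finset.mem_univ i)).trans h1
  refine (Finset.sum_le_card_nsmul _ _ _ h2).trans (le_of_eq ?_)
  rw [nsmul_eq_mul, Finset.card_univ]; ring

end Matrices


/-! ### Operators of the machine -/

section Internal

variable {n : Type} [Fintype n]

/-- The operator `A ⊗ 1 ⊗ 1`. -/
def internalOp (A : EuclideanSpace ℂ n →L[ℂ] EuclideanSpace ℂ n) : Total n →L[ℂ] Total n :=
  multOp volume fun _ => A

theorem coeFn_internalOp (A : EuclideanSpace ℂ n →L[ℂ] EuclideanSpace ℂ n) (Ψ : Total n) :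
    internalOp A Ψ =ᵐ[volume] fun z => A (Ψ z) :=
  coeFn_multOp (isMultiplier_const A) Ψ

theorem internalOp_mul (A B : EuclideanSpace ℂ n →L[ℂ] EuclideanSpace ℂ n) :
    internalOp (A * B) = internalOp A * internalOp B :=
  (multOp_mul (isMultiplier_const A) (isMultiplier_const B)).symm

theorem internalOp_add (A B : EuclideanSpace ℂ n →L[ℂ] EuclideanSpace ℂ n) :
    internalOp (A + B) = internalOp A + internalOp B :=
  (multOp_add (isMultiplier_const A) (isMultiplier_const B) (isMultiplier_const (A + B))).symm

theorem internalOp_smul (c : ℂ) (A : EuclideanSpace ℂ n →L[ℂ] EuclideanSpace ℂ n) :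
    internalOp (c • A) = c • internalOp A := by
  ext1 Ψ
  refine Lp.ext ?_
  filter_upwards [coeFn_internalOp (c • A) Ψ, coeFn_internalOp A Ψ,
    Lp.coeFn_smul c (internalOp A Ψ)] with z h1 h2 h3
  rw [h1, _root_.smul_apply, _root_.smul_apply, h3, Pi.smul_apply, h2]

theorem internalOp_one :
    internalOp (1 : EuclideanSpace ℂ n →L[ℂ] EuclideanSpace ℂ n) = 1 := multOp_one

theorem star_internalOp (A : EuclideanSpace ℂ n →L[ℂ] EuclideanSpace ℂ n) :
    star (internalOp A) = internalOp (star A) := star_multOp (isMultiplier_const A)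

/-- `A ↦ A ⊗ 1 ⊗ 1` as an additive map. -/
def internalOpHom : (EuclideanSpace ℂ n →L[ℂ] EuclideanSpace ℂ n) →+ (Total n →L[ℂ] Total n) :=
  AddMonoidHom.mk' internalOp internalOp_add

theorem internalOp_sum {ι : Type} (s : Finset ι)
    (A : ι → EuclideanSpace ℂ n →L[ℂ] EuclideanSpace ℂ n) :
    internalOp (∑ i ∈ s, A i) = ∑ i ∈ s, internalOp (A i) :=
  map_sum internalOpHom A s

theorem internalOp_zero :
    internalOp (0 : EuclideanSpace ℂ n →L[ℂ] EuclideanSpace ℂ n) = 0 := map_zero internalOpHom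

theorem systemOp_eq_internalOp [DecidableEq n] (A : Matrix n n ℂ) :
    systemOp A = internalOp (Matrix.toEuclideanCLM (𝕜 := ℂ) A) :=
  compLpL_eq_multOp _

theorem norm_internalOp_apply_le (A : EuclideanSpace ℂ n →L[ℂ] EuclideanSpace ℂ n) (Ψ : Total n) :
    ‖internalOp A Ψ‖ ≤ ‖A‖ * ‖Ψ‖ :=
  norm_multOp_apply_le (isMultiplier_const A) (fun _ => le_rfl) Ψ

/-- Translation of weight and clock. -/
abbrev translate (n : Type) [Fintype n] (w : ℝ × ℝ) : Total n →L[ℂ] Total n :=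
  shift volume (EuclideanSpace ℂ n) w

theorem translate_mul_internalOp (w : ℝ × ℝ)
    (A : EuclideanSpace ℂ n →L[ℂ] EuclideanSpace ℂ n) :
    translate n w * internalOp A = internalOp A * translate n w :=
  shift_mul_multOp w (isMultiplier_const A)

/-! ### Spectral projections of the system and translations conditioned on them -/

variable (v : OrthonormalBasis n ℂ (EuclideanSpace ℂ n))

/-- The projection on the `m`-th basis vector. -/
def basisProj (m : n) : EuclideanSpace ℂ n →L[ℂ] EuclideanSpace ℂ n :=
  InnerProductSpace.rankOne ℂ (v m) (v m)

theorem basisProj_apply (m : n) (x : EuclideanSpace ℂ n) :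
    basisProj v m x = ⟪v m, x⟫_ℂ • v m := rfl

theorem basisProj_mul [DecidableEq n] (m m' : n) :
    basisProj v m * basisProj v m' = if m = m' then basisProj v m else 0 := by
  ext1 x
  rw [mul_apply_eq_comp, basisProj_apply, basisProj_apply, inner_smul_right,
    orthonormal_iff_ite.1 v.orthonormal]
  split_ifs with h
  · rw [h, basisProj_apply, mul_one]
  · simp

theorem star_basisProj (m : n) : star (basisProj v m) = basisProj v m :=
  InnerProductSpace.adjoint_rankOne _ _

theorem sum_basisProj : ∑ m, basisProj v m = 1 := by
  ext1 x
  rw [_root_.sum_apply]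
  exact v.sum_repr' x

/-- The operator with eigenvalues `c` and eigenbasis `v`. -/
def spectralOp (c : n → ℂ) : EuclideanSpace ℂ n →L[ℂ] EuclideanSpace ℂ n :=
  ∑ m, c m • basisProj v m

variable [DecidableEq n]

theorem basisProj_mul_spectralOp (c : n → ℂ) (m : n) :
    basisProj v m * spectralOp v c = c m • basisProj v m := by
  rw [spectralOp, Finset.mul_sum, Finset.sum_eq_single m]
  · rw [mul_smul_comm, basisProj_mul, if_pos rfl]
  · intro m' _ h
    rw [mul_smul_comm, basisProj_mul, if_neg h.symm]
    exact smul_zero (A := EuclideanSpace ℂ n →L[ℂ] EuclideanSpace ℂ n) (c m')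
  · simp

theorem spectralOp_mul_basisProj (c : n → ℂ) (m : n) :
    spectralOp v c * basisProj v m = c m • basisProj v m := by
  rw [spectralOp, Finset.sum_mul, Finset.sum_eq_single m]
  · rw [smul_mul_assoc, basisProj_mul, if_pos rfl]
  · intro m' _ h
    rw [smul_mul_assoc, basisProj_mul, if_neg h]
    exact smul_zero (A := EuclideanSpace ℂ n →L[ℂ] EuclideanSpace ℂ n) (c m')
  · simp

theorem spectralOp_mul (c c' : n → ℂ) :
    spectralOp v c * spectralOp v c' = spectralOp v fun m => c m * c' m := by
  conv_lhs => rw [spectralOp, Finset.sum_mul]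
  simp only [smul_mul_assoc, basisProj_mul_spectralOp, smul_smul]
  rfl

theorem eq_spectralOp {A : EuclideanSpace ℂ n →L[ℂ] EuclideanSpace ℂ n} {c : n → ℂ}
    (h : ∀ m, A (v m) = c m • v m) : A = spectralOp v c := by
  have : A * 1 = spectralOp v c := by
    rw [← sum_basisProj v, Finset.mul_sum, spectralOp]
    refine Finset.sum_congr rfl fun m _ => ?_
    ext1 x
    rw [mul_apply_eq_comp, basisProj_apply, map_smul, h, _root_.smul_apply,
      basisProj_apply, smul_comm]
  rwa [mul_one] at this

theorem toEuclideanCLM_propagator {ħ : ℝ} {Hs : Matrix n n ℂ} {en : n → ℝ}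
    (h : IsEigenbasis Hs v en) (t : ℝ) : Matrix.toEuclideanCLM (𝕜 := ℂ) (propagator ħ Hs t) =
      spectralOp v fun m => cexp (-(I * t / ħ) * en m) :=
  eq_spectralOp v fun m => exp_smul_of_eigenbasis h _ m

/-- Translation by `c m` of weight and clock, if the system is in the state `v m`. -/
def conditionalShift (c : n → ℝ × ℝ) : Total n →L[ℂ] Total n :=
  ∑ m, internalOp (basisProj v m) * translate n (c m)

/-- The mixed terms vanish by orthogonality of the projections, so conditional shifts compose by
adding the shifts level by level. Unitarity and inverses follow from this. -/
theorem conditionalShift_mul (c c' : n → ℝ × ℝ) :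
    conditionalShift v c * conditionalShift v c' = conditionalShift v fun m => c m + c' m := by
  have : ∀ m m', internalOp (basisProj v m) * translate n (c m) *
      (internalOp (basisProj v m') * translate n (c' m')) =
      if m = m' then internalOp (basisProj v m) * translate n (c m + c' m) else 0 := by
    intro m m'
    rw [mul_assoc, ← mul_assoc (translate n (c m)), translate_mul_internalOp, mul_assoc,
      ← shift_add, ← mul_assoc, ← internalOp_mul, basisProj_mul]
    split_ifs with h
    · rw [h]
    · rw [internalOp_zero, zero_mul]
  simp [conditionalShift, Finset.sum_mul_sum, this]

theorem conditionalShift_zero : conditionalShift v (fun _ => 0) = 1 := by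
  simp [conditionalShift, shift_zero, ← internalOp_sum, sum_basisProj, internalOp_one]

theorem star_conditionalShift (c : n → ℝ × ℝ) :
    star (conditionalShift v c) = conditionalShift v fun m => -c m := by
  simp [conditionalShift, star_mul, star_internalOp, star_basisProj, star_shift,
    translate_mul_internalOp]

theorem conditionalShift_mem_unitary (c : n → ℝ × ℝ) :
    conditionalShift v c ∈ unitary (Total n →L[ℂ] Total n) := by
  rw [Unitary.mem_iff, star_conditionalShift, conditionalShift_mul, conditionalShift_mul]
  simp [conditionalShift_zero]

theorem conditionalShift_commute_internalOp (c : n → ℝ × ℝ)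
    {A : EuclideanSpace ℂ n →L[ℂ] EuclideanSpace ℂ n} (hA : ∀ m, Commute A (basisProj v m)) :
    conditionalShift v c * internalOp A = internalOp A * conditionalShift v c := by
  rw [conditionalShift, Finset.sum_mul, Finset.mul_sum]
  refine Finset.sum_congr rfl fun m _ => ?_
  rw [mul_assoc, translate_mul_internalOp, ← mul_assoc, ← mul_assoc, ← internalOp_mul,
    ← internalOp_mul, (hA m).eq]

theorem commute_spectralOp_basisProj (c : n → ℂ) (m : n) :
    Commute (spectralOp v c) (basisProj v m) := by
  rw [Commute, SemiconjBy, basisProj_mul_spectralOp, spectralOp_mul_basisProj]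

theorem conditionalShift_commute_multOp (c : n → ℝ × ℝ)
    {M : ℝ × ℝ → EuclideanSpace ℂ n →L[ℂ] EuclideanSpace ℂ n} (hM : IsMultiplier M)
    (hc : ∀ m z, M (z - c m) = M z) (hP : ∀ m z, Commute (basisProj v m) (M z)) :
    conditionalShift v c * multOp volume M = multOp volume M * conditionalShift v c := by
  rw [conditionalShift, Finset.sum_mul, Finset.mul_sum]
  refine Finset.sum_congr rfl fun m _ => ?_
  rw [mul_assoc, shift_mul_multOp _ hM, ← mul_assoc, ← mul_assoc, internalOp,
    multOp_mul (isMultiplier_const _) (hM.comp (by fun_prop)), multOp_mul hM (isMultiplier_const _)]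
  simp only [hc, (hP m _).eq]

theorem conditionalShift_commute_translate (c : n → ℝ × ℝ) (w : ℝ × ℝ) :
    conditionalShift v c * translate n w = translate n w * conditionalShift v c := by
  rw [conditionalShift, Finset.sum_mul, Finset.mul_sum]
  refine Finset.sum_congr rfl fun m _ => ?_
  rw [mul_assoc, ← shift_add, add_comm, shift_add, ← mul_assoc, ← translate_mul_internalOp,
    mul_assoc]

end Internal

/-! ### Free motion of weight and clock -/

section Free

variable {n : Type} [Fintype n]

theorem norm_cexp_neg_I_mul (r : ℝ) : ‖cexp (-(I * r))‖ = 1 := by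
  rw [← mul_neg, mul_comm, ← ofReal_neg, Complex.norm_exp_ofReal_mul_I]

theorem norm_phase (ħ t x : ℝ) : ‖cexp (-(I * t * x / ħ))‖ = 1 := by
  rw [← norm_cexp_neg_I_mul (t * x / ħ)]; push_cast; congr 3; ring

theorem isMultiplier_phase (ħ t : ℝ) : IsMultiplier fun z : ℝ × ℝ =>
    cexp (-(I * t * z.1 / ħ)) • (1 : EuclideanSpace ℂ n →L[ℂ] EuclideanSpace ℂ n) := by
  refine isMultiplier_smul_one (C := 1) ?_ fun z => (norm_phase ħ t z.1).le
  exact Continuous.stronglyMeasurable (by fun_prop)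

/-- `exp (-i X_w t / ħ)`. -/
def phaseOp (n : Type) [Fintype n] (ħ t : ℝ) : Total n →L[ℂ] Total n :=
  multOp volume fun z => cexp (-(I * t * z.1 / ħ)) • 1

theorem coeFn_phaseOp (ħ t : ℝ) (Ψ : Total n) :
    phaseOp n ħ t Ψ =ᵐ[volume] fun z => cexp (-(I * t * z.1 / ħ)) • Ψ z :=
  coeFn_multOp (isMultiplier_phase ħ t) Ψ

theorem phaseOp_add (ħ s t : ℝ) : phaseOp n ħ (s + t) = phaseOp n ħ s * phaseOp n ħ t := by
  rw [phaseOp, phaseOp, phaseOp, multOp_mul (isMultiplier_phase ħ s) (isMultiplier_phase ħ t)]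
  congr 1
  funext z
  rw [smul_mul_smul_comm, mul_one, ← Complex.exp_add]
  congr 2
  push_cast; ring

theorem phaseOp_zero (ħ : ℝ) : phaseOp n ħ 0 = 1 := by
  rw [phaseOp]; simp [multOp_one]

theorem star_phaseOp (ħ t : ℝ) : star (phaseOp n ħ t) = phaseOp n ħ (-t) := by
  rw [phaseOp, star_multOp (isMultiplier_phase ħ t), phaseOp]
  congr 1
  funext z
  rw [star_smul, star_one, RCLike.star_def, ← Complex.exp_conj]
  congr 2
  simp

theorem phaseOp_mul_internalOp (ħ t : ℝ) (A : EuclideanSpace ℂ n →L[ℂ] EuclideanSpace ℂ n) :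
    phaseOp n ħ t * internalOp A = internalOp A * phaseOp n ħ t := by
  rw [phaseOp, internalOp, multOp_mul (isMultiplier_phase ħ t) (isMultiplier_const A),
    multOp_mul (isMultiplier_const A) (isMultiplier_phase ħ t)]
  simp

theorem translate_clock_mul_phaseOp (ħ s t : ℝ) :
    translate n (0, s) * phaseOp n ħ t = phaseOp n ħ t * translate n (0, s) := by
  rw [phaseOp, shift_mul_multOp _ (isMultiplier_phase ħ t)]
  simp

/-- The Weyl relation between position and momentum of the weight. When `e` is an energy level, the
scalar is the phase acquired by that level in time `t`, which is why the energy shift can absorb the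
propagator of the system. -/
theorem translate_weight_mul_phaseOp (ħ e t : ℝ) :
    phaseOp n ħ t * translate n (e, 0) =
      cexp (-(I * t / ħ) * e) • (translate n (e, 0) * phaseOp n ħ t) := by
  rw [phaseOp, shift_mul_multOp _ (isMultiplier_phase ħ t), ← smul_mul_assoc]
  congr 1
  ext1 Ψ
  refine Lp.ext ?_
  have hM := (isMultiplier_phase (n := n) ħ t).comp (τ := fun z : ℝ × ℝ => z - (e, 0))
    (by fun_prop)
  filter_upwards [coeFn_multOp (isMultiplier_phase ħ t) Ψ, coeFn_multOp hM Ψ, Lp.coeFn_smul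
    (cexp (-(I * t / ħ) * e)) (multOp volume (fun z : ℝ × ℝ => cexp (-(I * t * (z - (e, 0)).1 / ħ))
      • (1 : EuclideanSpace ℂ n →L[ℂ] EuclideanSpace ℂ n)) Ψ)] with z h1 h2 h3
  rw [_root_.smul_apply, h1, h3, Pi.smul_apply, h2, _root_.smul_apply,
    _root_.smul_apply, smul_smul, ← Complex.exp_add]
  congr 2
  simp only [Prod.fst_sub]
  push_cast; ring

/-- The group `exp (-i (X_w + P_c) t / ħ)`. -/
def freeGroup (n : Type) [Fintype n] (ħ t : ℝ) : Total n →L[ℂ] Total n :=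
  phaseOp n ħ t * translate n (0, t)

theorem freeGroup_add (ħ s t : ℝ) : freeGroup n ħ (s + t) = freeGroup n ħ s * freeGroup n ħ t := by
  have : ((0 : ℝ), s + t) = (0, s) + (0, t) := by simp
  rw [freeGroup, freeGroup, freeGroup, phaseOp_add, this, translate, shift_add, mul_assoc, mul_assoc,
    ← mul_assoc (phaseOp n ħ t), ← translate_clock_mul_phaseOp, mul_assoc]

theorem freeGroup_zero (ħ : ℝ) : freeGroup n ħ 0 = 1 := by
  rw [freeGroup, phaseOp_zero, Prod.mk_zero_zero, translate, shift_zero, one_mul]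

theorem star_freeGroup (ħ t : ℝ) : star (freeGroup n ħ t) = freeGroup n ħ (-t) := by
  rw [freeGroup, star_mul, star_phaseOp, star_shift, freeGroup, Prod.neg_mk, neg_zero,
    translate_clock_mul_phaseOp]

theorem freeGroup_mem_unitary (ħ t : ℝ) : freeGroup n ħ t ∈ unitary (Total n →L[ℂ] Total n) := by
  rw [Unitary.mem_iff, star_freeGroup, ← freeGroup_add, ← freeGroup_add]
  simp [freeGroup_zero]

theorem freeGroup_mul_internalOp (ħ t : ℝ) (A : EuclideanSpace ℂ n →L[ℂ] EuclideanSpace ℂ n) :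
    freeGroup n ħ t * internalOp A = internalOp A * freeGroup n ħ t := by
  rw [freeGroup, mul_assoc, translate_mul_internalOp, ← mul_assoc, phaseOp_mul_internalOp,
    mul_assoc]

theorem coeFn_freeGroup (ħ t : ℝ) (Ψ : Total n) : freeGroup n ħ t Ψ =ᵐ[volume]
    fun z => cexp (-(I * t * z.1 / ħ)) • Ψ (z - (0, t)) := by
  filter_upwards [coeFn_phaseOp ħ t (translate n (0, t) Ψ), coeFn_shift (0, t) Ψ] with z h1 h2
  rw [freeGroup, mul_apply_eq_comp, h1, h2]

theorem phaseOp_mem_unitary (ħ t : ℝ) : phaseOp n ħ t ∈ unitary (Total n →L[ℂ] Total n) := by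
  rw [Unitary.mem_iff, star_phaseOp, ← phaseOp_add, ← phaseOp_add]
  simp [phaseOp_zero]

theorem norm_sq_eq_integral {α F : Type} [MeasurableSpace α] {μ : Measure α}
    [NormedAddCommGroup F] [InnerProductSpace ℂ F] (f : Lp F 2 μ) :
    ‖f‖ ^ 2 = ∫ z, ‖f z‖ ^ 2 ∂μ := by
  have h1 := L2.inner_def (𝕜 := ℂ) f f
  simp only [inner_self_eq_norm_sq_to_K] at h1
  have h2 : ∀ z, ((‖f z‖ : ℂ)) ^ 2 = ((‖f z‖ ^ 2 : ℝ) : ℂ) := fun z => by push_cast; rfl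
  simp only [RCLike.ofReal_eq_complex_ofReal, h2] at h1
  have h3 : ((‖f‖ ^ 2 : ℝ) : ℂ) = ((∫ z, ‖f z‖ ^ 2 ∂μ : ℝ) : ℂ) := by
    rw [← integral_complex_ofReal, ← h1]; push_cast; rfl
  exact_mod_cast h3

theorem integrable_norm_sq {α F : Type} [MeasurableSpace α] {μ : Measure α}
    [NormedAddCommGroup F] [InnerProductSpace ℂ F] (f : Lp F 2 μ) :
    Integrable (fun z => ‖f z‖ ^ 2) μ :=
  (memLp_two_iff_integrable_sq_norm (Lp.aestronglyMeasurable f)).1 (Lp.memLp f)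

/-- The position operator is unbounded, so the continuity is only strong; it comes from dominated
convergence with majorant `4 * ‖Ψ z‖ ^ 2`. -/
theorem continuous_phaseOp (ħ : ℝ) (Ψ : Total n) : Continuous fun t => phaseOp n ħ t Ψ := by
  refine continuous_iff_continuousAt.2 fun s => ?_
  rw [ContinuousAt, tendsto_iff_norm_sub_tendsto_zero]
  have h1 : ∀ t, ‖phaseOp n ħ t Ψ - phaseOp n ħ s Ψ‖ =
      √(∫ z : ℝ × ℝ, ‖(cexp (-(I * t * z.1 / ħ)) - cexp (-(I * s * z.1 / ħ))) • Ψ z‖ ^ 2) := by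
    intro t
    rw [← Real.sqrt_sq (norm_nonneg (phaseOp n ħ t Ψ - phaseOp n ħ s Ψ)), norm_sq_eq_integral]
    congr 1
    refine integral_congr_ae ?_
    filter_upwards [coeFn_phaseOp ħ t Ψ, coeFn_phaseOp ħ s Ψ,
      Lp.coeFn_sub (phaseOp n ħ t Ψ) (phaseOp n ħ s Ψ)] with z h1 h2 h3
    rw [h3, Pi.sub_apply, h1, h2, sub_smul]
  simp only [h1]
  rw [← Real.sqrt_zero]
  refine (Real.continuous_sqrt.tendsto 0).comp ?_
  have h2 : (0 : ℝ) = ∫ z : ℝ × ℝ,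
      ‖(cexp (-(I * s * z.1 / ħ)) - cexp (-(I * s * z.1 / ħ))) • Ψ z‖ ^ 2 := by simp
  rw [h2]
  refine tendsto_integral_filter_of_dominated_convergence (fun z => 4 * ‖Ψ z‖ ^ 2) ?_ ?_
    ((integrable_norm_sq Ψ).const_mul 4) ?_
  · refine .of_forall fun t => ?_
    have hc : Continuous fun z : ℝ × ℝ =>
        cexp (-(I * t * z.1 / ħ)) - cexp (-(I * s * z.1 / ħ)) := by fun_prop
    exact (hc.aestronglyMeasurable.smul (Lp.aestronglyMeasurable Ψ)).norm.pow 2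
  · refine .of_forall fun t => .of_forall fun z => ?_
    rw [Real.norm_of_nonneg (by positivity), norm_smul, mul_pow]
    refine mul_le_mul_of_nonneg_right ?_ (by positivity)
    have : ‖cexp (-(I * t * z.1 / ħ)) - cexp (-(I * s * z.1 / ħ))‖ ≤ 2 := by
      refine (norm_sub_le _ _).trans ?_
      rw [norm_phase, norm_phase]; norm_num
    nlinarith [norm_nonneg (cexp (-(I * t * z.1 / ħ)) - cexp (-(I * s * z.1 / ħ)))]
  · refine .of_forall fun z => ?_
    have hc : Continuous fun t : ℝ =>
        ‖(cexp (-(I * t * z.1 / ħ)) - cexp (-(I * s * z.1 / ħ))) • Ψ z‖ ^ 2 := by fun_prop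
    exact hc.tendsto s

theorem continuous_freeGroup (ħ : ℝ) (Ψ : Total n) : Continuous fun t => freeGroup n ħ t Ψ := by
  refine continuous_iff_continuousAt.2 fun s => ?_
  rw [ContinuousAt, tendsto_iff_norm_sub_tendsto_zero]
  have h1 : ∀ t, ‖freeGroup n ħ t Ψ - freeGroup n ħ s Ψ‖ ≤
      ‖translate n (0, t) Ψ - translate n (0, s) Ψ‖ +
        ‖phaseOp n ħ t (translate n (0, s) Ψ) - phaseOp n ħ s (translate n (0, s) Ψ)‖ := by
    intro t
    have := Unitary.norm_map ⟨_, phaseOp_mem_unitary (n := n) ħ t⟩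
      (translate n (0, t) Ψ - translate n (0, s) Ψ)
    rw [← this, map_sub]
    refine le_trans (le_of_eq ?_) (norm_add_le _ _)
    simp [freeGroup]
  refine squeeze_zero (fun t => norm_nonneg _) h1 ?_
  have h2 : Continuous fun t : ℝ => translate n (0, t) Ψ :=
    (continuous_shift Ψ).comp (by fun_prop : Continuous fun t : ℝ => ((0 : ℝ), t))
  have h3 := continuous_phaseOp ħ (translate n (0, s) Ψ)
  simpa using ((h2.tendsto s).sub_const (translate n (0, s) Ψ)).norm.add
    ((h3.tendsto s).sub_const (phaseOp n ħ s (translate n (0, s) Ψ))).norm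

end Free


/-! ### Density operators as ensembles of vectors -/

section Ensemble

variable {K : Type} [NormedAddCommGroup K] [InnerProductSpace ℂ K] [CompleteSpace K] {ι : Type}

/-- `ρ = ∑ i, |u i⟩⟨u i|` (in the weak sense), where `∑ i, ‖u i‖ ^ 2 = r`. -/
def IsEnsemble (ρ : K →L[ℂ] K) (u : ι → K) (r : ℝ) : Prop :=
  HasSum (fun i => ‖u i‖ ^ 2) r ∧ ∀ x y, HasSum (fun i => ⟪x, u i⟫_ℂ * ⟪u i, y⟫_ℂ) ⟪x, ρ y⟫_ℂ

theorem HilbertBasis.hasSum_norm_inner_sq {κ : Type} (b : HilbertBasis κ ℂ K) (x : K) :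
    HasSum (fun k => ‖⟪b k, x⟫_ℂ‖ ^ 2) (‖x‖ ^ 2) := by
  have h := b.hasSum_inner_mul_inner x x
  rw [inner_self_eq_norm_sq_to_K] at h
  have h' := Complex.hasSum_re h
  have h2 : (fun k => (⟪x, b k⟫_ℂ * ⟪b k, x⟫_ℂ).re) = fun k => ‖⟪b k, x⟫_ℂ‖ ^ 2 := by
    funext k
    rw [← inner_conj_symm x (b k), ← Complex.normSq_eq_conj_mul_self, ofReal_re,
      Complex.normSq_eq_norm_sq]
  rw [h2] at h'
  convert h' using 1
  rw [RCLike.ofReal_eq_complex_ofReal, ← ofReal_pow, ofReal_re]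

theorem HasTrace.unique {A : K →L[ℂ] K} {z w : ℂ} (hz : HasTrace A z) (hw : HasTrace A w) :
    z = w := by
  obtain ⟨s, b, -⟩ := exists_hilbertBasis ℂ K
  exact (hz s b).unique (hw s b)

/-- The vectors are √ρ applied to a Hilbert basis; Parseval's identity gives the decomposition, and
the trace gives the sum of the squared norms. -/
theorem IsDensity.exists_ensemble {ρ : K →L[ℂ] K} (h : IsDensity ρ) :
    ∃ (ι : Type) (u : ι → K), IsEnsemble ρ u 1 := by
  obtain ⟨hpos, htr⟩ := h
  obtain ⟨s, b, -⟩ := exists_hilbertBasis ℂ K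
  have h0 : 0 ≤ ρ := (ContinuousLinearMap.nonneg_iff_isPositive ρ).2 hpos
  set S := CFC.sqrt ρ
  have hS : S * S = ρ := CFC.sqrt_mul_sqrt_self ρ h0
  have hsa : ∀ x y, ⟪x, S y⟫_ℂ = ⟪S x, y⟫_ℂ := by
    have h1 : IsSelfAdjoint S := IsSelfAdjoint.of_nonneg (CFC.sqrt_nonneg ρ)
    intro x y
    rw [← ContinuousLinearMap.adjoint_inner_left, ← ContinuousLinearMap.star_eq_adjoint, h1.star_eq]
  have key : ∀ x y, HasSum (fun i => ⟪x, S (b i)⟫_ℂ * ⟪S (b i), y⟫_ℂ) ⟪x, ρ y⟫_ℂ := by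
    intro x y
    have := b.hasSum_inner_mul_inner (S x) (S y)
    rw [← hsa, ← mul_apply_eq_comp, hS] at this
    simpa only [hsa] using this
  refine ⟨s, fun i => S (b i), ?_, key⟩
  have h1 := Complex.hasSum_re (htr s b)
  rw [one_re] at h1
  convert h1 using 2 with i
  rw [← hS, mul_apply_eq_comp, hsa, inner_self_eq_norm_sq_to_K, RCLike.ofReal_eq_complex_ofReal,
    ← ofReal_pow, ofReal_re]

theorem IsEnsemble.summable {ρ : K →L[ℂ] K} {u : ι → K} {r : ℝ} (h : IsEnsemble ρ u r)
    (B : K →L[ℂ] K) : Summable fun i => ⟪u i, B (u i)⟫_ℂ := by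
  refine Summable.of_norm_bounded (h.1.summable.mul_left ‖B‖) fun i => ?_
  refine (norm_inner_le_norm _ _).trans ?_
  have := B.le_opNorm (u i)
  nlinarith [norm_nonneg (u i)]

/-- The double series ∑ ⟨bₖ, B uᵢ⟩⟨uᵢ, bₖ⟩ converges absolutely, so it may be summed in either
order. This turns a trace, defined through every Hilbert basis, into a sum over one ensemble. -/
theorem IsEnsemble.hasTrace {ρ : K →L[ℂ] K} {u : ι → K} {r : ℝ} (h : IsEnsemble ρ u r)
    (B : K →L[ℂ] K) : HasTrace (B ∘L ρ) (∑' i, ⟪u i, B (u i)⟫_ℂ) := by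
  intro s b
  -- The majorant is half the sum of two squares; Parseval sums it over the basis to at most a
  -- multiple of `‖u i‖ ^ 2`.
  have hg : Summable fun q : ι × s => (‖⟪b q.2, B (u q.1)⟫_ℂ‖ ^ 2 + ‖⟪b q.2, u q.1⟫_ℂ‖ ^ 2) / 2 := by
    have h1 : ∀ i, HasSum (fun k => (‖⟪b k, B (u i)⟫_ℂ‖ ^ 2 + ‖⟪b k, u i⟫_ℂ‖ ^ 2) / 2)
        ((‖B (u i)‖ ^ 2 + ‖u i‖ ^ 2) / 2) := fun i =>
      ((HilbertBasis.hasSum_norm_inner_sq b (B (u i))).add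
        (HilbertBasis.hasSum_norm_inner_sq b (u i))).div_const 2
    rw [summable_prod_of_nonneg fun q => by positivity]
    refine ⟨fun i => (h1 i).summable, ?_⟩
    simp only [(h1 _).tsum_eq]
    refine Summable.of_nonneg_of_le (fun i => by positivity) (fun i => ?_)
      (h.1.summable.mul_left ((‖B‖ ^ 2 + 1) / 2))
    have := pow_le_pow_left₀ (norm_nonneg _) (B.le_opNorm (u i)) 2
    rw [mul_pow] at this
    linarith
  have hf : Summable fun q : ι × s => ⟪b q.2, B (u q.1)⟫_ℂ * ⟪u q.1, b q.2⟫_ℂ := by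
    refine Summable.of_norm_bounded hg fun q => ?_
    rw [norm_mul, norm_inner_symm (u q.1)]
    nlinarith [sq_nonneg (‖⟪b q.2, B (u q.1)⟫_ℂ‖ - ‖⟪b q.2, u q.1⟫_ℂ‖)]
  -- Summing over the basis first gives the ensemble average of `B`; summing over the ensemble
  -- first, in `e2`, gives the diagonal elements of `B ∘L ρ`.
  have e1 := hf.hasSum.prod_fiberwise (g := fun i => ⟪u i, B (u i)⟫_ℂ) fun i => by
    simpa only [mul_comm] using b.hasSum_inner_mul_inner (u i) (B (u i))
  have e2 := ((Equiv.prodComm s ι).hasSum_iff.2 hf.hasSum).prod_fiberwise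
    (g := fun k => ⟪b k, (B ∘L ρ) (b k)⟫_ℂ) fun k => by
      have := h.2 (ContinuousLinearMap.adjoint B (b k)) (b k)
      simp only [ContinuousLinearMap.adjoint_inner_left] at this
      exact this
  rwa [e1.tsum_eq]

theorem IsEnsemble.hasTrace_self {ρ : K →L[ℂ] K} {u : ι → K} {r : ℝ} (h : IsEnsemble ρ u r) :
    HasTrace ρ r := by
  have h1 := h.hasTrace (ContinuousLinearMap.id ℂ K)
  rw [ContinuousLinearMap.id_comp] at h1
  convert h1
  have h2 := Complex.hasSum_ofReal.2 h.1
  rw [← h2.tsum_eq]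
  congr 1
  funext i
  rw [ContinuousLinearMap.id_apply, inner_self_eq_norm_sq_to_K]
  push_cast; rfl

theorem IsEnsemble.isDensity {ρ : K →L[ℂ] K} {u : ι → K} (h : IsEnsemble ρ u 1) :
    IsDensity ρ := by
  refine ⟨(ContinuousLinearMap.isPositive_iff_complex ρ).2 fun x => ?_, by
    simpa using h.hasTrace_self⟩
  have h1 := h.2 x x
  have h2 : (fun i => ⟪x, u i⟫_ℂ * ⟪u i, x⟫_ℂ) = fun i => ((‖⟪u i, x⟫_ℂ‖ ^ 2 : ℝ) : ℂ) := by
    funext i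
    rw [← inner_conj_symm x (u i), ← Complex.normSq_eq_conj_mul_self, Complex.normSq_eq_norm_sq]
  rw [h2] at h1
  have h3 : Summable fun i => ‖⟪u i, x⟫_ℂ‖ ^ 2 := Complex.summable_ofReal.1 h1.summable
  have h4 : ⟪x, ρ x⟫_ℂ = ((∑' i, ‖⟪u i, x⟫_ℂ‖ ^ 2 : ℝ) : ℂ) := by
    rw [ofReal_tsum]; exact h1.tsum_eq.symm
  rw [← inner_conj_symm (ρ x) x, h4, conj_ofReal]
  exact ⟨by simp, by simpa using tsum_nonneg fun i => by positivity⟩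

/-- The norm of |u⟩⟨u| is ‖u‖², so the series of rank-one operators converges absolutely in operator
norm. -/
theorem exists_isEnsemble {u : ι → K} {r : ℝ} (h : HasSum (fun i => ‖u i‖ ^ 2) r) :
    ∃ ρ : K →L[ℂ] K, IsEnsemble ρ u r := by
  have hs : Summable fun i => InnerProductSpace.rankOne ℂ (u i) (u i) := by
    refine Summable.of_norm_bounded h.summable fun i => ?_
    refine le_of_eq ?_
    rw [InnerProductSpace.norm_rankOne, sq]
  refine ⟨∑' i, InnerProductSpace.rankOne ℂ (u i) (u i), h, fun x y => ?_⟩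
  let L : (K →L[ℂ] K) →L[ℂ] ℂ := (innerSL ℂ x) ∘L ContinuousLinearMap.apply ℂ K y
  have := L.hasSum hs.hasSum
  have h2 : ∀ A : K →L[ℂ] K, L A = ⟪x, A y⟫_ℂ := fun A => rfl
  simp only [h2, InnerProductSpace.rankOne_apply, inner_smul_right] at this
  simpa only [mul_comm] using this

end Ensemble

theorem IsEnsemble.evolve {n ι : Type} [Fintype n] {ρ : Total n →L[ℂ] Total n} {u : ι → Total n}
    {r : ℝ} (h : IsEnsemble ρ u r) (U : Total n ≃ₗᵢ[ℂ] Total n) :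
    IsEnsemble (evolve U ρ) (fun i => U (u i)) r := by
  refine ⟨by simpa using h.1, fun x y => ?_⟩
  have h1 : ∀ x y, ⟪x, U y⟫_ℂ = ⟪U.symm x, y⟫_ℂ := fun x y => by
    rw [← U.inner_map_map (U.symm x) y, U.apply_symm_apply]
  have h2 : ∀ x y, ⟪U x, y⟫_ℂ = ⟪x, U.symm y⟫_ℂ := fun x y => by
    rw [← U.inner_map_map x (U.symm y), U.apply_symm_apply]
  have := h.2 (U.symm x) (U.symm y)
  simp only [h1, h2]
  convert this using 1
  exact h1 _ _

/-! ### Distributions of observables -/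

section Distribution

variable {α F : Type} [MeasurableSpace α] {μ : Measure α}
  [NormedAddCommGroup F] [InnerProductSpace ℂ F] {ι : Type}

/-- The distribution of the observable "multiplication by `f`" in the ensemble `u`. -/
def ensembleDistribution (f : α → ℝ) (u : ι → Lp F 2 μ) : Measure ℝ :=
  Measure.sum fun i => (μ.withDensity fun z => ‖u i z‖ₑ ^ 2).map f

theorem indicatorOp_norm_sq {S : Set α} (hS : MeasurableSet S) (g : Lp F 2 μ) :
    ‖indicatorOp μ F S g‖ₑ ^ 2 = ∫⁻ z in S, ‖g z‖ₑ ^ 2 ∂μ := by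
  rw [Lp.enorm_def, eLpNorm_congr_ae (coeFn_indicatorOp hS g), eLpNorm_indicator_eq_eLpNorm_restrict hS,
    eLpNorm_eq_lintegral_rpow_enorm_toReal (by norm_num) (by norm_num)]
  rw [← ENNReal.rpow_natCast, ← ENNReal.rpow_mul]
  norm_num

theorem ensembleDistribution_apply {f : α → ℝ} (hf : Measurable f) (u : ι → Lp F 2 μ) {B : Set ℝ}
    (hB : MeasurableSet B) :
    ensembleDistribution f u B = ∑' i, ‖indicatorOp μ F (f ⁻¹' B) (u i)‖ₑ ^ 2 := by
  rw [ensembleDistribution, Measure.sum_apply _ hB]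
  congr 1
  funext i
  rw [Measure.map_apply hf hB, withDensity_apply _ (hf hB), indicatorOp_norm_sq (hf hB)]

theorem norm_indicatorOp_le {S : Set α} (hS : MeasurableSet S) (g : Lp F 2 μ) :
    ‖indicatorOp μ F S g‖ ≤ ‖g‖ := by
  refine Lp.norm_le_norm_of_ae_le ?_
  filter_upwards [coeFn_indicatorOp hS g] with z hz
  rw [hz]
  exact norm_indicator_le_norm_self _ _

theorem inner_indicatorOp {S : Set α} (hS : MeasurableSet S) [CompleteSpace F] (g : Lp F 2 μ) :
    ⟪g, indicatorOp μ F S g⟫_ℂ = ((‖indicatorOp μ F S g‖ ^ 2 : ℝ) : ℂ) := by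
  have h1 : star (indicatorOp μ F S) * indicatorOp μ F S = indicatorOp μ F S := by
    rw [indicatorOp_eq_multOp hS, star_multOp (isMultiplier_indicator hS),
      multOp_mul (isMultiplier_indicator hS).star (isMultiplier_indicator hS)]
    congr 1
    funext z
    by_cases hz : z ∈ S <;> simp [hz]
  conv_lhs => rw [← h1, mul_apply_eq_comp, ContinuousLinearMap.star_eq_adjoint,
    ContinuousLinearMap.adjoint_inner_right, inner_self_eq_norm_sq_to_K]
  push_cast; rfl

theorem ensembleDistribution_real {f : α → ℝ} (hf : Measurable f) {u : ι → Lp F 2 μ} {r : ℝ}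
    (hu : HasSum (fun i => ‖u i‖ ^ 2) r) {B : Set ℝ} (hB : MeasurableSet B) :
    HasSum (fun i => ‖indicatorOp μ F (f ⁻¹' B) (u i)‖ ^ 2) ((ensembleDistribution f u).real B)
    ∧ ensembleDistribution f u B ≠ ⊤ := by
  have hs : Summable fun i => ‖indicatorOp μ F (f ⁻¹' B) (u i)‖ ^ 2 :=
    Summable.of_nonneg_of_le (fun i => by positivity)
      (fun i => pow_le_pow_left₀ (norm_nonneg _) (norm_indicatorOp_le (hf hB) _) 2) hu.summable
  have h1 : ensembleDistribution f u B =
      ENNReal.ofReal (∑' i, ‖indicatorOp μ F (f ⁻¹' B) (u i)‖ ^ 2) := by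
    rw [ensembleDistribution_apply hf u hB, ENNReal.ofReal_tsum_of_nonneg
      (fun i => by positivity) hs]
    congr 1
    funext i
    rw [ENNReal.ofReal_pow (norm_nonneg _), ofReal_norm]
  refine ⟨?_, h1 ▸ ENNReal.ofReal_ne_top⟩
  rw [Measure.real, h1, ENNReal.toReal_ofReal (tsum_nonneg fun i => by positivity)]
  exact hs.hasSum

theorem indicatorOp_univ : indicatorOp μ F Set.univ = 1 := by
  rw [indicatorOp_eq_multOp MeasurableSet.univ, Set.indicator_univ, multOp_one]

theorem isFiniteMeasure_ensembleDistribution {f : α → ℝ} (hf : Measurable f) {u : ι → Lp F 2 μ}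
    {r : ℝ} (hu : HasSum (fun i => ‖u i‖ ^ 2) r) : IsFiniteMeasure (ensembleDistribution f u) :=
  ⟨(ensembleDistribution_real hf hu MeasurableSet.univ).2.lt_top⟩

theorem ensembleDistribution_real_univ {f : α → ℝ} (hf : Measurable f) {u : ι → Lp F 2 μ} {r : ℝ}
    (hu : HasSum (fun i => ‖u i‖ ^ 2) r) : (ensembleDistribution f u).real Set.univ = r := by
  have := (ensembleDistribution_real hf hu MeasurableSet.univ).1
  simp only [Set.preimage_univ, indicatorOp_univ, one_apply_eq_self] at this
  exact this.unique hu

variable [CompleteSpace F]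

theorem IsEnsemble.hasTrace_indicatorOp {ρ : Lp F 2 μ →L[ℂ] Lp F 2 μ} {u : ι → Lp F 2 μ} {r : ℝ}
    (h : IsEnsemble ρ u r) {f : α → ℝ} (hf : Measurable f) {B : Set ℝ} (hB : MeasurableSet B) :
    HasTrace (indicatorOp μ F (f ⁻¹' B) ∘L ρ) (((ensembleDistribution f u).real B : ℝ) : ℂ) := by
  have h1 := h.hasTrace (indicatorOp μ F (f ⁻¹' B))
  simp only [inner_indicatorOp (hf hB)] at h1
  rwa [← ofReal_tsum, (ensembleDistribution_real hf h.1 hB).1.tsum_eq] at h1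

/-- The traces of the spectral projections determine the measure, so the distribution may be
computed from any ensemble of the state and does not depend on the choice. -/
theorem IsEnsemble.hasDistribution_iff {ρ : Lp F 2 μ →L[ℂ] Lp F 2 μ} {u : ι → Lp F 2 μ}
    (h : IsEnsemble ρ u 1) {f : α → ℝ} (hf : Measurable f) {ν : Measure ℝ} :
    HasDistribution f ρ ν ↔ ν = ensembleDistribution f u := by
  have := isFiniteMeasure_ensembleDistribution hf h.1
  constructor
  · rintro ⟨hν, hd⟩
    refine Measure.ext fun B hB => ?_
    have := (hd B hB).unique (h.hasTrace_indicatorOp hf hB)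
    rw [ofReal_inj] at this
    exact (measureReal_eq_measureReal_iff).1 this
  · rintro rfl
    refine ⟨⟨?_⟩, fun B hB => h.hasTrace_indicatorOp hf hB⟩
    have := ensembleDistribution_real_univ hf h.1
    rwa [Measure.real, ENNReal.toReal_eq_one_iff] at this

theorem IsEnsemble.hasMean_iff {ρ : Lp F 2 μ →L[ℂ] Lp F 2 μ} {u : ι → Lp F 2 μ}
    (h : IsEnsemble ρ u 1) {f : α → ℝ} (hf : Measurable f) {m : ℝ} :
    HasMean f ρ m ↔ Integrable (fun y => y) (ensembleDistribution f u) ∧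
      ∫ y, y ∂(ensembleDistribution f u) = m := by
  simp only [HasMean, h.hasDistribution_iff hf, exists_eq_left]

end Distribution


/-! ### Energy balance -/

section Balance

variable {n ι : Type} [Fintype n]

theorem indicatorOp_mul_internalOp {S : Set (ℝ × ℝ)} (hS : MeasurableSet S)
    (A : EuclideanSpace ℂ n →L[ℂ] EuclideanSpace ℂ n) :
    indicatorOp volume _ S * internalOp A = internalOp A * indicatorOp volume _ S := by
  rw [indicatorOp_eq_multOp hS, internalOp, multOp_mul (isMultiplier_indicator hS)
    (isMultiplier_const A), multOp_mul (isMultiplier_const A) (isMultiplier_indicator hS)]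
  congr 1
  funext z
  by_cases hz : z ∈ S <;> simp [hz]

theorem indicatorOp_mul_multOp {S : Set (ℝ × ℝ)} (hS : MeasurableSet S)
    {M : ℝ × ℝ → EuclideanSpace ℂ n →L[ℂ] EuclideanSpace ℂ n} (hM : IsMultiplier M) :
    indicatorOp volume _ S * multOp volume M = multOp volume M * indicatorOp volume _ S := by
  rw [indicatorOp_eq_multOp hS, multOp_mul (isMultiplier_indicator hS) hM,
    multOp_mul hM (isMultiplier_indicator hS)]
  congr 1
  funext z
  by_cases hz : z ∈ S <;> simp [hz]

theorem indicatorOp_mul_translate {S : Set (ℝ × ℝ)} (hS : MeasurableSet S) (w : ℝ × ℝ) :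
    indicatorOp volume _ S * translate n w =
      translate n w * indicatorOp volume _ ((fun z => z + w) ⁻¹' S) := by
  have hS' : MeasurableSet ((fun z => z + w) ⁻¹' S) := hS.preimage (by fun_prop)
  rw [indicatorOp_eq_multOp hS, indicatorOp_eq_multOp hS',
    shift_mul_multOp _ (isMultiplier_indicator hS')]
  congr 2
  funext z
  by_cases hz : z ∈ S <;> simp [hz]

/-- Used for the steps that leave the weight position untouched: system unitaries and the free
group. -/
theorem ensembleDistribution_isometry {f : ℝ × ℝ → ℝ} (hf : Measurable f) (u : ι → Total n)
    {T : Total n →L[ℂ] Total n} (hT : ∀ Ψ, ‖T Ψ‖ = ‖Ψ‖)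
    (hc : ∀ B, MeasurableSet B →
      indicatorOp volume _ (f ⁻¹' B) * T = T * indicatorOp volume _ (f ⁻¹' B)) :
    ensembleDistribution f (fun i => T (u i)) = ensembleDistribution f u := by
  refine Measure.ext fun B hB => ?_
  rw [ensembleDistribution_apply hf _ hB, ensembleDistribution_apply hf _ hB]
  congr 1
  funext i
  rw [← mul_apply_eq_comp, hc B hB, mul_apply_eq_comp, ← ofReal_norm, hT, ofReal_norm]

/-! ### Weight position conditioned on the energy level of the system -/

variable (v : OrthonormalBasis n ℂ (EuclideanSpace ℂ n))

variable [DecidableEq n]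

theorem inner_internalOp_basisProj (m : n) (Ψ : Total n) :
    ⟪Ψ, internalOp (basisProj v m) Ψ⟫_ℂ = ((‖internalOp (basisProj v m) Ψ‖ ^ 2 : ℝ) : ℂ) := by
  have h1 : star (internalOp (basisProj v m)) * internalOp (basisProj v m) =
      internalOp (basisProj v m) := by
    rw [star_internalOp, star_basisProj, ← internalOp_mul, basisProj_mul, if_pos rfl]
  conv_lhs => rw [← h1, mul_apply_eq_comp, ContinuousLinearMap.star_eq_adjoint,
    ContinuousLinearMap.adjoint_inner_right, inner_self_eq_norm_sq_to_K]
  push_cast; rfl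

theorem norm_sq_eq_sum_internalOp (Ψ : Total n) :
    ‖Ψ‖ ^ 2 = ∑ m, ‖internalOp (basisProj v m) Ψ‖ ^ 2 := by
  have h : Ψ = ∑ m, internalOp (basisProj v m) Ψ := by
    rw [← _root_.sum_apply, ← internalOp_sum, sum_basisProj, internalOp_one]; rfl
  have h2 : ⟪Ψ, Ψ⟫_ℂ = ∑ m, ((‖internalOp (basisProj v m) Ψ‖ ^ 2 : ℝ) : ℂ) := by
    rw [congrArg (fun x => ⟪Ψ, x⟫_ℂ) h, inner_sum]
    exact Finset.sum_congr rfl fun m _ => inner_internalOp_basisProj v m Ψ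
  rw [inner_self_eq_norm_sq_to_K, ← ofReal_sum, RCLike.ofReal_eq_complex_ofReal] at h2
  exact_mod_cast h2

theorem enorm_sq_eq_sum_internalOp (Ψ : Total n) :
    ‖Ψ‖ₑ ^ 2 = ∑ m, ‖internalOp (basisProj v m) Ψ‖ₑ ^ 2 := by
  have : ∀ Φ : Total n, ‖Φ‖ₑ ^ 2 = ENNReal.ofReal (‖Φ‖ ^ 2) := fun Φ => by
    rw [ENNReal.ofReal_pow (norm_nonneg _), ofReal_norm]
  simp only [this]
  rw [norm_sq_eq_sum_internalOp v, ENNReal.ofReal_sum_of_nonneg fun _ _ => by positivity]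

/-- The distribution of the position of the weight, if the system is in the state `v m`. -/
def conditionalDistribution (u : ι → Total n) (m : n) : Measure ℝ :=
  ensembleDistribution Prod.fst fun i => internalOp (basisProj v m) (u i)

theorem ensembleDistribution_eq_sum (u : ι → Total n) :
    ensembleDistribution Prod.fst u = ∑ m, conditionalDistribution v u m := by
  refine Measure.ext fun B hB => ?_
  rw [Measure.finsetSum_apply]
  simp only [conditionalDistribution, ensembleDistribution_apply measurable_fst _ hB]
  rw [← Summable.tsum_finsetSum fun _ _ => ENNReal.summable]
  congr 1
  funext i
  rw [enorm_sq_eq_sum_internalOp v]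
  refine Finset.sum_congr rfl fun m _ => ?_
  rw [← mul_apply_eq_comp, ← mul_apply_eq_comp, indicatorOp_mul_internalOp (measurable_fst hB)]

theorem basisProj_mul_conditionalShift (c : n → ℝ × ℝ) (m : n) :
    internalOp (basisProj v m) * conditionalShift v c =
      translate n (c m) * internalOp (basisProj v m) := by
  rw [conditionalShift, Finset.mul_sum, Finset.sum_eq_single m]
  · rw [← mul_assoc, ← internalOp_mul, basisProj_mul, if_pos rfl, translate_mul_internalOp]
  · intro m' _ h
    rw [← mul_assoc, ← internalOp_mul, basisProj_mul, if_neg h.symm, internalOp_zero, zero_mul]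
  · simp

/-- The shift preserves each energy component and translates the weight rigidly there, so every
conditional distribution is moved by its own energy. The components are orthogonal and do not
interfere. -/
theorem ensembleDistribution_conditionalShift (u : ι → Total n) (en : n → ℝ) :
    ensembleDistribution Prod.fst (fun i => conditionalShift v (fun m => (en m, 0)) (u i)) =
      ∑ m, (conditionalDistribution v u m).map fun y => y + en m := by
  refine Measure.ext fun B hB => ?_
  rw [Measure.finsetSum_apply]
  have h : ∀ m, (conditionalDistribution v u m).map (fun y => y + en m) B =
      conditionalDistribution v u m ((fun y => y + en m) ⁻¹' B) := fun m =>
    Measure.map_apply (by fun_prop) hB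
  have hB' : ∀ m, MeasurableSet ((fun y => y + en m) ⁻¹' B) := fun m =>
    hB.preimage (by fun_prop)
  simp only [h]
  simp only [conditionalDistribution, ensembleDistribution_apply measurable_fst _ hB,
    ensembleDistribution_apply measurable_fst _ (hB' _)]
  rw [← Summable.tsum_finsetSum fun _ _ => ENNReal.summable]
  congr 1
  funext i
  rw [enorm_sq_eq_sum_internalOp v]
  refine Finset.sum_congr rfl fun m _ => ?_
  rw [← mul_apply_eq_comp, ← mul_apply_eq_comp, ← indicatorOp_mul_internalOp (measurable_fst hB),
    mul_assoc, basisProj_mul_conditionalShift, ← mul_assoc,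
    indicatorOp_mul_translate (measurable_fst hB), mul_apply_eq_comp, mul_apply_eq_comp,
    ← ofReal_norm, norm_shift_apply, ofReal_norm]
  rfl

/-- The total mass is the probability of the level `m`; the sum over levels weighted by energy is
the mean system energy. -/
theorem conditionalDistribution_real_univ {u : ι → Total n} {r : ℝ}
    (hu : HasSum (fun i => ‖u i‖ ^ 2) r) (m : n) :
    HasSum (fun i => ‖internalOp (basisProj v m) (u i)‖ ^ 2)
      ((conditionalDistribution v u m).real Set.univ) ∧
      IsFiniteMeasure (conditionalDistribution v u m) := by
  have hs : Summable fun i => ‖internalOp (basisProj v m) (u i)‖ ^ 2 := by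
    refine Summable.of_nonneg_of_le (fun i => by positivity) (fun i => ?_) hu.summable
    rw [norm_sq_eq_sum_internalOp v (u i)]
    exact Finset.single_le_sum (f := fun m => ‖internalOp (basisProj v m) (u i)‖ ^ 2)
      (fun _ _ => by positivity) (Finset.mem_univ m)
  refine ⟨?_, isFiniteMeasure_ensembleDistribution measurable_fst hs.hasSum⟩
  rw [conditionalDistribution, ensembleDistribution_real_univ measurable_fst hs.hasSum]
  exact hs.hasSum

/-- The mean position of the weight changes under a conditional shift by the mean energy of the
system. -/
theorem integral_ensembleDistribution_conditionalShift {u : ι → Total n} {r : ℝ}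
    (hu : HasSum (fun i => ‖u i‖ ^ 2) r) (en : n → ℝ) :
    (Integrable (fun y => y) (ensembleDistribution Prod.fst fun i =>
        conditionalShift v (fun m => (en m, 0)) (u i)) ↔
      Integrable (fun y => y) (ensembleDistribution Prod.fst u)) ∧
    (Integrable (fun y => y) (ensembleDistribution Prod.fst u) →
      ∫ y, y ∂(ensembleDistribution Prod.fst fun i =>
        conditionalShift v (fun m => (en m, 0)) (u i)) =
      ∫ y, y ∂(ensembleDistribution Prod.fst u) +
        ∑ m, en m * (conditionalDistribution v u m).real Set.univ) := by
  have hfin := fun m => (conditionalDistribution_real_univ v hu m).2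
  -- The measures are finite, so adding the constant `en m` does not affect integrability.
  have hmap : ∀ m, Integrable (fun y : ℝ => y)
      ((conditionalDistribution v u m).map fun y => y + en m) ↔
      Integrable (fun y : ℝ => y) (conditionalDistribution v u m) := by
    intro m
    rw [integrable_map_measure (by fun_prop) (by fun_prop)]
    have := hfin m
    refine ⟨fun h => ?_, fun h => h.add (integrable_const (en m))⟩
    exact (h.sub (integrable_const (en m))).congr (.of_forall fun y => by simp)
  rw [ensembleDistribution_conditionalShift, ensembleDistribution_eq_sum v]
  simp only [integrable_finsetSum_measure, hmap, true_and, Finset.mem_univ, forall_true_left]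
  intro h
  rw [integral_finsetSum_measure fun m _ => (hmap m).2 (h m),
    integral_finsetSum_measure fun m _ => h m, ← Finset.sum_add_distrib]
  refine Finset.sum_congr rfl fun m _ => ?_
  have := hfin m
  rw [integral_map (by fun_prop) (by fun_prop), integral_add (h m) (integrable_const _),
    integral_const, smul_eq_mul, mul_comm (en m)]

theorem trace_mul_eq_sum_conditionalDistribution {ρ : Total n →L[ℂ] Total n} {u : ι → Total n}
    {r : ℝ} (hu : IsEnsemble ρ u r) {M Hs : Matrix n n ℂ} (hM : IsReducedState ρ M) {en : n → ℝ}
    (hen : IsEigenbasis Hs v en) :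
    energy Hs M = ∑ m, en m * (conditionalDistribution v u m).real Set.univ := by
  have h1 := (hM Hs).unique (hu.hasTrace _)
  have h2 : HasSum (fun i => ⟪u i, systemOp Hs (u i)⟫_ℂ)
      ((∑ m, en m * (conditionalDistribution v u m).real Set.univ : ℝ) : ℂ) := by
    have h3 : ∀ i, ⟪u i, systemOp Hs (u i)⟫_ℂ =
        ((∑ m, en m * ‖internalOp (basisProj v m) (u i)‖ ^ 2 : ℝ) : ℂ) := by
      intro i
      rw [systemOp_eq_internalOp, eq_spectralOp v hen, spectralOp, internalOp_sum,
        _root_.sum_apply, inner_sum, ofReal_sum]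
      refine Finset.sum_congr rfl fun m _ => ?_
      rw [internalOp_smul, _root_.smul_apply, inner_smul_right, inner_internalOp_basisProj]
      push_cast; rfl
    simp only [h3]
    rw [Complex.hasSum_ofReal]
    exact hasSum_sum fun m _ => (conditionalDistribution_real_univ v hu.1 m).1.mul_left (en m)
  rw [h2.tsum_eq] at h1
  rw [energy, Matrix.trace_mul_comm, h1, ofReal_re]

end Balance

/-! ### Reduced states of ensembles -/

section Reduced

variable {n ι : Type} [Fintype n] [DecidableEq n]

/-- By linearity the reduced state is fixed by its values on matrix units. The entry formula is kept
because closeness of reduced states is later measured entry by entry. -/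
theorem IsEnsemble.exists_isReducedState {ρ : Total n →L[ℂ] Total n} {u : ι → Total n} {r : ℝ}
    (h : IsEnsemble ρ u r) : ∃ M : Matrix n n ℂ, IsReducedState ρ M ∧
      ∀ a b, M a b = ∑' i, ⟪u i, systemOp (Matrix.single b a (1 : ℂ)) (u i)⟫_ℂ := by
  refine ⟨Matrix.of fun a b => ∑' i, ⟪u i, systemOp (Matrix.single b a (1 : ℂ)) (u i)⟫_ℂ,
    fun A => ?_, fun a b => rfl⟩
  convert h.hasTrace (systemOp A) using 1
  rw [Matrix.trace]
  simp only [Matrix.diag_apply, Matrix.mul_apply, Matrix.of_apply]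
  simp only [← tsum_mul_right]
  have hA : systemOp A = ∑ a, ∑ b, A b a • systemOp (Matrix.single b a (1 : ℂ)) := by
    simp only [systemOp_eq_internalOp, ← internalOp_smul, ← internalOp_sum, ← map_smul, ← map_sum]
    congr 2
    rw [Finset.sum_comm]
    conv_lhs => rw [Matrix.matrix_eq_sum_single A]
    simp [Matrix.smul_single]
  have hs : ∀ a b, Summable fun i =>
      ⟪u i, systemOp (Matrix.single b a (1 : ℂ)) (u i)⟫_ℂ * A b a := fun a b =>
    (h.summable _).mul_right _
  rw [← (hasSum_sum fun a _ => hasSum_sum fun b _ => (hs a b).hasSum).tsum_eq]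
  congr 1
  funext i
  rw [hA]
  simp only [_root_.sum_apply, _root_.smul_apply, inner_sum, inner_smul_right, mul_comm]

end Reduced


/-! ### Differentiation of families of square integrable functions -/

section Derivative

variable {n : Type} [Fintype n]

/-- Pointwise differentiability becomes differentiability in L²: all functions live on one compact
set, on which the difference quotients converge uniformly, and the L² norm is at most the supremum
times the square root of the volume. -/
theorem hasDerivAt_total {γ γ' : ℝ → ℝ × ℝ → EuclideanSpace ℂ n} {C : Set (ℝ × ℝ)}
    (hC : IsCompact C) (hγ' : Continuous (Function.uncurry γ'))
    (hd : ∀ t z, HasDerivAt (fun s => γ s z) (γ' t z) t)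
    (hsupp : ∀ t : ℝ, |t| ≤ 1 → ∀ z ∉ C, γ t z = 0)
    {f : ℝ → Total n} {f' : Total n} (hf : ∀ t, f t =ᵐ[volume] γ t) (hf' : f' =ᵐ[volume] γ' 0) :
    HasDerivAt f f' 0 := by
  have hμ : volume C ≠ ⊤ := hC.measure_lt_top.ne
  have hCm : MeasurableSet C := hC.measurableSet
  have hsupp' : ∀ z ∉ C, γ' 0 z = 0 := by
    intro z hz
    refine (hd 0 z).unique ((hasDerivAt_const (0 : ℝ) (0 : EuclideanSpace ℂ n)).congr_of_eventuallyEq ?_)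
    filter_upwards [Metric.ball_mem_nhds (0 : ℝ) one_pos] with t ht
    exact hsupp t (by simpa using (Metric.mem_ball.1 ht).le) z hz
  rw [hasDerivAt_iff_isLittleO_nhds_zero, Asymptotics.isLittleO_iff]
  intro c hc
  set A : ℝ := volume.real C ^ (1 / (2 : ℝ≥0∞).toReal)
  have hA : 0 ≤ A := by positivity
  -- `A + 1` in place of `A` covers the case of a null set `C`.
  have hε : 0 < c / (A + 1) := by positivity
  obtain ⟨w, hw, hw'⟩ := hC.mem_uniformity_of_prod (f := γ') (s := Set.univ) (q := (0 : ℝ))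
    hγ'.continuousOn (Set.mem_univ _) (Metric.dist_mem_uniformity hε)
  rw [nhdsWithin_univ] at hw
  obtain ⟨δ, hδ, hδw⟩ := Metric.mem_nhds_iff.1 hw
  filter_upwards [Metric.ball_mem_nhds (0 : ℝ) (lt_min hδ one_pos)] with h hh
  rw [Metric.mem_ball, lt_min_iff, dist_zero_right] at hh
  have key : ∀ z, ‖γ h z - γ 0 z - h • γ' 0 z‖ ≤ ‖C.indicator (fun _ => c / (A + 1) * |h|) z‖ := by
    intro z
    by_cases hz : z ∈ C
    · rw [Set.indicator_of_mem hz]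
      -- Mean value inequality for `γ s z - s • γ' 0 z`, whose derivative is uniformly small near
      -- time zero.
      have hb := Convex.norm_image_sub_le_of_norm_hasDerivWithin_le (𝕜 := ℝ)
        (f := fun s => γ s z - s • γ' 0 z) (f' := fun s => γ' s z - (1 : ℝ) • γ' 0 z)
        (s := Metric.ball 0 δ) (x := 0) (y := h) (C := c / (A + 1))
        (fun s _ => ((hd s z).sub ((hasDerivAt_id s).smul_const (γ' 0 z))).hasDerivWithinAt)
        (fun s hs => by
          have := hw' s (hδw hs) z hz
          rw [one_smul, ← dist_eq_norm]
          exact le_of_lt this)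
        (convex_ball _ _) (Metric.mem_ball_self hδ) (by simpa using hh.1)
      rw [Real.norm_of_nonneg (by positivity)]
      simp only [zero_smul, sub_zero, Real.norm_eq_abs] at hb
      refine le_trans (le_of_eq ?_) hb
      congr 1; abel
    · rw [Set.indicator_of_notMem hz, hsupp h hh.2.le z hz, hsupp 0 (by simp) z hz, hsupp' z hz]
      simp
  have hle : ‖f (0 + h) - f 0 - h • f'‖ ≤
      ‖indicatorConstLp 2 hCm hμ (c / (A + 1) * |h|)‖ := by
    refine Lp.norm_le_norm_of_ae_le ?_
    filter_upwards [hf h, hf 0, hf', Lp.coeFn_sub (f (0 + h)) (f 0), Lp.coeFn_smul h f',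
      Lp.coeFn_sub (f (0 + h) - f 0) (h • f'),
      indicatorConstLp_coeFn (p := 2) (hs := hCm) (hμs := hμ) (c := c / (A + 1) * |h|)]
      with z h1 h2 h3 h4 h5 h6 h7
    rw [h6, Pi.sub_apply, h4, Pi.sub_apply, h5, Pi.smul_apply, h2, h3, h7, zero_add, h1]
    exact key z
  refine hle.trans ?_
  rw [norm_indicatorConstLp (by norm_num) (by norm_num), Real.norm_of_nonneg (by positivity)]
  have : c / (A + 1) * A ≤ c := by
    rw [div_mul_eq_mul_div, div_le_iff₀ (by positivity)]
    nlinarith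
  calc c / (A + 1) * |h| * A = (c / (A + 1) * A) * |h| := by ring
    _ ≤ c * |h| := by gcongr

/-- The generator differentiates only in the clock direction, so one continuous derivative in that
variable suffices. This matters because the frame transformation brings in `F`, which is only
assumed to have a continuous derivative. -/
theorem hasDerivAt_freeGroup {ħ : ℝ} (hħ : ħ ≠ 0) {g gy : ℝ × ℝ → EuclideanSpace ℂ n}
    (hg : Continuous g) (hgc : HasCompactSupport g) (hgy : Continuous gy)
    (hd : ∀ x y, HasDerivAt (fun s => g (x, s)) (gy (x, y)) y) {Ψ Ξ : Total n}
    (hΨ : Ψ =ᵐ[volume] g) (hΞ : Ξ =ᵐ[volume] fun z => (z.1 : ℂ) • g z - (I * ħ) • gy z) :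
    HasDerivAt (fun t => freeGroup n ħ t Ψ) (-(I / ħ) • Ξ) 0 := by
  -- This set contains the supports of all translates of `g` by times at most 1 in absolute value.
  have hC : IsCompact ((fun q : (ℝ × ℝ) × ℝ => q.1 + (0, q.2)) ''
      (tsupport g ×ˢ Metric.closedBall (0 : ℝ) 1)) :=
    (hgc.isCompact.prod (isCompact_closedBall 0 1)).image (by fun_prop)
  refine hasDerivAt_total (γ := fun t z => cexp (-(I * t * z.1 / ħ)) • g (z - (0, t)))
    (γ' := fun t z => cexp (-(I * t * z.1 / ħ)) • (-(gy (z - (0, t)))) +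
      (cexp (-(I * t * z.1 / ħ)) * (-(I * z.1 / ħ))) • g (z - (0, t))) hC ?_ ?_ ?_ ?_ ?_
  · simp only [Function.uncurry_def]
    fun_prop
  · intro t z
    have h1 : HasDerivAt (fun s : ℝ => cexp (-(I * s * z.1 / ħ)))
        (cexp (-(I * t * z.1 / ħ)) * (-(I * z.1 / ħ))) t := by
      have h2 : HasDerivAt (fun s : ℝ => -(I * s * z.1 / ħ)) (-(I * z.1 / ħ)) t := by
        have h3 := ((hasDerivAt_id t).ofReal_comp).const_mul (-(I * z.1 / ħ))
        simp only [id_eq, ofReal_one, mul_one] at h3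
        refine h3.congr_of_eventuallyEq (.of_forall fun s => ?_)
        simp only []
        ring
      exact h2.cexp
    have h4 : HasDerivAt (fun s : ℝ => g (z - (0, s))) (-(gy (z - (0, t)))) t := by
      have h5 := (hd z.1 (z.2 - t)).scomp t ((hasDerivAt_id t).const_sub z.2)
      rw [neg_one_smul] at h5
      have e : ∀ s : ℝ, z - (0, s) = (z.1, z.2 - s) := fun s => by ext <;> simp
      simp only [e]
      exact h5
    exact h1.smul h4
  · intro t ht z hz
    have : g (z - (0, t)) = 0 := by
      by_contra hne
      refine hz ⟨(z - (0, t), t), ⟨subset_tsupport _ hne, ?_⟩, by simp⟩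
      simpa using ht
    simp only [this, smul_zero]
  · intro t
    filter_upwards [coeFn_freeGroup ħ t Ψ, ae_sub_right ((0 : ℝ), t) hΨ] with z h1 h2
    rw [h1, h2]
  · filter_upwards [hΞ, Lp.coeFn_smul (-(I / ħ)) Ξ] with z h1 h2
    have hħ' : (ħ : ℂ) ≠ 0 := ofReal_ne_zero.2 hħ
    rw [h2, Pi.smul_apply, h1]
    simp only [ofReal_zero, mul_zero, zero_mul, zero_div, neg_zero, Complex.exp_zero, one_smul,
      one_mul, Prod.mk_zero_zero, sub_zero, smul_sub, smul_smul]
    have e1 : -(I / (ħ : ℂ)) * (z.1 : ℂ) = -(I * z.1 / ħ) := by ring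
    have e2 : -(I / (ħ : ℂ)) * (I * ħ) = 1 := by
      field_simp; rw [I_sq]; ring
    rw [e1, e2, one_smul]
    abel

end Derivative


/-! ### Unitary groups of the system -/

section Unitaries

variable {n : Type} [Fintype n]

theorem operator_zero_smul (A : EuclideanSpace ℂ n →L[ℂ] EuclideanSpace ℂ n) : (0 : ℂ) • A = 0 :=
  zero_smul ℂ A

theorem operator_neg_smul (c : ℂ) (A : EuclideanSpace ℂ n →L[ℂ] EuclideanSpace ℂ n) :
    (-c) • A = -(c • A) :=
  neg_smul c A

/-- `exp (-i G s)`. -/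
def unitaryFlow (G : EuclideanSpace ℂ n →L[ℂ] EuclideanSpace ℂ n) (s : ℝ) :
    EuclideanSpace ℂ n →L[ℂ] EuclideanSpace ℂ n :=
  NormedSpace.exp ((-(I * s)) • G)

theorem unitaryFlow_zero (G : EuclideanSpace ℂ n →L[ℂ] EuclideanSpace ℂ n) :
    unitaryFlow G 0 = 1 := by
  rw [unitaryFlow, ofReal_zero, mul_zero, neg_zero, operator_zero_smul, NormedSpace.exp_zero]

theorem star_neg_I_smul {G : EuclideanSpace ℂ n →L[ℂ] EuclideanSpace ℂ n}
    (hG : IsSelfAdjoint G) (s : ℝ) : star ((-(I * s)) • G) = -((-(I * s)) • G) := by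
  rw [star_smul, hG.star_eq, ← operator_neg_smul]
  congr 1
  simp

theorem unitaryFlow_mem_unitary {G : EuclideanSpace ℂ n →L[ℂ] EuclideanSpace ℂ n}
    (hG : IsSelfAdjoint G) (s : ℝ) :
    unitaryFlow G s ∈ unitary (EuclideanSpace ℂ n →L[ℂ] EuclideanSpace ℂ n) := by
  let : NormedAlgebra ℚ (EuclideanSpace ℂ n →L[ℂ] EuclideanSpace ℂ n) :=
    NormedAlgebra.restrictScalars ℚ ℂ _
  exact NormedSpace.exp_mem_unitary_of_mem_skewAdjoint (skewAdjoint.mem_iff.2 (star_neg_I_smul hG s))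

theorem star_unitaryFlow {G : EuclideanSpace ℂ n →L[ℂ] EuclideanSpace ℂ n}
    (hG : IsSelfAdjoint G) (s : ℝ) : star (unitaryFlow G s) = unitaryFlow G (-s) := by
  rw [unitaryFlow, NormedSpace.star_exp, star_neg_I_smul hG, unitaryFlow]
  congr 1
  rw [← operator_neg_smul]
  congr 1
  push_cast; ring

theorem hasDerivAt_unitaryFlow (G : EuclideanSpace ℂ n →L[ℂ] EuclideanSpace ℂ n) (s : ℝ) :
    HasDerivAt (unitaryFlow G) (unitaryFlow G s * ((-I) • G)) s := by
  have h := (hasDerivAt_exp_smul_const (𝕂 := ℂ) ((-I) • G) (s : ℂ)).scomp s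
    (hasDerivAt_id s).ofReal_comp
  have e : ∀ r : ℝ, (r : ℂ) • ((-I) • G) = (-(I * r)) • G := fun r => by
    rw [smul_smul]; congr 1; ring
  simp only [Function.comp_def, e, ofReal_one] at h
  rw [one_smul] at h
  exact h

theorem continuous_unitaryFlow (G : EuclideanSpace ℂ n →L[ℂ] EuclideanSpace ℂ n) :
    Continuous (unitaryFlow G) :=
  continuous_iff_continuousAt.2 fun s => (hasDerivAt_unitaryFlow G s).continuousAt

theorem isMultiplier_unitaryFlow {G : EuclideanSpace ℂ n →L[ℂ] EuclideanSpace ℂ n}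
    (hG : IsSelfAdjoint G) {s : ℝ × ℝ → ℝ} (hs : Continuous s) :
    IsMultiplier fun z => unitaryFlow G (s z) := by
  refine ⟨((continuous_unitaryFlow G).comp hs).stronglyMeasurable, 1, fun z => ?_⟩
  exact ContinuousLinearMap.opNorm_le_bound _ zero_le_one fun x => by
    rw [Unitary.norm_map ⟨_, unitaryFlow_mem_unitary hG (s z)⟩, one_mul]

/-- The generator is -arg of the unitary. The discontinuity of the argument is harmless, since the
spectrum is finite and every function is continuous on it. -/
theorem exists_unitaryFlow_eq [DecidableEq n] {V : EuclideanSpace ℂ n →L[ℂ] EuclideanSpace ℂ n}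
    (hV : V ∈ unitary (EuclideanSpace ℂ n →L[ℂ] EuclideanSpace ℂ n)) :
    ∃ G, IsSelfAdjoint G ∧ unitaryFlow G 1 = V := by
  have hfin : (spectrum ℂ V).Finite := by
    have := Matrix.finite_spectrum ((Matrix.toEuclideanCLM (n := n) (𝕜 := ℂ)).symm V)
    rwa [AlgEquiv.spectrum_eq] at this
  have hn : IsStarNormal V := by
    constructor
    rw [Commute, SemiconjBy, Unitary.star_mul_self_of_mem hV, Unitary.mul_star_self_of_mem hV]
  have hc : ContinuousOn (fun z : ℂ => ((-arg z : ℝ) : ℂ)) (spectrum ℂ V) := hfin.continuousOn _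
  refine ⟨cfc (fun z : ℂ => ((-arg z : ℝ) : ℂ)) V, ?_, ?_⟩
  · simp [isSelfAdjoint_iff, ← cfc_star]
  · rw [unitaryFlow, ← cfc_smul _ _ V hc, ← CFC.exp_eq_normedSpace_exp (𝕜 := ℂ),
      ← cfc_comp' _ _ V (hg := (NormedSpace.exp_continuous).continuousOn) (hf := hfin.continuousOn _)]
    conv_rhs => rw [← cfc_id' ℂ V]
    refine cfc_congr fun y hy => ?_
    have h1 : ‖y‖ = 1 := spectrum.norm_eq_one_of_unitary hV hy
    have h2 := Complex.norm_mul_exp_arg_mul_I y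
    rw [h1, ofReal_one, one_mul] at h2
    simp only [← Complex.exp_eq_exp_ℂ]
    rw [← h2]
    congr 1
    simp only [h2, smul_eq_mul, ofReal_one]
    push_cast; ring

end Unitaries

/-! ### The interaction -/

section Interaction

variable {n : Type} [Fintype n] [DecidableEq n]

/-- The translation of the weight by the energy of the system: `exp (-i H_s P_w / ħ)`. -/
def energyShift (v : OrthonormalBasis n ℂ (EuclideanSpace ℂ n)) (en : n → ℝ) :
    Total n →L[ℂ] Total n :=
  conditionalShift v fun m => (en m, 0)

/-- `H_int = D† (ħ f(X_c) G) D` with the energy shift `D`. -/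
def interaction (ħ : ℝ) (v : OrthonormalBasis n ℂ (EuclideanSpace ℂ n)) (en : n → ℝ)
    (G : EuclideanSpace ℂ n →L[ℂ] EuclideanSpace ℂ n) (f : ℝ → ℝ) : Total n →L[ℂ] Total n :=
  star (energyShift v en) * multOp volume (fun z => ((ħ * f z.2 : ℝ) : ℂ) • G) * energyShift v en

theorem commutesWith_of_commute {A T : Total n →L[ℂ] Total n}
    {B : (ℝ × ℝ → EuclideanSpace ℂ n) → ℝ × ℝ → EuclideanSpace ℂ n}
    (hT : ∀ Ψ : Total n, T Ψ =ᵐ[volume] B Ψ) (h : A * T = T * A) : CommutesWith A B := by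
  intro Ψ Ψ' hΨ
  have : Ψ' = T Ψ := Lp.ext (hΨ.trans (hT Ψ).symm)
  rw [this, ← mul_apply_eq_comp, h, mul_apply_eq_comp]
  exact hT _

theorem isMultiplier_smul_const {f : ℝ → ℝ} (hf : Continuous f) {C : ℝ} (hC : ∀ y, |f y| ≤ C)
    (ħ : ℝ) (G : EuclideanSpace ℂ n →L[ℂ] EuclideanSpace ℂ n) :
    IsMultiplier fun z : ℝ × ℝ => ((ħ * f z.2 : ℝ) : ℂ) • G := by
  refine ⟨Continuous.stronglyMeasurable (by fun_prop), |ħ| * C * ‖G‖, fun z => ?_⟩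
  rw [norm_smul, Complex.norm_real, norm_mul, Real.norm_eq_abs, Real.norm_eq_abs]
  gcongr
  exact hC _

theorem multOp_mul_phaseOp {M : ℝ × ℝ → EuclideanSpace ℂ n →L[ℂ] EuclideanSpace ℂ n}
    (hM : IsMultiplier M) (ħ t : ℝ) :
    multOp volume M * phaseOp n ħ t = phaseOp n ħ t * multOp volume M := by
  rw [phaseOp, multOp_mul hM (isMultiplier_phase ħ t), multOp_mul (isMultiplier_phase ħ t) hM]
  simp

/-- The integrated form of D (H_s + X_w) = X_w D: on each energy level the Weyl relation produces
exactly the phase of the propagator. In the frame of D the engine Hamiltonian is the weight position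
alone. -/
theorem phaseOp_mul_energyShift {ħ : ℝ} {v : OrthonormalBasis n ℂ (EuclideanSpace ℂ n)}
    {en : n → ℝ} {Hs : Matrix n n ℂ} (hen : IsEigenbasis Hs v en) (t : ℝ) :
    phaseOp n ħ t * energyShift v en = energyShift v en *
      (phaseOp n ħ t * internalOp (Matrix.toEuclideanCLM (𝕜 := ℂ) (propagator ħ Hs t))) := by
  rw [toEuclideanCLM_propagator v hen, phaseOp_mul_internalOp, ← mul_assoc,
    energyShift, conditionalShift_commute_internalOp v _ (commute_spectralOp_basisProj v _),
    conditionalShift, Finset.mul_sum, Finset.mul_sum, Finset.sum_mul]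
  refine Finset.sum_congr rfl fun m _ => ?_
  rw [← mul_assoc, phaseOp_mul_internalOp, mul_assoc, translate_weight_mul_phaseOp,
    ← mul_assoc (internalOp (spectralOp _ _)), ← internalOp_mul, spectralOp_mul_basisProj,
    internalOp_smul, smul_mul_assoc, smul_mul_assoc, mul_smul_comm, mul_assoc]

theorem energyShift_mem_unitary (v : OrthonormalBasis n ℂ (EuclideanSpace ℂ n)) (en : n → ℝ) :
    energyShift v en ∈ unitary (Total n →L[ℂ] Total n) :=
  conditionalShift_mem_unitary v _

theorem energyShift_mul_multOp (v : OrthonormalBasis n ℂ (EuclideanSpace ℂ n)) (en : n → ℝ)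
    {c : ℝ → EuclideanSpace ℂ n →L[ℂ] EuclideanSpace ℂ n}
    (hc : IsMultiplier fun z : ℝ × ℝ => c z.2) (h : ∀ m y, Commute (basisProj v m) (c y)) :
    energyShift v en * multOp volume (fun z => c z.2) =
      multOp volume (fun z => c z.2) * energyShift v en :=
  conditionalShift_commute_multOp v _ hc (fun m z => by simp) fun m z => h m z.2

theorem star_energyShift_mul_comm {v : OrthonormalBasis n ℂ (EuclideanSpace ℂ n)} {en : n → ℝ}
    {A B : Total n →L[ℂ] Total n} (h : energyShift v en * A = B * energyShift v en) :
    A * star (energyShift v en) = star (energyShift v en) * B := by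
  have h1 := Unitary.star_mul_self_of_mem (energyShift_mem_unitary v en)
  have h2 := Unitary.mul_star_self_of_mem (energyShift_mem_unitary v en)
  calc A * star (energyShift v en)
      = star (energyShift v en) * (energyShift v en * A) * star (energyShift v en) := by
        rw [← mul_assoc, h1, one_mul]
    _ = star (energyShift v en) * B := by rw [h, mul_assoc, mul_assoc, h2, mul_one]

/-- The interaction has the form D* M D, so it commutes with `A` as soon as M commutes with `B`, the
conjugate D A D*. The commutation requirements are reduced to multipliers in this way. -/
theorem interaction_mul_comm {ħ : ℝ} {v : OrthonormalBasis n ℂ (EuclideanSpace ℂ n)} {en : n → ℝ}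
    {G : EuclideanSpace ℂ n →L[ℂ] EuclideanSpace ℂ n} {f : ℝ → ℝ} {A B : Total n →L[ℂ] Total n}
    (h : energyShift v en * A = B * energyShift v en)
    (hB : multOp volume (fun z => ((ħ * f z.2 : ℝ) : ℂ) • G) * B =
      B * multOp volume fun z => ((ħ * f z.2 : ℝ) : ℂ) • G) :
    interaction ħ v en G f * A = A * interaction ħ v en G f := by
  rw [interaction, mul_assoc, h, mul_assoc, ← mul_assoc _ B, hB, mul_assoc B, ← mul_assoc _ B,
    ← star_energyShift_mul_comm h]
  simp only [mul_assoc]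

/-- In the frame of D the interaction is a function of the clock position times a system operator.
It thus commutes with the phases of the weight position (the image of H_e), with weight translations
and with clock projections, and D itself does not touch the clock. -/
theorem isInteraction_interaction {ħ : ℝ} {v : OrthonormalBasis n ℂ (EuclideanSpace ℂ n)}
    {en : n → ℝ} {Hs : Matrix n n ℂ} (hen : IsEigenbasis Hs v en)
    {G : EuclideanSpace ℂ n →L[ℂ] EuclideanSpace ℂ n} (hG : IsSelfAdjoint G)
    {f : ℝ → ℝ} (hf : Continuous f) {C : ℝ} (hC : ∀ y, |f y| ≤ C) {b L : ℝ}
    (hsupp : ∀ y ∉ Set.Icc b (b + L), f y = 0) :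
    IsInteraction ħ Hs b L (interaction ħ v en G f) := by
  have hM := isMultiplier_smul_const hf hC ħ G
  have hind : ∀ S : Set ℝ, MeasurableSet S →
      energyShift v en * indicatorOp volume _ (Prod.snd ⁻¹' S) =
        indicatorOp volume _ (Prod.snd ⁻¹' S) * energyShift v en := by
    intro S hS
    rw [indicatorOp_eq_multOp (measurable_snd hS)]
    refine energyShift_mul_multOp v en (c := S.indicator fun _ => 1)
      (isMultiplier_indicator (measurable_snd hS)) fun m y => ?_
    by_cases hy : y ∈ S <;> simp [hy]
  refine ⟨?_, fun t => ?_, fun y => ?_, fun S hS => ?_, ?_⟩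
  · refine IsSelfAdjoint.conjugate' ?_ _
    rw [isSelfAdjoint_iff, star_multOp hM]
    congr 1
    funext z
    rw [star_smul, hG.star_eq, RCLike.star_def, conj_ofReal]
  · refine commutesWith_of_commute
      (T := phaseOp n ħ t * internalOp (Matrix.toEuclideanCLM (𝕜 := ℂ) (propagator ħ Hs t)))
      (fun Ψ => ?_) ?_
    · filter_upwards [coeFn_phaseOp ħ t
        (internalOp (Matrix.toEuclideanCLM (𝕜 := ℂ) (propagator ħ Hs t)) Ψ),
        coeFn_internalOp (Matrix.toEuclideanCLM (𝕜 := ℂ) (propagator ħ Hs t)) Ψ] with z h1 h2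
      rw [mul_apply_eq_comp, h1, h2]
    · exact interaction_mul_comm (phaseOp_mul_energyShift hen t).symm (multOp_mul_phaseOp hM ħ t)
  · refine commutesWith_of_commute (T := translate n (y, 0)) (fun Ψ => ?_) ?_
    · filter_upwards [coeFn_shift (y, (0 : ℝ)) Ψ] with z h
      rw [h, show z - (y, 0) = (z.1 - y, z.2) by ext <;> simp]
    · refine interaction_mul_comm (conditionalShift_commute_translate v _ _) ?_
      rw [shift_mul_multOp _ hM]
      simp
  · exact interaction_mul_comm (hind S hS) (indicatorOp_mul_multOp (measurable_snd hS) hM).symm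
  · change interaction ħ v en G f * _ = 0
    have hS : MeasurableSet (Set.Icc b (b + L))ᶜ := measurableSet_Icc.compl
    rw [interaction, mul_assoc, hind _ hS, mul_assoc, ← mul_assoc _ (indicatorOp _ _ _),
      indicatorOp_eq_multOp (measurable_snd hS), multOp_mul hM
      (isMultiplier_indicator (measurable_snd hS))]
    have : (fun z : ℝ × ℝ => ((ħ * f z.2 : ℝ) : ℂ) • G *
        (Prod.snd ⁻¹' (Set.Icc b (b + L))ᶜ).indicator (fun _ => 1) z) = fun z => 0 := by
      funext z
      by_cases hz : z.2 ∈ Set.Icc b (b + L)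
      · rw [Set.indicator_of_notMem (by simpa using hz), mul_zero]
      · rw [hsupp _ hz, mul_zero, ofReal_zero, operator_zero_smul, zero_mul]
    rw [this]
    have h0 : multOp volume (fun _ : ℝ × ℝ => (0 : EuclideanSpace ℂ n →L[ℂ] EuclideanSpace ℂ n)) = 0 :=
      internalOp_zero
    rw [h0, zero_mul, mul_zero]

end Interaction


/-! ### The evolution of the machine -/

section Evolution

variable {n : Type} [Fintype n]

theorem coeFn_sum {ι : Type} (s : Finset ι) (Ψ : ι → Total n) :
    (∑ i ∈ s, Ψ i : Total n) =ᵐ[volume] fun z => ∑ i ∈ s, Ψ i z := by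
  classical
  induction s using Finset.induction_on with
  | empty =>
    simp only [Finset.sum_empty]
    exact Lp.coeFn_zero _ _ _
  | insert i s hi ih =>
    rw [Finset.sum_insert hi]
    filter_upwards [Lp.coeFn_add (Ψ i) (∑ j ∈ s, Ψ j), ih] with z h1 h2
    rw [h1, Pi.add_apply, h2, Finset.sum_insert hi]

theorem coeFn_conditionalShift (v : OrthonormalBasis n ℂ (EuclideanSpace ℂ n)) (c : n → ℝ × ℝ)
    {Ψ : Total n} {Φ : ℝ × ℝ → EuclideanSpace ℂ n} (h : Ψ =ᵐ[volume] Φ) :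
    conditionalShift v c Ψ =ᵐ[volume] fun z => ∑ m, basisProj v m (Φ (z - c m)) := by
  rw [conditionalShift, _root_.sum_apply]
  have h1 : ∀ᵐ z : ℝ × ℝ, ∀ m, (internalOp (basisProj v m) * translate n (c m)) Ψ z =
      basisProj v m (Φ (z - c m)) := by
    rw [ae_all_iff]
    intro m
    filter_upwards [coeFn_internalOp (basisProj v m) (translate n (c m) Ψ),
      coeFn_shift (c m) Ψ, ae_sub_right (c m) h] with z h1 h2 h3
    rw [mul_apply_eq_comp, h1, h2, h3]
  filter_upwards [coeFn_sum Finset.univ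
    fun m => (internalOp (basisProj v m) * translate n (c m)) Ψ, h1] with z h2 h3
  rw [h2]
  exact Finset.sum_congr rfl fun m _ => h3 m

variable [DecidableEq n]

/-- The unitary transformation that removes the interaction. -/
def machineFrame (v : OrthonormalBasis n ℂ (EuclideanSpace ℂ n)) (en : n → ℝ)
    (G : EuclideanSpace ℂ n →L[ℂ] EuclideanSpace ℂ n) (F : ℝ → ℝ) : Total n →L[ℂ] Total n :=
  multOp volume (fun z => unitaryFlow G (-F z.2)) * energyShift v en

theorem machineFrame_mem_unitary (v : OrthonormalBasis n ℂ (EuclideanSpace ℂ n)) (en : n → ℝ)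
    {G : EuclideanSpace ℂ n →L[ℂ] EuclideanSpace ℂ n} (hG : IsSelfAdjoint G) {F : ℝ → ℝ}
    (hF : Continuous F) : machineFrame v en G F ∈ unitary (Total n →L[ℂ] Total n) :=
  mul_mem (multOp_mem_unitary (isMultiplier_unitaryFlow hG (by fun_prop))
    fun _ => unitaryFlow_mem_unitary hG _) (energyShift_mem_unitary v en)

/-- The evolution `exp (-i H t / ħ)` of the machine. -/
def machineGroup (ħ : ℝ) (v : OrthonormalBasis n ℂ (EuclideanSpace ℂ n)) (en : n → ℝ)
    {G : EuclideanSpace ℂ n →L[ℂ] EuclideanSpace ℂ n} (hG : IsSelfAdjoint G) {F : ℝ → ℝ}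
    (hF : Continuous F) (t : ℝ) : Total n ≃ₗᵢ[ℂ] Total n :=
  Unitary.linearIsometryEquiv
    (star ⟨machineFrame v en G F, machineFrame_mem_unitary v en hG hF⟩ *
      ⟨freeGroup n ħ t, freeGroup_mem_unitary ħ t⟩ *
      ⟨machineFrame v en G F, machineFrame_mem_unitary v en hG hF⟩)

theorem machineGroup_apply (ħ : ℝ) (v : OrthonormalBasis n ℂ (EuclideanSpace ℂ n)) (en : n → ℝ)
    {G : EuclideanSpace ℂ n →L[ℂ] EuclideanSpace ℂ n} (hG : IsSelfAdjoint G) {F : ℝ → ℝ}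
    (hF : Continuous F) (t : ℝ) (Ψ : Total n) : machineGroup ħ v en hG hF t Ψ =
      (star (machineFrame v en G F) * freeGroup n ħ t * machineFrame v en G F) Ψ := rfl

/-- The group law and strong continuity are inherited from the free group by conjugation with W. For
the generator it suffices to check, on the core, that W carries the full Hamiltonian to X_w + P_c: D
absorbs H_s into X_w, and the derivative of the flow along the clock supplies the interaction
because F' = f. -/
theorem isEvolution_machineGroup {ħ : ℝ} (hħ : ħ ≠ 0)
    {v : OrthonormalBasis n ℂ (EuclideanSpace ℂ n)} {en : n → ℝ} {Hs : Matrix n n ℂ}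
    (hen : IsEigenbasis Hs v en) {G : EuclideanSpace ℂ n →L[ℂ] EuclideanSpace ℂ n}
    (hG : IsSelfAdjoint G) {F f : ℝ → ℝ} (hF : Continuous F) (hFf : ∀ y, HasDerivAt F (f y) y)
    (hf : Continuous f) {C : ℝ} (hC : ∀ y, |f y| ≤ C) :
    IsEvolution ħ Hs (interaction ħ v en G f) (machineGroup ħ v en hG hF) := by
  have hW := machineFrame_mem_unitary v en hG hF
  set W := machineFrame v en G F
  refine ⟨fun s t Ψ => ?_, fun Ψ => ?_, ?_⟩
  · rw [machineGroup_apply, machineGroup_apply, machineGroup_apply, ← mul_apply_eq_comp,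
      freeGroup_add]
    congr 1
    calc _ = star W * freeGroup n ħ s * (1 * (freeGroup n ħ t * W)) := by
          rw [one_mul]; simp only [mul_assoc]; rfl
      _ = _ := by rw [← Unitary.mul_star_self_of_mem hW]; simp only [mul_assoc]; rfl
  · simp only [machineGroup_apply, mul_assoc, mul_apply_eq_comp]
    exact (ContinuousLinearMap.continuous _).comp (continuous_freeGroup ħ _)
  rintro ⟨Ψ, Ξ⟩ ⟨Φ, χ, hΦ, hΦc, hΨ, hχ, hΞ⟩
  dsimp only at hΨ hΞ ⊢
  set Φ₁ : ℝ × ℝ → EuclideanSpace ℂ n := fun z => ∑ m, basisProj v m (Φ (z - (en m, 0)))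
  set Φ₂ : ℝ × ℝ → EuclideanSpace ℂ n := fun z =>
    ∑ m, basisProj v m (fderiv ℝ Φ (z - (en m, 0)) ((0 : ℝ), (1 : ℝ)))
  have hΦ' : Continuous fun z => fderiv ℝ Φ z ((0 : ℝ), (1 : ℝ)) :=
    (hΦ.continuous_fderiv (by simp)).clm_apply continuous_const
  have hΦ₁ : Continuous Φ₁ := by
    have := hΦ.continuous
    fun_prop
  have hΦ₂ : Continuous Φ₂ := continuous_finsetSum _ fun m _ =>
    (basisProj v m).continuous.comp (hΦ'.comp (by fun_prop))
  have hd₁ : ∀ x y, HasDerivAt (fun s => Φ₁ (x, s)) (Φ₂ (x, y)) y := by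
    intro x y
    refine HasDerivAt.fun_sum fun m _ => ?_
    have h1 : HasDerivAt (fun s : ℝ => (x, s) - (en m, (0 : ℝ))) ((0 : ℝ), (1 : ℝ)) y := by
      simpa using ((hasDerivAt_const y x).prodMk (hasDerivAt_id y)).sub_const (en m, (0 : ℝ))
    have h2 := ((hΦ.differentiable (by simp)) ((x, y) - (en m, 0))).hasFDerivAt.comp_hasDerivAt y h1
    exact ((basisProj v m).restrictScalars ℝ).hasFDerivAt.comp_hasDerivAt y h2
  -- Product rule along the clock for exp(i G F(y)) applied to a moving vector; the second term is
  -- the one that reproduces the interaction.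
  have hF1 : ∀ (y : ℝ) (x : ℝ → EuclideanSpace ℂ n) (x' : EuclideanSpace ℂ n), HasDerivAt x x' y →
      HasDerivAt (fun s => unitaryFlow G (-F s) (x s))
        (unitaryFlow G (-F y) x' + ((f y : ℝ) : ℂ) • (unitaryFlow G (-F y) * (I • G)) (x y)) y := by
    intro y x x' hx
    have h1 := (hasDerivAt_unitaryFlow G (-F y)).scomp y (hFf y).neg
    have h2 := (ContinuousLinearMap.restrictScalarsL ℂ (EuclideanSpace ℂ n) (EuclideanSpace ℂ n)
      ℝ ℝ).hasFDerivAt.comp_hasDerivAt y h1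
    have h3 := h2.clm_apply hx
    rw [add_comm]
    have h4 : (ContinuousLinearMap.restrictScalarsL ℂ (EuclideanSpace ℂ n) (EuclideanSpace ℂ n)
        ℝ ℝ) (-f y • (unitaryFlow G (-F y) * -I • G)) (x y) =
        ((f y : ℝ) : ℂ) • (unitaryFlow G (-F y) * (I • G)) (x y) := by
      change (-f y) • (unitaryFlow G (-F y)) ((-I) • G (x y)) =
        ((f y : ℝ) : ℂ) • (unitaryFlow G (-F y)) (I • G (x y))
      rw [map_smul, map_smul, Complex.coe_smul, neg_smul, neg_smul, smul_neg, neg_neg]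
    rw [← h4]
    exact h3
  have hR : Continuous fun z : ℝ × ℝ => unitaryFlow G (-F z.2) :=
    (continuous_unitaryFlow G).comp (by fun_prop)
  have hRm : IsMultiplier fun z : ℝ × ℝ => unitaryFlow G (-F z.2) :=
    isMultiplier_unitaryFlow hG (by fun_prop)
  have hKΨ : energyShift v en Ψ =ᵐ[volume] Φ₁ := coeFn_conditionalShift v _ hΨ
  have hder := hasDerivAt_freeGroup (n := n) hħ (g := fun z => unitaryFlow G (-F z.2) (Φ₁ z))
    (gy := fun z => unitaryFlow G (-F z.2) (Φ₂ z) +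
      ((f z.2 : ℝ) : ℂ) • (unitaryFlow G (-F z.2) * (I • G)) (Φ₁ z)) (Ψ := W Ψ) (Ξ := W Ξ)
    (hR.clm_apply hΦ₁) ?_ ?_ ?_ ?_ ?_
  · have h1 := ((star W).restrictScalars ℝ).hasFDerivAt.comp_hasDerivAt 0 hder
    have h2 : star W (-(I / ħ) • W Ξ) = -(I / ħ) • Ξ := by
      rw [map_smul, ← mul_apply_eq_comp, Unitary.star_mul_self_of_mem hW]; rfl
    rw [← h2]
    exact h1
  · have h1 : HasCompactSupport Φ₁ := by
      have h2 : ∀ m, HasCompactSupport fun z => basisProj v m (Φ (z - (en m, 0))) := fun m =>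
        (hΦc.comp_homeomorph (Homeomorph.subRight (en m, (0 : ℝ)))).comp_left
          (g := basisProj v m) (map_zero _)
      have h3 : ∀ s : Finset n,
          HasCompactSupport fun z => ∑ m ∈ s, basisProj v m (Φ (z - (en m, 0))) := by
        intro s
        induction s using Finset.induction_on with
        | empty =>
          simp only [Finset.sum_empty]
          exact HasCompactSupport.zero
        | insert m s hm ih =>
          simp only [Finset.sum_insert hm]
          exact (h2 m).add ih
      exact h3 _
    refine h1.mono fun z hz => ?_
    contrapose! hz
    simp [Function.notMem_support.1 hz]
  · refine (hR.clm_apply hΦ₂).add ?_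
    exact (continuous_ofReal.comp (hf.comp continuous_snd)).smul
      ((hR.mul continuous_const).clm_apply hΦ₁)
  · intro x y
    exact hF1 y _ _ (hd₁ x y)
  · filter_upwards [coeFn_multOp hRm (energyShift v en Ψ), hKΨ] with z h1 h2
    simp only [W, machineFrame, mul_apply_eq_comp]
    rw [h1, h2]
  · have hM := isMultiplier_smul_const hf hC ħ G
    -- On level `m` the weight is displaced by `en m`, and (x - en m) + en m = x: the system energy
    -- cancels the displacement.
    have hKχ : energyShift v en χ =ᵐ[volume] fun z => (z.1 : ℂ) • Φ₁ z - (I * ħ) • Φ₂ z := by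
      filter_upwards [coeFn_conditionalShift v (fun m => (en m, 0)) hχ] with z h1
      rw [energyShift, h1, Finset.smul_sum, Finset.smul_sum, ← Finset.sum_sub_distrib]
      refine Finset.sum_congr rfl fun m _ => ?_
      have h2 : basisProj v m (Matrix.toEuclideanCLM (𝕜 := ℂ) Hs (Φ (z - (en m, 0)))) =
          (en m : ℂ) • basisProj v m (Φ (z - (en m, 0))) := by
        rw [eq_spectralOp v hen, ← mul_apply_eq_comp, basisProj_mul_spectralOp]; rfl
      rw [freeHamiltonian, map_sub, map_add, h2, map_smul, map_smul, ← add_smul]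
      congr 2
      simp
    have hKH : energyShift v en (interaction ħ v en G f Ψ) =
        multOp volume (fun z => ((ħ * f z.2 : ℝ) : ℂ) • G) (energyShift v en Ψ) := by
      rw [interaction, ← mul_apply_eq_comp, ← mul_assoc, ← mul_assoc,
        Unitary.mul_star_self_of_mem (energyShift_mem_unitary v en), one_mul, mul_apply_eq_comp]
    have hΞ' : energyShift v en Ξ = energyShift v en χ +
        multOp volume (fun z => ((ħ * f z.2 : ℝ) : ℂ) • G) (energyShift v en Ψ) := by
      rw [hΞ, map_add, hKH]
    filter_upwards [coeFn_multOp hRm (energyShift v en Ξ), hKχ,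
      coeFn_multOp hM (energyShift v en Ψ), hKΨ, Lp.coeFn_add (energyShift v en χ)
        (multOp volume (fun z => ((ħ * f z.2 : ℝ) : ℂ) • G) (energyShift v en Ψ))]
      with z h1 h2 h3 h4 h5
    have h6 : (W Ξ : ℝ × ℝ → EuclideanSpace ℂ n) z =
      multOp volume (fun z => unitaryFlow G (-F z.2)) (energyShift v en Ξ) z := rfl
    rw [h6, h1, hΞ', h5, Pi.add_apply, h2, h3, h4]
    simp only [map_add, map_sub, map_smul, _root_.smul_apply, mul_apply_eq_comp, smul_add, smul_smul]
    -- The factor -iħ of the clock momentum times the factor i from the flow equals ħ, the prefactor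
    -- of the interaction.
    have h7 : I * (ħ : ℂ) * ((f z.2 : ℂ) * I) = -((ħ * f z.2 : ℝ) : ℂ) := by
      push_cast; linear_combination (ħ * f z.2 : ℂ) * I_sq
    rw [h7, neg_smul]
    abel

end Evolution


/-! ### Product vectors and product states -/

section ProductVectors

variable {n : Type} [Fintype n]

theorem coeFn_productVector (v : EuclideanSpace ℂ n) (g h : Line) :
    productVector v g h =ᵐ[volume] fun z => (g z.1 * h z.2) • v :=
  (memLp_productVector v g h).coeFn_toLp

theorem ae_fst {p : ℝ → Prop} (h : ∀ᵐ x, p x) : ∀ᵐ z : ℝ × ℝ, p z.1 :=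
  Measure.quasiMeasurePreserving_fst.ae h

theorem ae_snd {p : ℝ → Prop} (h : ∀ᵐ x, p x) : ∀ᵐ z : ℝ × ℝ, p z.2 :=
  Measure.quasiMeasurePreserving_snd.ae h

theorem inner_productVector (v v' : EuclideanSpace ℂ n) (g g' h h' : Line) :
    ⟪productVector v g h, productVector v' g' h'⟫_ℂ = ⟪v, v'⟫_ℂ * ⟪g, g'⟫_ℂ * ⟪h, h'⟫_ℂ := by
  rw [L2.inner_def, L2.inner_def, L2.inner_def, mul_assoc, ← integral_prod_mul,
    ← integral_const_mul]
  refine integral_congr_ae ?_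
  filter_upwards [coeFn_productVector v g h, coeFn_productVector v' g' h'] with z h1 h2
  rw [h1, h2, inner_smul_left, inner_smul_right]
  simp only [RCLike.inner_apply, map_mul]
  ring

theorem norm_productVector (v : EuclideanSpace ℂ n) (g h : Line) :
    ‖productVector v g h‖ = ‖v‖ * ‖g‖ * ‖h‖ := by
  have h1 := inner_productVector v v g g h h
  simp only [inner_self_eq_norm_sq_to_K, RCLike.ofReal_eq_complex_ofReal] at h1
  have h2 : ‖productVector v g h‖ ^ 2 = (‖v‖ * ‖g‖ * ‖h‖) ^ 2 := by
    rw [mul_pow, mul_pow]; exact_mod_cast h1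
  exact (pow_left_inj₀ (norm_nonneg _) (by positivity) two_ne_zero).1 h2

theorem internalOp_productVector (A : EuclideanSpace ℂ n →L[ℂ] EuclideanSpace ℂ n)
    (v : EuclideanSpace ℂ n) (g h : Line) :
    internalOp A (productVector v g h) = productVector (A v) g h := by
  refine Lp.ext ?_
  filter_upwards [coeFn_internalOp A (productVector v g h), coeFn_productVector v g h,
    coeFn_productVector (A v) g h] with z h1 h2 h3
  rw [h1, h2, h3, map_smul]

theorem translate_weight_productVector (e : ℝ) (v : EuclideanSpace ℂ n) (g h : Line) :
    translate n (e, 0) (productVector v g h) = productVector v (shift volume ℂ e g) h := by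
  refine Lp.ext ?_
  filter_upwards [coeFn_shift (e, (0 : ℝ)) (productVector v g h),
    ae_sub_right (e, (0 : ℝ)) (coeFn_productVector v g h),
    coeFn_productVector v (shift volume ℂ e g) h, ae_fst (coeFn_shift e g)] with z h1 h2 h3 h4
  rw [h1, h2, h3, h4]
  simp

theorem productVector_sub_smul (v : EuclideanSpace ℂ n) (g g' h : Line) (c : ℂ) :
    productVector v (g - c • g') h = productVector v g h - c • productVector v g' h := by
  refine Lp.ext ?_
  filter_upwards [coeFn_productVector v (g - c • g') h, coeFn_productVector v g h,
    coeFn_productVector v g' h, Lp.coeFn_sub (productVector v g h) (c • productVector v g' h),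
    Lp.coeFn_smul c (productVector v g' h), ae_fst (Lp.coeFn_sub g (c • g')),
    ae_fst (Lp.coeFn_smul c g')] with z h1 h2 h3 h4 h5 h6 h7
  rw [h1, h4, Pi.sub_apply, h2, h5, Pi.smul_apply, h3, h6, Pi.sub_apply, h7, Pi.smul_apply,
    sub_mul, sub_smul, smul_eq_mul, smul_smul, mul_assoc]

theorem indicatorOp_productVector {S : Set ℝ} (hS : MeasurableSet S) (v : EuclideanSpace ℂ n)
    (g h : Line) : indicatorOp volume _ (Prod.fst ⁻¹' S) (productVector v g h) =
      productVector v (indicatorOp volume ℂ S g) h := by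
  refine Lp.ext ?_
  filter_upwards [coeFn_indicatorOp (measurable_fst hS) (productVector v g h),
    coeFn_productVector v g h, coeFn_productVector v (indicatorOp volume ℂ S g) h,
    ae_fst (coeFn_indicatorOp hS g)] with z h1 h2 h3 h4
  rw [h1, h3, h4]
  by_cases hz : z.1 ∈ S
  · rw [Set.indicator_of_mem hz, Set.indicator_of_mem (show z ∈ Prod.fst ⁻¹' S from hz), h2]
  · rw [Set.indicator_of_notMem hz, Set.indicator_of_notMem (show z ∉ Prod.fst ⁻¹' S from hz)]
    simp

theorem hasSum_mul_prod {R ι J : Type} [NormedRing R] [CompleteSpace R] {a : ι → R} {b : J → R}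
    {x y : R} (ha : HasSum a x) (hb : HasSum b y) (ha' : Summable fun i => ‖a i‖)
    (hb' : Summable fun i => ‖b i‖) : HasSum (fun q : ι × J => a q.1 * b q.2) (x * y) :=
  ha.mul hb (summable_mul_of_summable_norm ha' hb')

theorem hasSum_mul_mul {ι J K : Type} {a : ι → ℂ} {b : J → ℂ} {c : K → ℂ} {x y z : ℂ}
    (ha : HasSum a x) (hb : HasSum b y) (hc : HasSum c z) :
    HasSum (fun q : ι × J × K => a q.1 * b q.2.1 * c q.2.2) (x * y * z) := by
  have h1 := hasSum_mul_prod hb hc hb.summable.norm hc.summable.norm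
  have h2 := hasSum_mul_prod ha h1 ha.summable.norm h1.summable.norm
  simp only [mul_assoc]
  exact h2

theorem hasSum_mul_mul_real {ι J K : Type} {a : ι → ℝ} {b : J → ℝ} {c : K → ℝ} {x y z : ℝ}
    (ha : HasSum a x) (hb : HasSum b y) (hc : HasSum c z) :
    HasSum (fun q : ι × J × K => a q.1 * b q.2.1 * c q.2.2) (x * y * z) := by
  have := hasSum_mul_mul (Complex.hasSum_ofReal.2 ha) (Complex.hasSum_ofReal.2 hb)
    (Complex.hasSum_ofReal.2 hc)
  exact_mod_cast this

variable {ι J K : Type}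

/-- The ensemble of product vectors of three ensembles. -/
def productEnsemble (x : ι → EuclideanSpace ℂ n) (g : J → Line) (h : K → Line) :
    ι × J × K → Total n :=
  fun q => productVector (x q.1) (g q.2.1) (h q.2.2)

theorem hasSum_norm_productEnsemble {x : ι → EuclideanSpace ℂ n} {g : J → Line} {h : K → Line}
    (hx : HasSum (fun i => ‖x i‖ ^ 2) 1) (hg : HasSum (fun i => ‖g i‖ ^ 2) 1)
    (hh : HasSum (fun i => ‖h i‖ ^ 2) 1) : HasSum (fun q => ‖productEnsemble x g h q‖ ^ 2) 1 := by
  have := hasSum_mul_mul_real hx hg hh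
  simp only [productEnsemble, norm_productVector, mul_pow]
  simpa using this

theorem exists_productState [DecidableEq n] {ρs : Matrix n n ℂ} {ρw ρc : Line →L[ℂ] Line}
    {x : ι → EuclideanSpace ℂ n} {g : J → Line} {h : K → Line}
    (hx : IsEnsemble (Matrix.toEuclideanCLM (𝕜 := ℂ) ρs) x 1) (hg : IsEnsemble ρw g 1)
    (hh : IsEnsemble ρc h 1) :
    ∃ ρ₀, IsEnsemble ρ₀ (productEnsemble x g h) 1 ∧ IsProductState ρ₀ ρs ρw ρc := by
  obtain ⟨ρ₀, hρ₀⟩ := exists_isEnsemble (hasSum_norm_productEnsemble hx.1 hg.1 hh.1)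
  refine ⟨ρ₀, hρ₀, fun v v' a a' b b' => ?_⟩
  have h1 := hasSum_mul_mul (hx.2 v v') (hg.2 a a') (hh.2 b b')
  have h2 := hρ₀.2 (productVector v a b) (productVector v' a' b')
  refine h2.unique ?_
  convert h1 using 2 with q
  simp only [productEnsemble, inner_productVector]
  ring

/-- System and clock contribute factors that sum to 1, so finite mean energy of the weight passes to
the total initial state. -/
theorem ensembleDistribution_productEnsemble {x : ι → EuclideanSpace ℂ n} {g : J → Line}
    {h : K → Line} (hx : HasSum (fun i => ‖x i‖ ^ 2) 1) (hg : HasSum (fun i => ‖g i‖ ^ 2) 1)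
    (hh : HasSum (fun i => ‖h i‖ ^ 2) 1) :
    ensembleDistribution Prod.fst (productEnsemble x g h) =
      ensembleDistribution (fun y => y) g := by
  have h0 := hasSum_norm_productEnsemble hx hg hh
  refine Measure.ext fun B hB => ?_
  have h1 := ensembleDistribution_real measurable_fst h0 hB
  have h2 := ensembleDistribution_real (f := fun y => y) measurable_id hg hB
  have h3 := hasSum_mul_mul_real hx h2.1 hh
  rw [one_mul, mul_one] at h3
  rw [← ENNReal.toReal_eq_toReal_iff' h1.2 h2.2]
  refine h1.1.unique (Eq.mpr (congrArg (HasSum · _) (funext fun q => ?_)) h3)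
  rw [productEnsemble, indicatorOp_productVector hB, norm_productVector, mul_pow, mul_pow]
  rfl

open scoped MatrixOrder in
theorem exists_eq_conjTranspose_mul_self [DecidableEq n] {ρ : Matrix n n ℂ} (hρ : ρ.PosSemidef) :
    ∃ B : Matrix n n ℂ, ρ = Bᴴ * B := by
  refine ⟨CFC.sqrt ρ, ?_⟩
  have h1 : (CFC.sqrt ρ)ᴴ = CFC.sqrt ρ := (CFC.sqrt_nonneg ρ).posSemidef.isHermitian
  rw [h1, CFC.sqrt_mul_sqrt_self ρ hρ.nonneg]

theorem exists_ensemble_of_posSemidef [DecidableEq n] {ρ : Matrix n n ℂ} (hρ : ρ.PosSemidef)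
    (h1 : ρ.trace = 1) : ∃ x : n → EuclideanSpace ℂ n,
      IsEnsemble (Matrix.toEuclideanCLM (𝕜 := ℂ) ρ) x 1 ∧
        ∀ a b, ρ a b = ∑ i, x i a * star (x i b) := by
  obtain ⟨B, hB⟩ := exists_eq_conjTranspose_mul_self hρ
  have hab : ∀ a b, ρ a b = ∑ i, star (B i a) * star (star (B i b)) := fun a b => by
    rw [hB, Matrix.mul_apply]
    simp
  refine ⟨fun i => WithLp.toLp 2 fun a => star (B i a), ⟨?_, fun y z => ?_⟩, hab⟩
  · have h2 : ∑ i, ‖(WithLp.toLp 2 fun a => star (B i a) : EuclideanSpace ℂ n)‖ ^ 2 = 1 := by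
      have h3 : (ρ.trace).re = 1 := by rw [h1]; simp
      rw [← h3, Matrix.trace, Complex.re_sum]
      simp only [Matrix.diag_apply, hab, Complex.re_sum, EuclideanSpace.norm_sq_eq]
      rw [Finset.sum_comm]
      refine Finset.sum_congr rfl fun a _ => Finset.sum_congr rfl fun i _ => ?_
      rw [← Complex.normSq_eq_norm_sq, RCLike.star_def, Complex.mul_conj,
        ofReal_re]
    rw [← h2]
    exact hasSum_fintype _
  · have h2 : ⟪y, Matrix.toEuclideanCLM (𝕜 := ℂ) ρ z⟫_ℂ =
        ∑ i, ⟪y, (WithLp.toLp 2 fun a => star (B i a) : EuclideanSpace ℂ n)⟫_ℂ *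
          ⟪(WithLp.toLp 2 fun a => star (B i a) : EuclideanSpace ℂ n), z⟫_ℂ := by
      have h3 : ∀ (i : n) (w : EuclideanSpace ℂ n), ⟪(WithLp.toLp 2 fun a => star (B i a) :
          EuclideanSpace ℂ n), w⟫_ℂ = Matrix.toEuclideanCLM (𝕜 := ℂ) B w i := fun i w => by
        simp [PiLp.inner_apply, Matrix.mulVec, dotProduct, mul_comm]
      rw [hB, ← star_eq_conjTranspose, map_mul, map_star, mul_apply_eq_comp,
        ContinuousLinearMap.star_eq_adjoint, ContinuousLinearMap.adjoint_inner_right,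
        PiLp.inner_apply]
      refine Finset.sum_congr rfl fun i _ => ?_
      rw [← inner_conj_symm y, h3, h3, RCLike.inner_apply, mul_comm]
    rw [h2]
    exact hasSum_fintype _

end ProductVectors


/-! ### Momentum and translations of the weight -/

section Momentum

open scoped FourierTransform SchwartzMap

theorem isMultiplier_fourierPhase (w : ℝ) : IsMultiplier fun ξ : ℝ =>
    cexp (-(I * (2 * Real.pi * w * ξ : ℝ))) • (1 : ℂ →L[ℂ] ℂ) := by
  refine isMultiplier_smul_one (C := 1) ?_ fun ξ => (norm_cexp_neg_I_mul _).le
  exact Continuous.stronglyMeasurable (by fun_prop)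

theorem fourier_comp_sub (f : ℝ → ℂ) (w ξ : ℝ) :
    𝓕 (fun x => f (x - w)) ξ = cexp (-(I * (2 * Real.pi * w * ξ : ℝ))) * 𝓕 f ξ := by
  rw [Real.fourier_real_eq_integral_exp_smul, Real.fourier_real_eq_integral_exp_smul,
    ← integral_const_mul]
  symm
  rw [← integral_sub_right_eq_self _ w]
  refine integral_congr_ae (Filter.Eventually.of_forall fun x => ?_)
  simp only [smul_eq_mul]
  rw [← mul_assoc, ← Complex.exp_add]
  congr 2
  push_cast
  ring

/-- Both sides are continuous in `g`, so the identity needs to be checked only on the dense set of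
Schwartz functions, where the Fourier integral is available. -/
theorem fourier_shift (w : ℝ) (g : Line) :
    Lp.fourierTransformₗᵢ ℝ ℂ (shift volume ℂ w g) =
      multOp volume (fun ξ : ℝ => cexp (-(I * (2 * Real.pi * w * ξ : ℝ))) • (1 : ℂ →L[ℂ] ℂ))
        (Lp.fourierTransformₗᵢ ℝ ℂ g) := by
  refine DenseRange.induction_on (SchwartzMap.denseRange_toLpCLM (F := ℂ) (E := ℝ)
    (μ := volume) (p := 2) ENNReal.ofNat_ne_top) g ?_ fun f => ?_
  · exact isClosed_eq ((Lp.fourierTransformₗᵢ ℝ ℂ).continuous.comp (shift volume ℂ w).continuous)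
      ((multOp volume _).continuous.comp (Lp.fourierTransformₗᵢ ℝ ℂ).continuous)
  · rw [SchwartzMap.toLpCLM_apply]
    have h1 : shift volume ℂ w (f.toLp 2) = (f.compSubConstCLM ℂ w).toLp 2 := by
      refine Lp.ext ?_
      filter_upwards [coeFn_shift w (f.toLp 2 volume), ae_sub_right w (f.coeFn_toLp 2 volume),
        (f.compSubConstCLM ℂ w).coeFn_toLp 2 volume] with x h1 h2 h3
      rw [h1, h2, h3, SchwartzMap.compSubConstCLM_apply]
    rw [h1]
    have h2 : ∀ f : 𝓢(ℝ, ℂ), Lp.fourierTransformₗᵢ ℝ ℂ (f.toLp 2) = (𝓕 f).toLp 2 :=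
      SchwartzMap.toLp_fourier_eq
    rw [h2, h2]
    refine Lp.ext ?_
    filter_upwards [(𝓕 (f.compSubConstCLM ℂ w)).coeFn_toLp 2 volume, (𝓕 f).coeFn_toLp 2 volume,
      coeFn_multOp (isMultiplier_fourierPhase w) ((𝓕 f).toLp 2 volume)] with ξ h3 h4 h5
    rw [h3, h5, h4, SchwartzMap.fourier_coe, SchwartzMap.fourier_coe]
    exact fourier_comp_sub f w ξ

theorem norm_cexp_neg_sub_le (x y : ℝ) : ‖cexp (-(I * x)) - cexp (-(I * y))‖ ≤ |x - y| := by
  have h1 : cexp (-(I * x)) - cexp (-(I * y)) =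
      cexp (-(I * y)) * (cexp (I * ((y - x : ℝ) : ℂ)) - 1) := by
    rw [mul_sub, ← Complex.exp_add, mul_one]
    congr 2
    push_cast
    ring
  rw [h1, norm_mul, norm_cexp_neg_I_mul, one_mul, abs_sub_comm]
  exact Real.norm_exp_I_mul_ofReal_sub_one_le

/-- The momenta at distance at least `δ` from `p₀`, in the Fourier variable. -/
def momentumTail (ħ p₀ δ : ℝ) : Set ℝ := {ξ | 2 * Real.pi * ħ * ξ ∈ {p | δ ≤ |p - p₀|}}

theorem measurableSet_momentumTail (ħ p₀ δ : ℝ) : MeasurableSet (momentumTail ħ p₀ δ) := by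
  have : Continuous fun ξ : ℝ => |2 * Real.pi * ħ * ξ - p₀| := by fun_prop
  exact measurableSet_le measurable_const this.measurable

/-- A translation acts nearly as a phase factor on a wave function with narrow momentum
distribution. -/
theorem norm_shift_sub_sq_le {ħ : ℝ} (hħ : 0 < ħ) (p₀ δ w : ℝ) (g : Line) :
    ‖shift volume ℂ w g - cexp (-(I * (w * p₀ / ħ : ℝ))) • g‖ ^ 2 ≤
      (w * δ / ħ) ^ 2 * ‖g‖ ^ 2 +
        4 * ‖indicatorOp volume ℂ (momentumTail ħ p₀ δ) (Lp.fourierTransformₗᵢ ℝ ℂ g)‖ ^ 2 := by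
  set G := Lp.fourierTransformₗᵢ ℝ ℂ g with hG
  set c := cexp (-(I * (w * p₀ / ħ : ℝ)))
  set M := fun ξ : ℝ => cexp (-(I * (2 * Real.pi * w * ξ : ℝ))) • (1 : ℂ →L[ℂ] ℂ)
  have h1 : ‖shift volume ℂ w g - c • g‖ = ‖multOp volume M G - c • G‖ := by
    rw [← (Lp.fourierTransformₗᵢ ℝ ℂ).norm_map, map_sub, map_smul, fourier_shift]
  have h2 : ‖g‖ = ‖G‖ := ((Lp.fourierTransformₗᵢ ℝ ℂ).norm_map g).symm
  have hS := measurableSet_momentumTail ħ p₀ δ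
  rw [h1, h2, norm_sq_eq_integral, norm_sq_eq_integral, norm_sq_eq_integral,
    ← integral_const_mul, ← integral_const_mul,
    ← integral_add ((integrable_norm_sq _).const_mul _) ((integrable_norm_sq _).const_mul _)]
  refine integral_mono_ae (integrable_norm_sq _)
    (((integrable_norm_sq _).const_mul _).add ((integrable_norm_sq _).const_mul _)) ?_
  filter_upwards [Lp.coeFn_sub (multOp volume M G) (c • G), Lp.coeFn_smul c G,
    coeFn_multOp (isMultiplier_fourierPhase w) G, coeFn_indicatorOp hS G] with ξ h3 h4 h5 h6
  have h7 : (multOp volume M G - c • G : Line) ξ =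
      (cexp (-(I * (2 * Real.pi * w * ξ : ℝ))) - c) * G ξ := by
    rw [h3, Pi.sub_apply, h4, h5, Pi.smul_apply, sub_mul, smul_eq_mul]
    rfl
  simp only [h7, h6, norm_mul, mul_pow]
  -- In the tail two unimodular numbers differ by at most 2, whence the factor 4. Outside it the
  -- exponents differ by at most `|w * δ / ħ|`.
  by_cases hξ : ξ ∈ momentumTail ħ p₀ δ
  · rw [Set.indicator_of_mem hξ]
    have h8 : ‖cexp (-(I * (2 * Real.pi * w * ξ : ℝ))) - c‖ ≤ 2 := by
      refine (norm_sub_le _ _).trans ?_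
      rw [norm_cexp_neg_I_mul, norm_cexp_neg_I_mul]
      norm_num
    have h9 : ‖cexp (-(I * (2 * Real.pi * w * ξ : ℝ))) - c‖ ^ 2 ≤ 4 := by
      nlinarith [norm_nonneg (cexp (-(I * (2 * Real.pi * w * ξ : ℝ))) - c)]
    nlinarith [sq_nonneg (‖G ξ‖), mul_nonneg (sq_nonneg (w * δ / ħ)) (sq_nonneg ‖G ξ‖)]
  · rw [Set.indicator_of_notMem hξ, norm_zero]
    have h8 : |2 * Real.pi * ħ * ξ - p₀| ≤ δ := by
      simp only [momentumTail, Set.mem_ofPred_eq, not_le] at hξ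
      exact hξ.le
    have h9 : ‖cexp (-(I * (2 * Real.pi * w * ξ : ℝ))) - c‖ ≤ |w * δ / ħ| := by
      refine (norm_cexp_neg_sub_le _ _).trans ?_
      have : 2 * Real.pi * w * ξ - w * p₀ / ħ = w / ħ * (2 * Real.pi * ħ * ξ - p₀) := by
        field_simp
      rw [this, abs_mul, mul_div_right_comm, abs_mul]
      exact mul_le_mul_of_nonneg_left (h8.trans (le_abs_self δ)) (abs_nonneg _)
    have h10 := pow_le_pow_left₀ (norm_nonneg _) h9 2
    rw [sq_abs] at h10
    nlinarith [sq_nonneg (‖G ξ‖)]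

theorem inner_momentumProjection (ħ p₀ δ : ℝ) (g : Line) :
    ⟪g, momentumProjection ħ {p | δ ≤ |p - p₀|} g⟫_ℂ =
      ((‖indicatorOp volume ℂ (momentumTail ħ p₀ δ) (Lp.fourierTransformₗᵢ ℝ ℂ g)‖ ^ 2 : ℝ) : ℂ)
        := by
  rw [← inner_indicatorOp (measurableSet_momentumTail ħ p₀ δ),
    ← (Lp.fourierTransformₗᵢ ℝ ℂ).inner_map_map g]
  congr 1
  exact (Lp.fourierTransformₗᵢ ℝ ℂ).apply_symm_apply _

/-- The tail probability of the state is spread over the members of an ensemble; only the sum of the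
tails is small, not each one relative to its norm. -/
theorem IsEnsemble.tsum_momentumTail {ι : Type} {ρ : Line →L[ℂ] Line} {g : ι → Line}
    (hg : IsEnsemble ρ g 1) {ħ p₀ δ r : ℝ}
    (hr : HasTrace (momentumProjection ħ {p | δ ≤ |p - p₀|} ∘L ρ) r) :
    HasSum (fun j => ‖indicatorOp volume ℂ (momentumTail ħ p₀ δ)
      (Lp.fourierTransformₗᵢ ℝ ℂ (g j))‖ ^ 2) r := by
  have h1 := (hg.hasTrace (momentumProjection ħ {p | δ ≤ |p - p₀|})).unique hr
  simp only [inner_momentumProjection] at h1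
  have h2 : Summable fun j => ‖indicatorOp volume ℂ (momentumTail ħ p₀ δ)
      (Lp.fourierTransformₗᵢ ℝ ℂ (g j))‖ ^ 2 := by
    refine Summable.of_nonneg_of_le (fun _ => by positivity) (fun j => ?_) hg.1.summable
    have h3 := norm_indicatorOp_le (measurableSet_momentumTail ħ p₀ δ)
      (Lp.fourierTransformₗᵢ ℝ ℂ (g j))
    rw [LinearIsometryEquiv.norm_map] at h3
    exact pow_le_pow_left₀ (norm_nonneg _) h3 2
  rw [← ofReal_tsum, ofReal_inj] at h1
  rw [← h1]
  exact h2.hasSum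

/-- Of the two factors of `f` in the density, one is bounded and the other decays fast enough to
absorb the position. -/
theorem integrable_ensembleDistribution_schwartz (f : 𝓢(ℝ, ℂ)) {c : ℂ} :
    Integrable (fun y => y)
      (ensembleDistribution (fun y => y) fun _ : Unit => c • f.toLp 2 volume) := by
  have h0 : ensembleDistribution (fun y : ℝ => y) (fun _ : Unit => c • f.toLp 2 volume) =
      volume.withDensity fun z => ‖c * f z‖ₑ ^ 2 := by
    rw [ensembleDistribution, Measure.sum_fintype]
    simp only [Finset.univ_unique, Finset.sum_singleton]
    rw [Measure.map_id']
    refine withDensity_congr_ae ?_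
    filter_upwards [Lp.coeFn_smul c (f.toLp 2 volume), f.coeFn_toLp 2 volume] with x h1 h2
    rw [h1, Pi.smul_apply, h2, smul_eq_mul]
  have hm : Measurable fun z => ‖c * f z‖ₑ ^ 2 := by
    have := f.continuous
    exact (Continuous.measurable (by fun_prop))
  rw [h0, integrable_withDensity_iff hm (Filter.Eventually.of_forall fun z => by finiteness)]
  obtain ⟨C, hC⟩ := f.decay 0 0
  have hC2 : ∀ z, ‖f z‖ ≤ C := fun z => by simpa using hC.2 z
  have h1 := (f.integrable_pow_mul volume 1).const_mul (‖c‖ ^ 2 * C)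
  refine h1.mono' ?_ (Filter.Eventually.of_forall fun z => ?_)
  · have := f.continuous
    exact (measurable_id.mul hm.ennreal_toReal).aestronglyMeasurable
  · rw [ENNReal.toReal_pow, toReal_enorm, norm_mul, norm_pow, norm_norm, norm_mul, pow_one,
      mul_pow]
    have h2 := hC2 z
    have h3 : 0 ≤ ‖z‖ * ‖c‖ ^ 2 * ‖f z‖ := by positivity
    nlinarith

/-- A normalized bump around p₀ in momentum space has no tail at all; it is a Schwartz function, so
its inverse Fourier transform has finite mean position. -/
theorem exists_isNarrowWeight {ħ : ℝ} (hħ : 0 < ħ) (p₀ : ℝ) {δ : ℝ} (hδ : 0 < δ) :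
    ∃ ρ, IsNarrowWeight ħ p₀ δ ρ := by
  -- Momentum is 2πħξ, so centre and radius of the bump are those of the momentum window divided by
  -- 2πħ.
  have hr : 0 < 2 * Real.pi * ħ := by positivity
  let φ : ContDiffBump (p₀ / (2 * Real.pi * ħ)) :=
    ⟨δ / (2 * Real.pi * ħ) / 2, δ / (2 * Real.pi * ħ), by positivity, half_lt_self (by positivity)⟩
  have hc : HasCompactSupport fun ξ => (φ ξ : ℂ) :=
    φ.hasCompactSupport.comp_left (g := fun x : ℝ => (x : ℂ)) ofReal_zero
  have hd : ContDiff ℝ ∞ fun ξ => (φ ξ : ℂ) := ofRealCLM.contDiff.comp φ.contDiff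
  let η : 𝓢(ℝ, ℂ) := hc.toSchwartzMap hd
  have hη : ∀ ξ, η ξ = φ ξ := fun ξ => rfl
  have hη0 : η.toLp 2 volume ≠ 0 := by
    intro h
    have h1 : η = 0 := SchwartzMap.injective_toLp 2 volume (by
      exact h.trans ((SchwartzMap.toLpCLM ℂ ℂ 2 volume).map_zero).symm)
    have h2 := hη (p₀ / (2 * Real.pi * ħ))
    rw [h1, φ.one_of_mem_closedBall (Metric.mem_closedBall_self φ.rIn_pos.le)] at h2
    simp at h2
  have hn : ‖η.toLp 2 volume‖ ≠ 0 := norm_ne_zero_iff.2 hη0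
  have hf : Lp.fourierTransformₗᵢ ℝ ℂ ((𝓕⁻ η).toLp 2) = η.toLp 2 := by
    rw [← SchwartzMap.toLp_fourierInv_eq]
    exact (Lp.fourierTransformₗᵢ ℝ ℂ).apply_symm_apply _
  set c : ℂ := ((‖η.toLp 2 volume‖⁻¹ : ℝ) : ℂ)
  have hsum : HasSum (fun _ : Unit => ‖c • (𝓕⁻ η).toLp 2 volume‖ ^ 2) 1 := by
    have h1 : ‖c • (𝓕⁻ η).toLp 2 volume‖ ^ 2 = 1 := by
      rw [← (Lp.fourierTransformₗᵢ ℝ ℂ).norm_map, map_smul, hf, norm_smul, norm_real, norm_inv,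
        norm_norm, inv_mul_cancel₀ hn, one_pow]
    rw [h1]
    simp
  obtain ⟨ρ, hρ⟩ := exists_isEnsemble hsum
  refine ⟨ρ, hρ.isDensity, ⟨_, (hρ.hasMean_iff measurable_id).2
    ⟨integrable_ensembleDistribution_schwartz _, rfl⟩⟩, 0, hδ.le, ?_⟩
  have h1 := hρ.hasTrace (momentumProjection ħ {p | δ ≤ |p - p₀|})
  simp only [inner_momentumProjection] at h1
  have h2 : indicatorOp volume ℂ (momentumTail ħ p₀ δ) (η.toLp 2 volume) = 0 := by
    refine Lp.ext ?_
    filter_upwards [coeFn_indicatorOp (measurableSet_momentumTail ħ p₀ δ) (η.toLp 2 volume),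
      η.coeFn_toLp 2 volume, Lp.coeFn_zero ℂ 2 (volume : Measure ℝ)] with ξ h3 h4 h5
    rw [h3, h5, Pi.zero_apply]
    by_cases hξ : ξ ∈ momentumTail ħ p₀ δ
    · rw [Set.indicator_of_mem hξ, h4, hη, φ.zero_of_le_dist, ofReal_zero]
      change δ ≤ |2 * Real.pi * ħ * ξ - p₀| at hξ
      change δ / (2 * Real.pi * ħ) ≤ dist ξ (p₀ / (2 * Real.pi * ħ))
      rw [Real.dist_eq, div_le_iff₀ hr]
      refine hξ.trans (le_of_eq ?_)
      rw [← abs_of_pos hr, ← abs_mul, abs_of_pos hr, sub_mul, div_mul_cancel₀ _ hr.ne', mul_comm ξ]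
    · rw [Set.indicator_of_notMem hξ]
  simpa [map_smul, hf, h2] using h1

end Momentum


/-! ### Running the machine on product states -/

section Running

variable {n : Type} [Fintype n] [DecidableEq n]

theorem HasTrace.zero {K : Type} [NormedAddCommGroup K] [InnerProductSpace ℂ K] :
    HasTrace (0 : K →L[ℂ] K) 0 := fun s b => by
  simp

/-- The probability outside the interval is a vanishing sum of nonnegative terms, so every member of
the ensemble is supported in the interval. -/
theorem IsClockState.exists_ensemble {a K : ℝ} {ρ : Line →L[ℂ] Line} (h : IsClockState a K ρ) :
    ∃ (κ : Type) (w : κ → Line), IsEnsemble ρ w 1 ∧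
      ∀ k, ∀ᵐ y, y ∉ Set.Icc a (a + K) → w k y = 0 := by
  obtain ⟨κ, w, hw⟩ := h.1.exists_ensemble
  refine ⟨κ, w, hw, fun k => ?_⟩
  have hS : MeasurableSet (Set.Icc a (a + K))ᶜ := measurableSet_Icc.compl
  have h1 := hw.hasTrace_indicatorOp (f := fun y => y) measurable_id hS
  rw [Set.preimage_id', h.2] at h1
  have h2 := (ensembleDistribution_real (f := fun y => y) measurable_id hw.1 hS).1
  rw [ofReal_eq_zero.1 (h1.unique HasTrace.zero),
    hasSum_zero_iff_of_nonneg fun _ => by positivity] at h2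
  have h3 : indicatorOp volume ℂ (Set.Icc a (a + K))ᶜ (w k) = 0 := by
    simpa using congrFun h2 k
  filter_upwards [coeFn_indicatorOp hS (w k), Lp.coeFn_zero ℂ 2 (volume : Measure ℝ)]
    with y h4 h5 hy
  rw [h3, h5, Set.indicator_of_mem hy] at h4
  exact h4.symm

/-- The clock moves rigidly at unit speed. At time 0 it lies where F = 0, so W acts as D; at time
`t` it lies where F = 1, so W* acts as D* exp(-iG). This is exact and makes no assumption on the
weight. -/
theorem machineGroup_apply_of_support {ħ : ℝ}
    {v : OrthonormalBasis n ℂ (EuclideanSpace ℂ n)} {en : n → ℝ}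
    {G : EuclideanSpace ℂ n →L[ℂ] EuclideanSpace ℂ n} (hG : IsSelfAdjoint G) {F : ℝ → ℝ}
    (hF : Continuous F) {a K L t : ℝ} (hF0 : ∀ y ≤ a + K, F y = 0)
    (hF1 : ∀ y, a + K + L ≤ y → F y = 1) (ht : K + L ≤ t) {Ψ : Total n}
    (hΨ : ∀ᵐ z, z.2 ∉ Set.Icc a (a + K) → Ψ z = 0) :
    energyShift v en (machineGroup ħ v en hG hF t Ψ) =
      internalOp (unitaryFlow G 1) (freeGroup n ħ t (energyShift v en Ψ)) := by
  have hD : ∀ᵐ z, z.2 ∉ Set.Icc a (a + K) → energyShift v en Ψ z = 0 := by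
    have h1 : Ψ =ᵐ[volume] fun z => (Prod.snd ⁻¹' Set.Icc a (a + K)).indicator Ψ z := by
      filter_upwards [hΨ] with z hz
      by_cases h : z.2 ∈ Set.Icc a (a + K)
      · rw [Set.indicator_of_mem (show z ∈ Prod.snd ⁻¹' Set.Icc a (a + K) from h)]
      · rw [hz h, Set.indicator_of_notMem (show z ∉ Prod.snd ⁻¹' Set.Icc a (a + K) from h)]
    filter_upwards [coeFn_conditionalShift v (fun m => (en m, 0)) h1] with z h2 hz
    rw [energyShift, h2]
    refine Finset.sum_eq_zero fun m _ => ?_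
    rw [Set.indicator_of_notMem, map_zero]
    simpa using hz
  have hM := isMultiplier_unitaryFlow hG (s := fun z : ℝ × ℝ => -F z.2) (by fun_prop)
  have e1 : machineFrame v en G F Ψ = energyShift v en Ψ := by
    rw [machineFrame, mul_apply_eq_comp]
    refine Lp.ext ?_
    filter_upwards [hD, coeFn_multOp hM (energyShift v en Ψ)] with z h1 h2
    rw [h2]
    by_cases h : z.2 ∈ Set.Icc a (a + K)
    · rw [hF0 _ h.2, neg_zero, unitaryFlow_zero, one_apply_eq_self]
    · rw [h1 h, map_zero]
  have e2 : star (machineFrame v en G F) = star (energyShift v en) *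
      multOp volume fun z => unitaryFlow G (F z.2) := by
    rw [machineFrame, star_mul, star_multOp hM]
    simp only [star_unitaryFlow hG, neg_neg]
  have hM' := isMultiplier_unitaryFlow hG (s := fun z : ℝ × ℝ => F z.2) (by fun_prop)
  have e3 : multOp volume (fun z => unitaryFlow G (F z.2)) (freeGroup n ħ t (energyShift v en Ψ)) =
      internalOp (unitaryFlow G 1) (freeGroup n ħ t (energyShift v en Ψ)) := by
    refine Lp.ext ?_
    filter_upwards [ae_sub_right (0, t) hD, coeFn_freeGroup ħ t (energyShift v en Ψ),
      coeFn_multOp hM' (freeGroup n ħ t (energyShift v en Ψ)),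
      coeFn_internalOp (unitaryFlow G 1) (freeGroup n ħ t (energyShift v en Ψ))] with z h1 h2 h3 h4
    rw [h3, h4]
    by_cases h : (z - (0, t)).2 ∈ Set.Icc a (a + K)
    · rw [hF1]
      -- The clock started at or after `a` and has moved by `t ≥ K + L`, so it has left the
      -- interaction region.
      have := h.1
      rw [Prod.snd_sub] at this
      linarith
    · rw [h2, h1 h, smul_zero, map_zero, map_zero]
  rw [machineGroup_apply, mul_apply_eq_comp, mul_apply_eq_comp, e1, e2, mul_apply_eq_comp, e3,
    ← mul_apply_eq_comp, Unitary.mul_star_self_of_mem (energyShift_mem_unitary v en),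
    one_apply_eq_self]

/-! #### The deviation from the ideal evolution -/

/-- The phase factors by which the energy shift acts on a weight of momentum `p₀`. -/
def phaseShift (v : OrthonormalBasis n ℂ (EuclideanSpace ℂ n)) (en : n → ℝ) (ħ p₀ : ℝ) :
    EuclideanSpace ℂ n →L[ℂ] EuclideanSpace ℂ n :=
  spectralOp v fun m => cexp (-(I * (en m * p₀ / ħ : ℝ)))

theorem phaseShift_mul_neg (v : OrthonormalBasis n ℂ (EuclideanSpace ℂ n)) (en : n → ℝ)
    (ħ p₀ : ℝ) : phaseShift v en ħ p₀ * phaseShift v en ħ (-p₀) = 1 := by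
  rw [phaseShift, phaseShift, spectralOp_mul, ← sum_basisProj v, spectralOp]
  refine Finset.sum_congr rfl fun m _ => ?_
  rw [← Complex.exp_add]
  have : -(I * ((en m * p₀ / ħ : ℝ) : ℂ)) + -(I * ((en m * -p₀ / ħ : ℝ) : ℂ)) = 0 := by
    push_cast; ring
  rw [this, Complex.exp_zero]
  exact one_smul ℂ (basisProj v m)

theorem star_phaseShift (v : OrthonormalBasis n ℂ (EuclideanSpace ℂ n)) (en : n → ℝ)
    (ħ p₀ : ℝ) : star (phaseShift v en ħ p₀) = phaseShift v en ħ (-p₀) := by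
  refine (map_sum (starAddEquiv (R := EuclideanSpace ℂ n →L[ℂ] EuclideanSpace ℂ n))
    (fun m => cexp (-(I * (en m * p₀ / ħ : ℝ))) • basisProj v m) Finset.univ).trans ?_
  refine Finset.sum_congr rfl fun m _ => ?_
  rw [starAddEquiv_apply, star_smul, star_basisProj, RCLike.star_def, ← Complex.exp_conj]
  congr 2
  rw [map_neg, map_mul, conj_I, conj_ofReal]
  push_cast; ring

theorem phaseShift_mem_unitary (v : OrthonormalBasis n ℂ (EuclideanSpace ℂ n)) (en : n → ℝ)
    (ħ p₀ : ℝ) : phaseShift v en ħ p₀ ∈ unitary (EuclideanSpace ℂ n →L[ℂ] EuclideanSpace ℂ n) := by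
  rw [Unitary.mem_iff, star_phaseShift]
  refine ⟨?_, phaseShift_mul_neg v en ħ p₀⟩
  simpa using phaseShift_mul_neg v en ħ (-p₀)

theorem norm_basisProj_apply_le (v : OrthonormalBasis n ℂ (EuclideanSpace ℂ n)) (m : n)
    (x : EuclideanSpace ℂ n) : ‖basisProj v m x‖ ≤ ‖x‖ := by
  rw [basisProj_apply, norm_smul, v.orthonormal.1 m, mul_one]
  simpa [v.orthonormal.1 m] using norm_inner_le_norm (𝕜 := ℂ) (v m) x

/-- On each energy level D translates the weight, whereas Z multiplies by the phase of momentum p₀;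
the two are compared level by level. -/
theorem norm_energyShift_sub_phaseShift_le (v : OrthonormalBasis n ℂ (EuclideanSpace ℂ n))
    (en : n → ℝ) (ħ p₀ : ℝ) (x : EuclideanSpace ℂ n) (g h : Line) :
    ‖energyShift v en (productVector x g h) -
        internalOp (phaseShift v en ħ p₀) (productVector x g h)‖ ≤
      ‖x‖ * ‖h‖ * ∑ m, ‖shift volume ℂ (en m) g - cexp (-(I * (en m * p₀ / ħ : ℝ))) • g‖ := by
  have h1 : energyShift v en (productVector x g h) -
      internalOp (phaseShift v en ħ p₀) (productVector x g h) =
      ∑ m, productVector (basisProj v m x)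
        (shift volume ℂ (en m) g - cexp (-(I * (en m * p₀ / ħ : ℝ))) • g) h := by
    rw [energyShift, conditionalShift, phaseShift, spectralOp, internalOp_sum, _root_.sum_apply,
      _root_.sum_apply, ← Finset.sum_sub_distrib]
    refine Finset.sum_congr rfl fun m _ => ?_
    rw [mul_apply_eq_comp, translate_weight_productVector, internalOp_productVector,
      internalOp_smul, _root_.smul_apply, internalOp_productVector, productVector_sub_smul]
  rw [h1, Finset.mul_sum]
  refine (norm_sum_le _ _).trans (Finset.sum_le_sum fun m _ => ?_)
  rw [norm_productVector, mul_right_comm]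
  gcongr
  exact norm_basisProj_apply_le v m x

theorem norm_internalOp_of_mem_unitary {A : EuclideanSpace ℂ n →L[ℂ] EuclideanSpace ℂ n}
    (hA : A ∈ unitary (EuclideanSpace ℂ n →L[ℂ] EuclideanSpace ℂ n)) (Ψ : Total n) :
    ‖internalOp A Ψ‖ = ‖Ψ‖ :=
  Unitary.norm_map ⟨internalOp A, multOp_mem_unitary (isMultiplier_const A) fun _ => hA⟩ Ψ

theorem norm_freeGroup_apply (ħ t : ℝ) (Ψ : Total n) : ‖freeGroup n ħ t Ψ‖ = ‖Ψ‖ :=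
  Unitary.norm_map ⟨_, freeGroup_mem_unitary ħ t⟩ Ψ

theorem norm_energyShift_apply (v : OrthonormalBasis n ℂ (EuclideanSpace ℂ n)) (en : n → ℝ)
    (Ψ : Total n) : ‖energyShift v en Ψ‖ = ‖Ψ‖ :=
  Unitary.norm_map ⟨_, energyShift_mem_unitary v en⟩ Ψ

theorem freeGroup_mul_energyShift {ħ : ℝ} {v : OrthonormalBasis n ℂ (EuclideanSpace ℂ n)}
    {en : n → ℝ} {Hs : Matrix n n ℂ} (hen : IsEigenbasis Hs v en) (t : ℝ) :
    freeGroup n ħ t * energyShift v en = energyShift v en *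
      (freeGroup n ħ t * internalOp (Matrix.toEuclideanCLM (𝕜 := ℂ) (propagator ħ Hs t))) := by
  rw [freeGroup, mul_assoc, energyShift, ← conditionalShift_commute_translate, ← mul_assoc]
  change phaseOp n ħ t * energyShift v en * _ = energyShift v en * _
  rw [phaseOp_mul_energyShift hen, mul_assoc, mul_assoc, mul_assoc, translate_mul_internalOp]

/-- After applying D, the vectors to compare are exp(-iG) DΨ and D VΨ, up to the isometric free
group. Both are close to exp(-iG) ZΨ = Z VΨ, and the two replacements of D by Z account for the
factor 2. The bound does not depend on time. -/
theorem norm_machineGroup_sub_le {ħ : ℝ}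
    {v : OrthonormalBasis n ℂ (EuclideanSpace ℂ n)} {en : n → ℝ} {Hs : Matrix n n ℂ}
    (hen : IsEigenbasis Hs v en)
    {G V : EuclideanSpace ℂ n →L[ℂ] EuclideanSpace ℂ n} (hG : IsSelfAdjoint G) {F : ℝ → ℝ}
    (hF : Continuous F) {a K L t p₀ : ℝ} (hF0 : ∀ y ≤ a + K, F y = 0)
    (hF1 : ∀ y, a + K + L ≤ y → F y = 1) (ht : K + L ≤ t)
    (hV : V ∈ unitary (EuclideanSpace ℂ n →L[ℂ] EuclideanSpace ℂ n))
    (hGV : unitaryFlow G 1 = phaseShift v en ħ p₀ * V * phaseShift v en ħ (-p₀))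
    (x : EuclideanSpace ℂ n) (g : Line) {h : Line}
    (hh : ∀ᵐ y, y ∉ Set.Icc a (a + K) → h y = 0) :
    ‖machineGroup ħ v en hG hF t (productVector x g h) - freeGroup n ħ t
        (internalOp (Matrix.toEuclideanCLM (𝕜 := ℂ) (propagator ħ Hs t) * V)
          (productVector x g h))‖ ≤
      2 * (‖x‖ * ‖h‖) *
        ∑ m, ‖shift volume ℂ (en m) g - cexp (-(I * (en m * p₀ / ħ : ℝ))) • g‖ := by
  set Ψ := productVector x g h with hΨ
  have hs : ∀ᵐ z, z.2 ∉ Set.Icc a (a + K) → Ψ z = 0 := by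
    filter_upwards [coeFn_productVector x g h, ae_snd hh] with z h1 h2 hz
    rw [h1, h2 hz, mul_zero, zero_smul]
  have e1 := machineGroup_apply_of_support (ħ := ħ) (v := v) (en := en) hG hF hF0 hF1 ht hs
  have e2 : energyShift v en (freeGroup n ħ t
      (internalOp (Matrix.toEuclideanCLM (𝕜 := ℂ) (propagator ħ Hs t) * V) Ψ)) =
      freeGroup n ħ t (energyShift v en (internalOp V Ψ)) := by
    rw [internalOp_mul, mul_apply_eq_comp, ← mul_apply_eq_comp (freeGroup n ħ t),
      ← mul_apply_eq_comp (energyShift v en), ← freeGroup_mul_energyShift hen, mul_apply_eq_comp]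
  have e3 : internalOp (unitaryFlow G 1) (freeGroup n ħ t (energyShift v en Ψ)) =
      freeGroup n ħ t (internalOp (unitaryFlow G 1) (energyShift v en Ψ)) := by
    rw [← mul_apply_eq_comp, ← freeGroup_mul_internalOp, mul_apply_eq_comp]
  -- This is where the choice exp(-iG) = Z V Z* enters.
  have e4 : internalOp (unitaryFlow G 1) (internalOp (phaseShift v en ħ p₀) Ψ) =
      internalOp (phaseShift v en ħ p₀) (internalOp V Ψ) := by
    rw [← mul_apply_eq_comp, ← mul_apply_eq_comp, ← internalOp_mul, ← internalOp_mul, hGV, mul_assoc]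
    have := phaseShift_mul_neg v en ħ (-p₀)
    rw [neg_neg] at this
    rw [this, mul_one]
  have e5 : internalOp V Ψ = productVector (V x) g h := internalOp_productVector V x g h
  have e6 : ‖V x‖ = ‖x‖ := Unitary.norm_map ⟨V, hV⟩ x
  rw [← norm_energyShift_apply v en, map_sub, e1, e2, e3, ← map_sub, norm_freeGroup_apply]
  refine (norm_sub_le_norm_sub_add_norm_sub _
    (internalOp (unitaryFlow G 1) (internalOp (phaseShift v en ħ p₀) Ψ)) _).trans ?_
  rw [← map_sub, norm_internalOp_of_mem_unitary (unitaryFlow_mem_unitary hG 1), e4, e5,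
    norm_sub_rev (internalOp (phaseShift v en ħ p₀) _)]
  have b1 := norm_energyShift_sub_phaseShift_le v en ħ p₀ x g h
  have b2 := norm_energyShift_sub_phaseShift_le v en ħ p₀ (V x) g h
  rw [e6] at b2
  linarith

theorem norm_toEuclideanCLM_single_le (a b : n) :
    ‖Matrix.toEuclideanCLM (𝕜 := ℂ) (Matrix.single a b (1 : ℂ))‖ ≤ 1 := by
  refine ContinuousLinearMap.opNorm_le_bound _ zero_le_one fun x => ?_
  have : Matrix.toEuclideanCLM (𝕜 := ℂ) (Matrix.single a b (1 : ℂ)) x =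
      EuclideanSpace.single a (x b) := by
    ext i
    simp [Matrix.mulVec, dotProduct, Matrix.single_apply, ite_and, eq_comm]
  rw [this, PiLp.norm_single, one_mul]
  exact PiLp.norm_apply_le x b

theorem norm_inner_sub_inner_le {A : Total n →L[ℂ] Total n} (hA : ∀ Ψ, ‖A Ψ‖ ≤ ‖Ψ‖)
    (Ψ Φ : Total n) : ‖⟪Ψ, A Ψ⟫_ℂ - ⟪Φ, A Φ⟫_ℂ‖ ≤ (‖Ψ‖ + ‖Φ‖) * ‖Ψ - Φ‖ := by
  have h1 : ⟪Ψ, A Ψ⟫_ℂ - ⟪Φ, A Φ⟫_ℂ = ⟪Ψ - Φ, A Ψ⟫_ℂ + ⟪Φ, A (Ψ - Φ)⟫_ℂ := by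
    rw [inner_sub_left, map_sub, inner_sub_right]; ring
  rw [h1]
  have h2 := (norm_inner_le_norm (𝕜 := ℂ) (Ψ - Φ) (A Ψ)).trans
    (mul_le_mul_of_nonneg_left (hA Ψ) (norm_nonneg _))
  have h3 := (norm_inner_le_norm (𝕜 := ℂ) Φ (A (Ψ - Φ))).trans
    (mul_le_mul_of_nonneg_left (hA (Ψ - Φ)) (norm_nonneg _))
  refine (norm_add_le _ _).trans ?_
  linarith

theorem norm_systemOp_single_le (a b : n) (Ψ : Total n) :
    ‖systemOp (Matrix.single a b (1 : ℂ)) Ψ‖ ≤ ‖Ψ‖ := by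
  rw [systemOp_eq_internalOp]
  refine (norm_internalOp_apply_le _ Ψ).trans ?_
  nlinarith [norm_nonneg Ψ, norm_toEuclideanCLM_single_le (n := n) a b]

theorem inner_systemOp_single (x : EuclideanSpace ℂ n) (g h : Line) (a b : n) :
    ⟪productVector x g h, systemOp (Matrix.single b a (1 : ℂ)) (productVector x g h)⟫_ℂ =
      x a * star (x b) * ((‖g‖ ^ 2 : ℝ) : ℂ) * ((‖h‖ ^ 2 : ℝ) : ℂ) := by
  have h1 : Matrix.toEuclideanCLM (𝕜 := ℂ) (Matrix.single b a (1 : ℂ)) x =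
      EuclideanSpace.single b (x a) := by
    ext i
    simp [Matrix.mulVec, dotProduct, Matrix.single_apply, ite_and, eq_comm]
  rw [systemOp_eq_internalOp, internalOp_productVector, inner_productVector, h1,
    EuclideanSpace.inner_single_right, inner_self_eq_norm_sq_to_K, inner_self_eq_norm_sq_to_K]
  push_cast
  rfl

/-- The entries of the reduced state after an ideal system operation; weight and clock again
contribute factors that sum to 1. -/
theorem hasSum_inner_systemOp_single {ι J κ : Type} {ρ : Matrix n n ℂ}
    {x : ι → EuclideanSpace ℂ n} {g : J → Line} {h : κ → Line}
    (hx : IsEnsemble (Matrix.toEuclideanCLM (𝕜 := ℂ) ρ) x 1)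
    (hg : HasSum (fun i => ‖g i‖ ^ 2) 1) (hh : HasSum (fun i => ‖h i‖ ^ 2) 1)
    (X : Matrix n n ℂ) (a b : n) :
    HasSum (fun q => ⟪internalOp (Matrix.toEuclideanCLM (𝕜 := ℂ) X) (productEnsemble x g h q),
      systemOp (Matrix.single b a (1 : ℂ))
        (internalOp (Matrix.toEuclideanCLM (𝕜 := ℂ) X) (productEnsemble x g h q))⟫_ℂ)
      ((X * ρ * Xᴴ) a b) := by
  set T := Matrix.toEuclideanCLM (𝕜 := ℂ) X with hT
  have hsT : star T = Matrix.toEuclideanCLM (𝕜 := ℂ) Xᴴ := (map_star _ X).symm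
  have hl : ∀ c y, ⟪star T (EuclideanSpace.single c 1), y⟫_ℂ = T y c := fun c y => by
    rw [ContinuousLinearMap.star_eq_adjoint, ContinuousLinearMap.adjoint_inner_left,
      EuclideanSpace.inner_single_left]
    simp
  have h1 := hx.2 (star T (EuclideanSpace.single a 1)) (star T (EuclideanSpace.single b 1))
  have h2 : ⟪star T (EuclideanSpace.single a 1), Matrix.toEuclideanCLM (𝕜 := ℂ) ρ
      (star T (EuclideanSpace.single b 1))⟫_ℂ = (X * ρ * Xᴴ) a b := by
    rw [hl, hT, hsT, ← mul_apply_eq_comp, ← mul_apply_eq_comp, ← map_mul, ← map_mul]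
    simp
    rfl
  have h3 : ∀ i, ⟪star T (EuclideanSpace.single a 1), x i⟫_ℂ *
      ⟪x i, star T (EuclideanSpace.single b 1)⟫_ℂ = T (x i) a * star (T (x i) b) := fun i => by
    rw [← inner_conj_symm (x i), hl, hl]; rfl
  rw [h2] at h1
  simp only [h3] at h1
  have h4 := hasSum_mul_mul h1 (Complex.hasSum_ofReal.2 hg) (Complex.hasSum_ofReal.2 hh)
  rw [ofReal_one, mul_one, mul_one] at h4
  refine Eq.mpr (congrArg (HasSum · _) (funext fun q => ?_)) h4
  rw [productEnsemble, internalOp_productVector,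
    inner_systemOp_single]

end Running


/-! ### Existence of autonomous implementations -/

section Existence

/-- A smooth step function that increases from `0` to `1` between `b` and `b + L`. -/
theorem exists_smooth_step (b : ℝ) {L : ℝ} (hL : 0 < L) : ∃ F f : ℝ → ℝ, Continuous F ∧
    Continuous f ∧ (∀ y, HasDerivAt F (f y) y) ∧ (∃ C, ∀ y, |f y| ≤ C) ∧
    (∀ y ∉ Set.Icc b (b + L), f y = 0) ∧ (∀ y ≤ b, F y = 0) ∧ ∀ y, b + L ≤ y → F y = 1 := by
  set F : ℝ → ℝ := fun y => Real.smoothTransition ((y - b) / L)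
  have hd : ContDiff ℝ ∞ F := Real.smoothTransition.contDiff.comp (by fun_prop)
  have h0 : ∀ y ≤ b, F y = 0 := fun y hy =>
    Real.smoothTransition.zero_of_nonpos (div_nonpos_of_nonpos_of_nonneg (by linarith) hL.le)
  have h1 : ∀ y, b + L ≤ y → F y = 1 := fun y hy =>
    Real.smoothTransition.one_of_one_le (by rw [le_div_iff₀ hL]; linarith)
  have hc : Continuous (deriv F) := hd.continuous_deriv (by simp)
  have hs : ∀ y ∉ Set.Icc b (b + L), deriv F y = 0 := fun y hy => by
    rw [Set.mem_Icc, not_and_or, not_le, not_le] at hy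
    rcases hy with hy | hy
    · have : F =ᶠ[nhds y] fun _ => 0 := by
        filter_upwards [Iio_mem_nhds hy] with z hz using h0 z (le_of_lt hz)
      rw [this.deriv_eq, deriv_const]
    · have : F =ᶠ[nhds y] fun _ => 1 := by
        filter_upwards [Ioi_mem_nhds hy] with z hz using h1 z (le_of_lt hz)
      rw [this.deriv_eq, deriv_const]
  refine ⟨F, deriv F, hd.continuous, hc,
    fun y => (hd.differentiable (by simp) y).hasDerivAt, ?_, hs, h0, h1⟩
  obtain ⟨C, hC⟩ := isCompact_Icc.exists_bound_of_continuousOn (hc.continuousOn (s := Set.Icc b (b + L)))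
  refine ⟨max C 0, fun y => ?_⟩
  by_cases hy : y ∈ Set.Icc b (b + L)
  · exact (hC y hy).trans (le_max_left _ _)
  · rw [hs y hy, abs_zero]; exact le_max_right _ _

variable {n : Type} [Fintype n] [DecidableEq n]

/-- A momentum tolerance `δ` for which each of the energy shifts acts as a phase factor up to an
error `κ`. -/
theorem exists_tolerance (ħ : ℝ) (en : n → ℝ) {κ : ℝ} (hκ : 0 < κ) :
    ∃ δ > 0, ∀ m, (en m * δ / ħ) ^ 2 + 4 * δ ≤ κ ^ 2 := by
  set R : ℝ := ∑ m, (en m / ħ) ^ 2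
  have hR : 0 ≤ R := Finset.sum_nonneg fun _ _ => sq_nonneg _
  refine ⟨min 1 (κ ^ 2 / (R + 4)), lt_min one_pos (by positivity), fun m => ?_⟩
  -- The bound by 1 allows δ² to be replaced by δ; then both terms together are at most (R + 4) δ.
  set δ := min 1 (κ ^ 2 / (R + 4))
  have h0 : 0 < δ := lt_min one_pos (by positivity)
  have h1 : δ ≤ 1 := min_le_left _ _
  have h2 : δ * (R + 4) ≤ κ ^ 2 := by
    rw [← le_div_iff₀ (by positivity)]; exact min_le_right _ _
  have h3 : (en m / ħ) ^ 2 ≤ R :=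
    Finset.single_le_sum (f := fun m => (en m / ħ) ^ 2) (fun _ _ => sq_nonneg _) (Finset.mem_univ m)
  have h4 : (en m * δ / ħ) ^ 2 = (en m / ħ) ^ 2 * δ ^ 2 := by ring
  rw [h4]
  have h5 : δ ^ 2 ≤ δ := by nlinarith
  nlinarith [mul_le_mul h3 h5 (sq_nonneg δ) hR]

/-- Young's inequality with weight κ. It replaces the Cauchy–Schwarz inequality over the ensemble
and yields majorants that are linear in the two quantities whose sums are known, squared norms and
tails. -/
theorem mul_le_of_sq_le {κ x y z : ℝ} (hκ : 0 < κ) (h : y ^ 2 ≤ z) :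
    x * y ≤ (κ * x ^ 2 + z / κ) / 2 := by
  have h1 : z / κ = κ * (z / κ ^ 2) := by field_simp
  have h2 : (y / κ) ^ 2 ≤ z / κ ^ 2 := by rw [div_pow]; gcongr
  have h3 : x * y = κ * (x * (y / κ)) := by field_simp
  rw [h1, h3]
  nlinarith [sq_nonneg (x - y / κ), mul_le_mul_of_nonneg_left h2 hκ.le]

/-- A narrow weight deviates little from a momentum eigenstate: the total deviation has a summable
majorant. -/
theorem IsNarrowWeight.exists_majorant {ħ p₀ δ : ℝ} (hħ : 0 < ħ) {ρ : Line →L[ℂ] Line}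
    (hρ : IsNarrowWeight ħ p₀ δ ρ) (en : n → ℝ) {κ : ℝ} (hκ : 0 < κ)
    (hδ : ∀ m, (en m * δ / ħ) ^ 2 + 4 * δ ≤ κ ^ 2) :
    ∃ (J : Type) (g : J → Line), IsEnsemble ρ g 1 ∧ ∃ (β : J → ℝ) (B : ℝ), HasSum β B ∧
      B ≤ Fintype.card n * κ ∧ ∀ j,
      ‖g j‖ * ∑ m, ‖shift volume ℂ (en m) (g j) - cexp (-(I * (en m * p₀ / ħ : ℝ))) • g j‖
        ≤ β j := by
  obtain ⟨J, g, hg⟩ := hρ.1.exists_ensemble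
  obtain ⟨r, hr, ht⟩ := hρ.2.2
  have hs := hg.tsum_momentumTail ht
  -- The majorant is Young's inequality applied to the estimate for a single translation. After
  -- summation the squared norms give 1 and the tails give `r ≤ δ`, so each level contributes at
  -- most κ.
  refine ⟨J, g, hg, fun j => ∑ m, (κ * ‖g j‖ ^ 2 + ((en m * δ / ħ) ^ 2 * ‖g j‖ ^ 2 +
    4 * ‖indicatorOp volume ℂ (momentumTail ħ p₀ δ) (Lp.fourierTransformₗᵢ ℝ ℂ (g j))‖ ^ 2) / κ) / 2,
    ∑ m, (κ * 1 + ((en m * δ / ħ) ^ 2 * 1 + 4 * r) / κ) / 2, ?_, ?_, fun j => ?_⟩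
  · exact hasSum_sum fun m _ => ((hg.1.mul_left _).add
      (((hg.1.mul_left _).add (hs.mul_left _)).div_const κ)).div_const 2
  · rw [← nsmul_eq_mul]
    refine Finset.sum_le_card_nsmul _ _ _ fun m _ => ?_
    have h1 : ((en m * δ / ħ) ^ 2 * 1 + 4 * r) / κ ≤ κ := by
      rw [div_le_iff₀ hκ]
      nlinarith [hδ m]
    linarith
  · rw [Finset.mul_sum]
    exact Finset.sum_le_sum fun m _ => mul_le_of_sq_le hκ (norm_shift_sub_sq_le hħ p₀ δ (en m) (g j))

theorem indicatorOp_fst_mul_freeGroup {B : Set ℝ} (hB : MeasurableSet B) (ħ t : ℝ) :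
    indicatorOp volume (EuclideanSpace ℂ n) (Prod.fst ⁻¹' B : Set (ℝ × ℝ)) * freeGroup n ħ t =
      freeGroup n ħ t * indicatorOp volume _ (Prod.fst ⁻¹' B : Set (ℝ × ℝ)) := by
  rw [freeGroup, ← mul_assoc, phaseOp, indicatorOp_mul_multOp (measurable_fst hB)
    (isMultiplier_phase ħ t), mul_assoc, indicatorOp_mul_translate (measurable_fst hB), mul_assoc]
  congr 3
  ext z
  simp

/-- Exact conservation of the mean energy of system and weight. -/
theorem integral_ensembleDistribution_machineGroup {ħ : ℝ}
    {v : OrthonormalBasis n ℂ (EuclideanSpace ℂ n)} {en : n → ℝ} {Hs : Matrix n n ℂ}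
    (hen : IsEigenbasis Hs v en) {U : Total n → Total n} {t : ℝ}
    {V : EuclideanSpace ℂ n →L[ℂ] EuclideanSpace ℂ n}
    (hV : V ∈ unitary (EuclideanSpace ℂ n →L[ℂ] EuclideanSpace ℂ n))
    {ι : Type} {u : ι → Total n} {ρ ρ' : Total n →L[ℂ] Total n} (hu : IsEnsemble ρ u 1)
    (hu' : IsEnsemble ρ' (fun i => U (u i)) 1)
    (hU : ∀ i, energyShift v en (U (u i)) =
      internalOp V (freeGroup n ħ t (energyShift v en (u i))))
    {M M' : Matrix n n ℂ} (hM : IsReducedState ρ M) (hM' : IsReducedState ρ' M')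
    (hint : Integrable (fun y => y) (ensembleDistribution Prod.fst u)) :
    Integrable (fun y => y) (ensembleDistribution Prod.fst fun i => U (u i)) ∧
      ∫ y, y ∂(ensembleDistribution Prod.fst fun i => U (u i)) + energy Hs M' =
        ∫ y, y ∂(ensembleDistribution Prod.fst u) + energy Hs M := by
  -- In the frame of D the evolution is a system unitary and the free group, and neither changes the
  -- distribution of the weight position.
  have h1 : ensembleDistribution Prod.fst (fun i => energyShift v en (U (u i))) =
      ensembleDistribution Prod.fst fun i => energyShift v en (u i) := by
    simp only [hU]
    rw [ensembleDistribution_isometry measurable_fst (fun i => freeGroup n ħ t (energyShift v en (u i)))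
      (norm_internalOp_of_mem_unitary hV)
      (fun B hB => indicatorOp_mul_internalOp (measurable_fst hB) V),
      ensembleDistribution_isometry measurable_fst (fun i => energyShift v en (u i))
      (norm_freeGroup_apply ħ t) (fun B hB => indicatorOp_fst_mul_freeGroup hB ħ t)]
  obtain ⟨a1, a2⟩ := integral_ensembleDistribution_conditionalShift v hu.1 en
  obtain ⟨b1, b2⟩ := integral_ensembleDistribution_conditionalShift v hu'.1 en
  change Integrable _ (ensembleDistribution Prod.fst fun i => energyShift v en (u i)) ↔ _ at a1
  change Integrable _ (ensembleDistribution Prod.fst fun i => energyShift v en (U (u i))) ↔ _ at b1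
  rw [h1] at b1
  have hint' := b1.1 (a1.2 hint)
  refine ⟨hint', ?_⟩
  have a3 := a2 hint
  have b3 := b2 hint'
  change ∫ y, y ∂(ensembleDistribution Prod.fst fun i => energyShift v en (u i)) = _ at a3
  change ∫ y, y ∂(ensembleDistribution Prod.fst fun i => energyShift v en (U (u i))) = _ at b3
  rw [h1] at b3
  rw [trace_mul_eq_sum_conditionalDistribution v hu hM hen,
    trace_mul_eq_sum_conditionalDistribution v hu' hM' hen]
  linarith

theorem IsReducedState.of_entries {ρ : Total n →L[ℂ] Total n} {ι : Type} {u : ι → Total n} {r : ℝ}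
    (hu : IsEnsemble ρ u r) {M : Matrix n n ℂ}
    (h : ∀ a b, HasSum (fun i => ⟪u i, systemOp (Matrix.single b a (1 : ℂ)) (u i)⟫_ℂ) (M a b)) :
    IsReducedState ρ M := by
  obtain ⟨M', h1, h2⟩ := hu.exists_isReducedState
  have : M = M' := by
    ext a b
    rw [h2, (h a b).tsum_eq]
  rwa [this]

theorem toEuclideanCLM_propagator_mem_unitary {v : OrthonormalBasis n ℂ (EuclideanSpace ℂ n)}
    {en : n → ℝ} {Hs : Matrix n n ℂ} (hen : IsEigenbasis Hs v en) (ħ t : ℝ) :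
    Matrix.toEuclideanCLM (𝕜 := ℂ) (propagator ħ Hs t) ∈
      unitary (EuclideanSpace ℂ n →L[ℂ] EuclideanSpace ℂ n) := by
  have : Matrix.toEuclideanCLM (𝕜 := ℂ) (propagator ħ Hs t) = phaseShift v en ħ t := by
    rw [toEuclideanCLM_propagator v hen, phaseShift]
    congr 1
    funext m
    push_cast
    ring_nf
  rw [this]
  exact phaseShift_mem_unitary v en ħ t

/-- Every unitary of the system can be implemented by an autonomous machine, up to an arbitrarily
small error and with exact conservation of the mean energy. -/
theorem exists_machine {ħ : ℝ} (hħ : 0 < ħ) {Hs : Matrix n n ℂ} (hHs : Hs.IsHermitian)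
    {V : Matrix n n ℂ} (hV : V ∈ Matrix.unitaryGroup n ℂ) {ρ : Matrix n n ℂ} (hρ : ρ.PosSemidef)
    (hρ1 : ρ.trace = 1) {η : ℝ} (hη : 0 < η) (a K : ℝ) {L : ℝ} (p₀ : ℝ) (hL : 0 < L) :
    ∃ (Hint : Total n →L[ℂ] Total n) (U : ℝ → Total n ≃ₗᵢ[ℂ] Total n),
      IsInteraction ħ Hs (a + K) L Hint ∧ IsEvolution ħ Hs Hint U ∧
      ∃ δ > 0, (∃ ρw, IsNarrowWeight ħ p₀ δ ρw) ∧
      ∀ ρw ρc, IsNarrowWeight ħ p₀ δ ρw → IsClockState a K ρc →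
        ∃ ρ₀, IsDensity ρ₀ ∧ IsProductState ρ₀ ρ ρw ρc ∧
        ∀ t, K + L ≤ t → ∃ ρs : Matrix n n ℂ, IsReducedState (evolve (U t) ρ₀) ρs ∧
          (∀ i j, ‖(ρs - freeEvolution ħ Hs t (V * ρ * Vᴴ)) i j‖ ≤ η) ∧
          ∃ m₀ m, HasMean Prod.fst ρ₀ m₀ ∧ HasMean Prod.fst (evolve (U t) ρ₀) m ∧
            m - m₀ = energy Hs ρ - energy Hs ρs := by
  set v := hHs.eigenvectorBasis
  set en := hHs.eigenvalues
  have hen : IsEigenbasis Hs v en := fun i => by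
    ext j
    have := congrFun (hHs.mulVec_eigenvectorBasis i) j
    simpa using this
  have hVT : Matrix.toEuclideanCLM (𝕜 := ℂ) V ∈
      unitary (EuclideanSpace ℂ n →L[ℂ] EuclideanSpace ℂ n) := by
    have h := Unitary.mem_iff.1 hV
    rw [Unitary.mem_iff, ← map_star, ← map_mul, ← map_mul, h.1, h.2, map_one]
    exact ⟨rfl, rfl⟩
  obtain ⟨G, hG, hGV⟩ := exists_unitaryFlow_eq (mul_mem (mul_mem (phaseShift_mem_unitary v en ħ p₀)
    hVT) (phaseShift_mem_unitary v en ħ (-p₀)))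
  obtain ⟨F, f, hF, hf, hFf, ⟨C, hC⟩, hfs, hF0, hF1⟩ := exists_smooth_step (a + K) hL
  -- The entry error will be at most 4 `card n` κ; adding 1 avoids a zero denominator.
  set κ := η / (4 * (Fintype.card n + 1))
  have hκ : 0 < κ := by positivity
  obtain ⟨δ, hδ, hδκ⟩ := exists_tolerance ħ en hκ
  refine ⟨interaction ħ v en G f, machineGroup ħ v en hG hF,
    isInteraction_interaction hen hG hf hC hfs,
    isEvolution_machineGroup hħ.ne' hen hG hF hFf hf hC, δ, hδ, exists_isNarrowWeight hħ p₀ hδ, ?_⟩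
  intro ρw ρc hw hc
  obtain ⟨J, g, hg, β, B, hβ, hB, hgβ⟩ := hw.exists_majorant hħ en hκ hδκ
  obtain ⟨c, h, hh, hhs⟩ := hc.exists_ensemble
  obtain ⟨x, hx, -⟩ := exists_ensemble_of_posSemidef hρ hρ1
  obtain ⟨ρ₀, hρ₀, hprod⟩ := exists_productState hx hg hh
  refine ⟨ρ₀, hρ₀.isDensity, hprod, fun t ht => ?_⟩
  have hu := hρ₀.evolve (machineGroup ħ v en hG hF t)
  obtain ⟨ρs, hρs, hentry⟩ := hu.exists_isReducedState
  refine ⟨ρs, hρs, fun i j => ?_, ?_⟩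
  · set X := propagator ħ Hs t * V
    have hX : Matrix.toEuclideanCLM (𝕜 := ℂ) X =
        Matrix.toEuclideanCLM (𝕜 := ℂ) (propagator ħ Hs t) * Matrix.toEuclideanCLM (𝕜 := ℂ) V :=
      map_mul _ _ _
    have hfree : freeEvolution ħ Hs t (V * ρ * Vᴴ) = X * ρ * Xᴴ := by
      simp only [freeEvolution, X, conjTranspose_mul, mul_assoc]
    have h1 := hasSum_inner_systemOp_single hx hg.1 hh.1 X i j
    set u := productEnsemble x g h
    set Φ : _ → Total n := fun q => freeGroup n ħ t
      (internalOp (Matrix.toEuclideanCLM (𝕜 := ℂ) X) (u q)) with hΦ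
    set S := systemOp (Matrix.single j i (1 : ℂ)) with hS
    -- The free motion of weight and clock is invisible to system observables.
    have h2 : ∀ q, ⟪Φ q, S (Φ q)⟫_ℂ = ⟪internalOp (Matrix.toEuclideanCLM (𝕜 := ℂ) X) (u q),
        S (internalOp (Matrix.toEuclideanCLM (𝕜 := ℂ) X) (u q))⟫_ℂ := fun q => by
      rw [hΦ, hS, systemOp_eq_internalOp, ← mul_apply_eq_comp (internalOp _) (freeGroup n ħ t),
        ← freeGroup_mul_internalOp, mul_apply_eq_comp]
      exact Unitary.inner_map_map ⟨_, freeGroup_mem_unitary ħ t⟩ _ _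
    simp only [← h2] at h1
    have h3 := hu.summable S
    rw [Matrix.sub_apply, hentry, hfree, ← h1.tsum_eq, ← h3.tsum_sub h1.summable]
    -- One factor 2 comes from the two equal norms in the difference of quadratic forms, the other
    -- from the two replacements of D by Z.
    have h4 : HasSum (fun q : _ × J × c => 4 * (‖x q.1‖ ^ 2 * β q.2.1 * ‖h q.2.2‖ ^ 2)) (4 * B) := by
      simpa using (hasSum_mul_mul_real hx.1 hβ hh.1).mul_left 4
    have h5 : 4 * B ≤ η := by
      refine (mul_le_mul_of_nonneg_left hB (by norm_num)).trans ?_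
      have : η = 4 * ((Fintype.card n + 1) * κ) := by
        simp only [κ]; field_simp
      rw [this]
      nlinarith
    refine (tsum_of_norm_bounded h4 fun q => ?_).trans h5
    refine (norm_inner_sub_inner_le (norm_systemOp_single_le j i) _ _).trans ?_
    have h6 : ‖Φ q‖ = ‖u q‖ := by
      rw [hΦ, norm_freeGroup_apply, hX, internalOp_mul, mul_apply_eq_comp,
        norm_internalOp_of_mem_unitary (toEuclideanCLM_propagator_mem_unitary hen ħ t),
        norm_internalOp_of_mem_unitary hVT]
    have h7 : ‖u q‖ = ‖x q.1‖ * ‖g q.2.1‖ * ‖h q.2.2‖ := norm_productVector _ _ _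
    have h8 := norm_machineGroup_sub_le (ħ := ħ) (p₀ := p₀) hen hG hF hF0 hF1 ht hVT hGV (x q.1)
      (g q.2.1) (hhs q.2.2)
    rw [LinearIsometryEquiv.norm_map, h6, h7]
    rw [hΦ, hX]
    refine (mul_le_mul_of_nonneg_left h8 (by positivity)).trans ?_
    have h9 := mul_le_mul_of_nonneg_left (hgβ q.2.1)
      (by positivity : 0 ≤ 4 * (‖x q.1‖ ^ 2 * ‖h q.2.2‖ ^ 2))
    refine le_of_eq_of_le ?_ (h9.trans_eq ?_) <;> ring
  · have hmean : Integrable (fun y => y) (ensembleDistribution Prod.fst (productEnsemble x g h)) := by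
      rw [ensembleDistribution_productEnsemble hx.1 hg.1 hh.1]
      obtain ⟨m, hm⟩ := hw.2.1
      exact ((hg.hasMean_iff measurable_id).1 hm).1
    -- The case `X = 1` of the entry formula identifies the initial reduced state.
    have hred : IsReducedState ρ₀ ρ := IsReducedState.of_entries hρ₀ fun i j => by
      have h1 := hasSum_inner_systemOp_single hx hg.1 hh.1 1 i j
      simpa [internalOp_one] using h1
    obtain ⟨h1, h2⟩ := integral_ensembleDistribution_machineGroup (ħ := ħ) (t := t) hen
      (U := machineGroup ħ v en hG hF t) (unitaryFlow_mem_unitary hG 1) hρ₀ hu (fun q => by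
        refine machineGroup_apply_of_support hG hF hF0 hF1 ht ?_
        filter_upwards [coeFn_productVector (x q.1) (g q.2.1) (h q.2.2), ae_snd (hhs q.2.2)]
          with z h1 h2 hz
        rw [productEnsemble, h1, h2 hz, mul_zero, zero_smul]) hred hρs hmean
    refine ⟨_, _, (hρ₀.hasMean_iff measurable_fst).2 ⟨hmean, rfl⟩,
      (hu.hasMean_iff measurable_fst).2 ⟨h1, rfl⟩, ?_⟩
    linarith

end Existence


/-! ### The protocol unitary -/

section ProtocolUnitary

variable {d N : ℕ}

/-- Induction along the protocol: reversal puts the first swap rightmost in the product, so that it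
acts first. -/
theorem prod_reverse_ofFn_induction {M : Type} [Monoid M] : ∀ {N : ℕ} (f : Fin N → M)
    (Q : Fin (N + 1) → M → Prop), Q 0 1 → (∀ j x, Q j.castSucc x → Q j.succ (f j * x)) →
    Q (Fin.last N) (List.ofFn f).reverse.prod
  | 0, _, _, h0, _ => by simpa using h0
  | N + 1, f, Q, h0, hs => by
    have ih := prod_reverse_ofFn_induction (fun j => f j.castSucc) (fun i => Q i.castSucc) h0
      fun j x hx => by
        have := hs j.castSucc x hx
        rwa [Fin.succ_castSucc] at this
    have := hs (Fin.last N) _ ih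
    rw [List.ofFn_succ', List.concat_eq_append, List.reverse_append, List.prod_append,
      List.reverse_singleton, List.prod_singleton]
    exact this

/-- The classical swap of the energy labels of the subsystem and the `j`-th bath system. -/
def labelSwap (j : Fin N) : Equiv.Perm (Fin d × Bath d N) :=
  Function.Involutive.toPerm (fun x => (x.2 j, Function.update x.2 j x.1)) fun x => by
    simp

theorem labelSwap_apply (j : Fin N) (x : Fin d × Bath d N) :
    labelSwap j x = (x.2 j, Function.update x.2 j x.1) := rfl

/-- The permutation matrix of `labelSwap`. -/
def labelSwapMatrix (j : Fin N) : Matrix (Fin d × Bath d N) (Fin d × Bath d N) ℂ :=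
  (1 : Matrix (Fin d × Bath d N) (Fin d × Bath d N) ℂ).submatrix id (labelSwap j)

theorem labelSwapMatrix_mem_unitary (j : Fin N) :
    labelSwapMatrix (d := d) j ∈ Matrix.unitaryGroup _ ℂ := by
  rw [Matrix.mem_unitaryGroup_iff, labelSwapMatrix, star_eq_conjTranspose, conjTranspose_submatrix,
    conjTranspose_one, submatrix_mul_equiv, one_mul, submatrix_id_id]

theorem labelSwapMatrix_conj_diagonal (j : Fin N) (c : Fin d × Bath d N → ℂ) :
    labelSwapMatrix j * diagonal c * (labelSwapMatrix j)ᴴ = diagonal (c ∘ labelSwap j) := by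
  have h : diagonal c = (diagonal (c ∘ labelSwap j)).submatrix (labelSwap j) (labelSwap j) := by
    rw [submatrix_diagonal_equiv]
    congr 1
    funext x
    have : labelSwap j (labelSwap j x) = x := (labelSwap j).symm_apply_apply x
    simp [this]
  rw [h, labelSwapMatrix, conjTranspose_submatrix, conjTranspose_one, submatrix_mul_equiv, one_mul,
    submatrix_mul_equiv, mul_one, submatrix_id_id]

/-- A basis of the subsystem as a matrix on subsystem and bath. -/
def frame (N : ℕ) (v : OrthonormalBasis (Fin d) ℂ (EuclideanSpace ℂ (Fin d))) :
    Matrix (Fin d × Bath d N) (Fin d × Bath d N) ℂ :=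
  basisMatrix v ⊗ₖ (1 : Matrix (Bath d N) (Bath d N) ℂ)

theorem frame_mem_unitary (v : OrthonormalBasis (Fin d) ℂ (EuclideanSpace ℂ (Fin d))) :
    frame N v ∈ Matrix.unitaryGroup _ ℂ :=
  kronecker_mem_unitary (basisMatrix_mem_unitary v) (one_mem _)

theorem frame_conjTranspose (v : OrthonormalBasis (Fin d) ℂ (EuclideanSpace ℂ (Fin d))) :
    (frame N v)ᴴ = (basisMatrix v)ᴴ ⊗ₖ (1 : Matrix (Bath d N) (Bath d N) ℂ) := by
  rw [frame, conjTranspose_kronecker, conjTranspose_one]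

theorem frame_conjTranspose_mul_self
    (v : OrthonormalBasis (Fin d) ℂ (EuclideanSpace ℂ (Fin d))) : (frame N v)ᴴ * frame N v = 1 :=
  Matrix.mem_unitaryGroup_iff'.1 (frame_mem_unitary v)

theorem rotation_eq (v w : OrthonormalBasis (Fin d) ℂ (EuclideanSpace ℂ (Fin d))) :
    rotation (N := N) v w = frame N w * (frame N v)ᴴ := by
  rw [rotation, ketBra_sum, frame_conjTranspose, frame, ← mul_kronecker_mul, one_mul]

theorem ketBra_basis (v : OrthonormalBasis (Fin d) ℂ (EuclideanSpace ℂ (Fin d))) (i m : Fin d) :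
    ketBra (v i) (v m) = basisMatrix v * Matrix.single i m 1 * (basisMatrix v)ᴴ := by
  ext a b
  simp [ketBra, vecMulVec_apply, Matrix.mul_apply, basisMatrix, Matrix.single_apply, ite_and]

theorem sum_single_kronecker_single (j : Fin N) :
    ∑ m : Fin d, ∑ b : Bath d N, Matrix.single (b j) m (1 : ℂ) ⊗ₖ
      Matrix.single (Function.update b j m) b (1 : ℂ) = labelSwapMatrix j := by
  rw [← Fintype.sum_prod_type' (f := fun (m : Fin d) (b : Bath d N) =>
    Matrix.single (b j) m (1 : ℂ) ⊗ₖ Matrix.single (Function.update b j m) b (1 : ℂ))]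
  ext x y
  rw [Matrix.sum_apply, Finset.sum_eq_single y]
  · simp [labelSwapMatrix, labelSwap_apply, Matrix.single_apply, Matrix.one_apply, Prod.ext_iff,
      ite_and, eq_comm]
    split_ifs <;> rfl
  · intro z _ hz
    simp only [single_kronecker_single, Matrix.single_apply]
    rw [if_neg fun h => hz h.2]
  · simp

theorem swap_eq (v : OrthonormalBasis (Fin d) ℂ (EuclideanSpace ℂ (Fin d))) (j : Fin N) :
    swap v j = frame N v * labelSwapMatrix j * (frame N v)ᴴ := by
  rw [← sum_single_kronecker_single, Finset.mul_sum, Finset.sum_mul, swap]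
  refine Finset.sum_congr rfl fun m _ => ?_
  rw [Finset.mul_sum, Finset.sum_mul]
  refine Finset.sum_congr rfl fun b _ => ?_
  rw [ketBra_basis, frame_conjTranspose, frame, ← mul_kronecker_mul, ← mul_kronecker_mul, one_mul,
    mul_one]

theorem swap_mem_unitary (v : OrthonormalBasis (Fin d) ℂ (EuclideanSpace ℂ (Fin d))) (j : Fin N) :
    swap v j ∈ Matrix.unitaryGroup (Fin d × Bath d N) ℂ := by
  rw [swap_eq]
  exact mul_mem (mul_mem (frame_mem_unitary v) (labelSwapMatrix_mem_unitary j))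
    (Unitary.star_mem (frame_mem_unitary v))

theorem protocolUnitary_mem_unitary
    (ψ E φ : OrthonormalBasis (Fin d) ℂ (EuclideanSpace ℂ (Fin d))) :
    protocolUnitary N ψ E φ ∈ Matrix.unitaryGroup (Fin d × Bath d N) ℂ := by
  rw [protocolUnitary, rotation_eq, rotation_eq]
  refine mul_mem (mul_mem (mul_mem (frame_mem_unitary _) (Unitary.star_mem (frame_mem_unitary _))) ?_)
    (mul_mem (frame_mem_unitary _) (Unitary.star_mem (frame_mem_unitary _)))
  exact prod_reverse_ofFn_induction _ (fun _ x => x ∈ Matrix.unitaryGroup _ ℂ) (one_mem _)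
    fun j x hx => mul_mem (swap_mem_unitary E j) hx

/-- The joint distribution of the energy labels after the first `i` swaps. -/
def pathWeight (P : Fin (N + 1) → Fin d → ℝ) (i : Fin (N + 1)) (x : Fin d × Bath d N) : ℝ :=
  P i x.1 * ∏ j : Fin N, if j.castSucc < i then P j.castSucc (x.2 j) else P j.succ (x.2 j)

/-- Just before swap `j` the subsystem carries the distribution `P j.castSucc` and bath system `j`
still carries `P j.succ`. Exchanging the labels exchanges these two factors, and no other factor
changes. -/
theorem pathWeight_labelSwap (P : Fin (N + 1) → Fin d → ℝ) (j : Fin N) (x : Fin d × Bath d N) :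
    pathWeight P j.castSucc (labelSwap j x) = pathWeight P j.succ x := by
  rw [labelSwap_apply, pathWeight, pathWeight, ← Finset.mul_prod_erase _ _ (Finset.mem_univ j),
    ← Finset.mul_prod_erase _ _ (Finset.mem_univ j), if_neg (lt_irrefl _),
    if_pos (Fin.castSucc_lt_succ)]
  simp only
  rw [Function.update_self, mul_left_comm]
  congr 2
  refine Finset.prod_congr rfl fun k hk => ?_
  have hkj : k ≠ j := Finset.ne_of_mem_erase hk
  rw [Function.update_of_ne hkj]
  have : k.castSucc < j.castSucc ↔ k.castSucc < j.succ := by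
    have : (k : ℕ) ≠ j := fun h => hkj (Fin.ext h)
    simp only [Fin.lt_def, Fin.val_castSucc, Fin.val_succ]
    omega
  simp only [this]

theorem swaps_conj_diagonal (v : OrthonormalBasis (Fin d) ℂ (EuclideanSpace ℂ (Fin d)))
    (P : Fin (N + 1) → Fin d → ℝ) :
    (List.ofFn fun j : Fin N => swap v j).reverse.prod *
        (frame N v * diagonal (fun x => (pathWeight P 0 x : ℂ)) * (frame N v)ᴴ) *
        ((List.ofFn fun j : Fin N => swap v j).reverse.prod)ᴴ =
      frame N v * diagonal (fun x => (pathWeight P (Fin.last N) x : ℂ)) * (frame N v)ᴴ := by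
  refine prod_reverse_ofFn_induction (fun j : Fin N => swap v j) (fun i W =>
    W * (frame N v * diagonal (fun x => (pathWeight P 0 x : ℂ)) * (frame N v)ᴴ) * Wᴴ =
      frame N v * diagonal (fun x => (pathWeight P i x : ℂ)) * (frame N v)ᴴ) ?_ fun j W hW => ?_
  · rw [conjTranspose_one, one_mul, mul_one]
  · have h1 := frame_conjTranspose_mul_self (N := N) v
    have h2 : (fun x => (pathWeight P j.succ x : ℂ)) =
        (fun x => (pathWeight P j.castSucc x : ℂ)) ∘ labelSwap j := by
      funext x
      simp [← pathWeight_labelSwap]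
    rw [h2, ← labelSwapMatrix_conj_diagonal, conjTranspose_mul]
    calc swap v j * W * _ * (Wᴴ * (swap v j)ᴴ) = swap v j * (W *
          (frame N v * diagonal (fun x => (pathWeight P 0 x : ℂ)) * (frame N v)ᴴ) * Wᴴ) *
          (swap v j)ᴴ := by simp only [mul_assoc]
      _ = _ := by
        rw [hW, swap_eq]
        simp only [conjTranspose_mul, conjTranspose_conjTranspose]
        have e : ∀ X : Matrix (Fin d × Bath d N) (Fin d × Bath d N) ℂ,
            (frame N v)ᴴ * (frame N v * X) = X := fun X => by rw [← mul_assoc, h1, one_mul]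
        simp only [mul_assoc, e]

/-- The product distribution on the bath. -/
def bathWeight (f : Fin N → Fin d → ℝ) (b : Bath d N) : ℝ := ∏ j, f j (b j)

theorem eq_frame_mul_diagonal {M : Matrix (Fin d) (Fin d) ℂ}
    {v : OrthonormalBasis (Fin d) ℂ (EuclideanSpace ℂ (Fin d))} {p : Fin d → ℝ}
    (h : IsEigenbasis M v p) (w : Bath d N → ℝ) :
    M ⊗ₖ diagonal (fun b => (w b : ℂ)) =
      frame N v * diagonal (fun x => ((p x.1 * w x.2 : ℝ) : ℂ)) * (frame N v)ᴴ := by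
  rw [frame_conjTranspose, frame]
  have : diagonal (fun x : Fin d × Bath d N => ((p x.1 * w x.2 : ℝ) : ℂ)) =
      diagonal (fun i => (p i : ℂ)) ⊗ₖ diagonal fun b => (w b : ℂ) := by
    rw [diagonal_kronecker_diagonal]; simp
  rw [this, ← mul_kronecker_mul, ← mul_kronecker_mul, one_mul, mul_one,
    ← eq_basisMatrix_mul_diagonal h]

/-- The swap sequence shifts the whole list of distributions by one place: the subsystem receives
the last one and bath system `j` the one preceding its own. The outer rotations only change the
eigenbasis of the subsystem. -/
theorem protocolUnitary_conj {ρ σ : Matrix (Fin d) (Fin d) ℂ}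
    {ψ E φ : OrthonormalBasis (Fin d) ℂ (EuclideanSpace ℂ (Fin d))}
    (P : Fin (N + 1) → Fin d → ℝ) (hψ : IsEigenbasis ρ ψ (P 0))
    (hφ : IsEigenbasis σ φ (P (Fin.last N))) :
    protocolUnitary N ψ E φ * (ρ ⊗ₖ diagonal fun b => (bathWeight (fun j => P j.succ) b : ℂ)) *
        (protocolUnitary N ψ E φ)ᴴ =
      σ ⊗ₖ diagonal fun b => (bathWeight (fun j => P j.castSucc) b : ℂ) := by
  rw [eq_frame_mul_diagonal hψ, eq_frame_mul_diagonal hφ, protocolUnitary, rotation_eq, rotation_eq]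
  have h0 : (fun x : Fin d × Bath d N => ((P 0 x.1 * bathWeight (fun j => P j.succ) x.2 : ℝ) : ℂ)) =
      fun x => (pathWeight P 0 x : ℂ) := by
    funext x
    simp [pathWeight, bathWeight]
  have h1 : (fun x : Fin d × Bath d N =>
      ((P (Fin.last N) x.1 * bathWeight (fun j => P j.castSucc) x.2 : ℝ) : ℂ)) =
      fun x => (pathWeight P (Fin.last N) x : ℂ) := by
    funext x
    simp [pathWeight, bathWeight, Fin.castSucc_lt_last]
  rw [h0, h1]
  have e : ∀ (v : OrthonormalBasis (Fin d) ℂ (EuclideanSpace ℂ (Fin d)))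
      (X : Matrix (Fin d × Bath d N) (Fin d × Bath d N) ℂ),
      (frame N v)ᴴ * (frame N v * X) = X := fun v X => by
    rw [← mul_assoc, frame_conjTranspose_mul_self, one_mul]
  have h2 := swaps_conj_diagonal E P
  have h3 := congrArg (fun X => frame N φ * ((frame N E)ᴴ * X * frame N E) * (frame N φ)ᴴ) h2
  simp only [mul_assoc, e, conjTranspose_mul, conjTranspose_conjTranspose,
    frame_conjTranspose_mul_self, mul_one] at h3 ⊢
  exact h3

end ProtocolUnitary


/-! ### Energy and entropy balance of the protocol -/

section Spectrum

variable {n : Type} [Fintype n] [DecidableEq n]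

/-- The number of eigenvalues violating `Q` is a symmetric sum, so it is the same for both
labellings. -/
theorem IsEigenbasis.forall_of_eigenvalues {M : Matrix n n ℂ}
    {v : OrthonormalBasis n ℂ (EuclideanSpace ℂ n)} {p : n → ℝ} (h : IsEigenbasis M v p)
    (hM : M.IsHermitian) {Q : ℝ → Prop} (hQ : ∀ i, Q (hM.eigenvalues i)) (i : n) : Q (p i) := by
  classical
  have h1 := sum_eigenvalues_eq hM h fun x => if Q x then 0 else 1
  rw [Finset.sum_eq_zero fun i _ => if_pos (hQ i), eq_comm,
    Finset.sum_eq_zero_iff_of_nonneg fun i _ => by split_ifs <;> norm_num] at h1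
  by_contra hi
  simpa [hi] using h1 i (Finset.mem_univ i)

theorem IsEigenbasis.sum_eq_one {M : Matrix n n ℂ}
    {v : OrthonormalBasis n ℂ (EuclideanSpace ℂ n)} {p : n → ℝ} (h : IsEigenbasis M v p)
    (hM : M.IsHermitian) (h1 : M.trace = 1) : ∑ i, p i = 1 := by
  have h2 := sum_eigenvalues_eq hM h fun x => x
  rw [← h2]
  have h3 := hM.trace_eq_sum_eigenvalues
  rw [h1] at h3
  simpa using (congrArg Complex.re h3).symm

end Spectrum

/-! ### Thermal bath states, mean energies and entropy production -/

section Balance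

variable {d N : ℕ}

theorem sum_bathWeight (f : Fin N → Fin d → ℝ) : ∑ b, bathWeight f b = ∏ j, ∑ i, f j i := by
  rw [Finset.prod_univ_sum, Fintype.piFinset_univ]
  rfl

/-- An observable of one bath system only sees the marginal of that system, as the other factors sum
to 1. -/
theorem sum_mul_bathWeight {f : Fin N → Fin d → ℝ} (hf : ∀ j, ∑ i, f j i = 1) (j : Fin N)
    (c : Fin d → ℝ) : ∑ b : Bath d N, c (b j) * bathWeight f b = ∑ i, c i * f j i := by
  have h : ∀ b : Bath d N, c (b j) * bathWeight f b =
      bathWeight (Function.update f j fun i => c i * f j i) b := fun b => by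
    rw [bathWeight, bathWeight, ← Finset.mul_prod_erase _ _ (Finset.mem_univ j),
      ← Finset.mul_prod_erase _ _ (Finset.mem_univ j), Function.update_self, ← mul_assoc]
    congr 1
    exact Finset.prod_congr rfl fun k hk => by
      rw [Function.update_of_ne (Finset.ne_of_mem_erase hk)]
  simp only [h]
  rw [sum_bathWeight, ← Finset.mul_prod_erase _ _ (Finset.mem_univ j), Function.update_self,
    Finset.prod_eq_one, mul_one]
  intro k hk
  rw [Function.update_of_ne (Finset.ne_of_mem_erase hk), hf]

theorem thermalState_bathHamiltonian (k T : ℝ) (e : Fin N → Fin d → ℝ) :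
    thermalState k T (bathHamiltonian e) =
      diagonal fun b => (bathWeight (fun j => boltzmann k T (e j)) b : ℂ) := by
  have h1 : NormedSpace.exp ((-(1 / (k * T)) : ℂ) • bathHamiltonian e) =
      diagonal fun b => (bathWeight (fun j i => Real.exp (-e j i / (k * T))) b : ℂ) := by
    rw [bathHamiltonian, ← Matrix.diagonal_smul, Matrix.exp_diagonal]
    congr 1
    funext b
    rw [Pi.exp_def, ← Complex.exp_eq_exp_ℂ, bathWeight, ← Real.exp_sum, Complex.ofReal_exp]
    change cexp ((-(1 / (k * T)) : ℂ) * ((∑ j, e j (b j) : ℝ) : ℂ)) = _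
    congr 1
    push_cast
    rw [Finset.mul_sum]
    exact Finset.sum_congr rfl fun j _ => by ring
  rw [thermalState, h1, Matrix.trace_diagonal, ← ofReal_sum, sum_bathWeight, ← Matrix.diagonal_smul]
  congr 1
  funext b
  rw [Pi.smul_apply, smul_eq_mul, ← ofReal_inv, ← ofReal_mul, bathWeight, bathWeight]
  simp only [boltzmann]
  rw [Finset.prod_div_distrib, inv_mul_eq_div]

theorem partialTrace_kronecker {n m : Type} [Fintype n] [Fintype m] (A : Matrix n n ℂ)
    (B : Matrix m m ℂ) : partialTrace (A ⊗ₖ B) = B.trace • A := by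
  ext i j
  simp [partialTrace, Matrix.trace, Matrix.kroneckerMap_apply, Finset.mul_sum,
    mul_comm]

theorem trace_diagonal_bathWeight {f : Fin N → Fin d → ℝ} (hf : ∀ j, ∑ i, f j i = 1) :
    (diagonal fun b => (bathWeight f b : ℂ)).trace = 1 := by
  rw [Matrix.trace_diagonal, ← ofReal_sum, sum_bathWeight, Finset.prod_eq_one fun j _ => hf j,
    ofReal_one]

theorem energy_kronecker_bathWeight (Hu : Matrix (Fin d) (Fin d) ℂ) (e : Fin N → Fin d → ℝ)
    {σ : Matrix (Fin d) (Fin d) ℂ} (hσ : σ.trace = 1) {f : Fin N → Fin d → ℝ}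
    (hf : ∀ j, ∑ i, f j i = 1) :
    energy (systemHamiltonian Hu e) (σ ⊗ₖ diagonal fun b => (bathWeight f b : ℂ)) =
      energy Hu σ + ∑ j, ∑ i, e j i * f j i := by
  rw [energy, systemHamiltonian, add_mul, ← mul_kronecker_mul, ← mul_kronecker_mul, one_mul, one_mul,
    Matrix.trace_add, Matrix.trace_kronecker, Matrix.trace_kronecker, hσ,
    trace_diagonal_bathWeight hf, bathHamiltonian, diagonal_mul_diagonal, Matrix.trace_diagonal,
    mul_one, one_mul, Complex.add_re, energy]
  congr 1
  simp only [← ofReal_mul]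
  rw [← ofReal_sum, ofReal_re]
  simp only [Finset.sum_mul]
  rw [Finset.sum_comm]
  exact Finset.sum_congr rfl fun j _ => sum_mul_bathWeight hf j (e j)

theorem sum_succ_sub_castSucc (f : Fin (N + 1) → ℝ) :
    ∑ j : Fin N, (f j.succ - f j.castSucc) = f (Fin.last N) - f 0 := by
  have h1 := Fin.sum_univ_succ f
  have h2 := Fin.sum_univ_castSucc f
  rw [Finset.sum_sub_distrib]
  linarith

/-- The entropy production of the protocol, in units of `k`. -/
def dissipation (P : Fin (N + 1) → Fin d → ℝ) : ℝ :=
  ∑ j : Fin N, ∑ i, P j.castSucc i * (Real.log (P j.castSucc i) - Real.log (P j.succ i))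

/-- The entropy difference telescopes along the path. Its terms P log P at the end of each step
cancel the initial bath energies, leaving the relative entropy of consecutive distributions. -/
theorem work_sub_freeEnergy_eq (c : ℝ) (P : Fin (N + 1) → Fin d → ℝ) :
    ∑ j : Fin N, ∑ i, -c * Real.log (P j.succ i) * P j.castSucc i -
        ∑ j : Fin N, ∑ i, -c * Real.log (P j.succ i) * P j.succ i +
        c * (∑ i, Real.negMulLog (P (Fin.last N) i) - ∑ i, Real.negMulLog (P 0 i)) =
      c * dissipation P := by
  rw [← sum_succ_sub_castSucc fun j => ∑ i, Real.negMulLog (P j i), dissipation, Finset.mul_sum,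
    Finset.mul_sum, ← Finset.sum_sub_distrib, ← Finset.sum_add_distrib]
  refine Finset.sum_congr rfl fun j _ => ?_
  rw [← Finset.sum_sub_distrib, ← Finset.sum_sub_distrib, Finset.mul_sum, Finset.mul_sum,
    ← Finset.sum_add_distrib]
  refine Finset.sum_congr rfl fun i _ => ?_
  simp only [Real.negMulLog]
  ring

/-- Together with the next lemma this is log z ≤ z - 1, at y/x and at x/y. The linear terms cancel
after summation over two normalized distributions, leaving nonnegativity and the χ² bound. The value
x = 0 is admitted because `p` may have zeros. -/
theorem sub_le_mul_log_sub_log {x y : ℝ} (hx : 0 ≤ x) (hy : 0 < y) :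
    x - y ≤ x * (Real.log x - Real.log y) := by
  rcases hx.eq_or_lt with rfl | hx
  · simp [hy.le]
  · have h := Real.log_le_sub_one_of_pos (div_pos hy hx)
    rw [Real.log_div hy.ne' hx.ne'] at h
    have h2 : x * (y / x) = y := by field_simp
    nlinarith

theorem mul_log_sub_log_le {x y : ℝ} (hx : 0 ≤ x) (hy : 0 < y) :
    x * (Real.log x - Real.log y) ≤ (x - y) + (x - y) ^ 2 / y := by
  have h1 : (x - y) + (x - y) ^ 2 / y = x * (x / y - 1) := by field_simp; ring
  rw [h1]
  rcases hx.eq_or_lt with rfl | hx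
  · simp
  · have h := Real.log_le_sub_one_of_pos (div_pos hx hy)
    rw [Real.log_div hx.ne' hy.ne'] at h
    exact mul_le_mul_of_nonneg_left h hx.le

theorem dissipation_nonneg {P : Fin (N + 1) → Fin d → ℝ} (h0 : ∀ j i, 0 ≤ P j i)
    (hpos : ∀ (j : Fin N) i, 0 < P j.succ i) (h1 : ∀ j, ∑ i, P j i = 1) : 0 ≤ dissipation P := by
  refine Finset.sum_nonneg fun j _ => ?_
  have : ∑ i, (P j.castSucc i - P j.succ i) = 0 := by rw [Finset.sum_sub_distrib, h1, h1, sub_self]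
  rw [← this]
  exact Finset.sum_le_sum fun i _ => sub_le_mul_log_sub_log (h0 _ i) (hpos j i)

theorem dissipation_le {P : Fin (N + 1) → Fin d → ℝ} (h0 : ∀ j i, 0 ≤ P j i)
    (hpos : ∀ (j : Fin N) i, 0 < P j.succ i) (h1 : ∀ j, ∑ i, P j i = 1) :
    dissipation P ≤ ∑ j : Fin N, ∑ i, (P j.castSucc i - P j.succ i) ^ 2 / P j.succ i := by
  refine Finset.sum_le_sum fun j _ => ?_
  have : ∑ i, (P j.castSucc i - P j.succ i) = 0 := by rw [Finset.sum_sub_distrib, h1, h1, sub_self]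
  rw [← zero_add (∑ i, (P j.castSucc i - P j.succ i) ^ 2 / P j.succ i), ← this,
    ← Finset.sum_add_distrib]
  exact Finset.sum_le_sum fun i _ => mul_log_sub_log_le (h0 _ i) (hpos j i)

end Balance

/-! ### The linear path and its vanishing dissipation -/

section Path

variable {d : ℕ}

/-- The linear interpolation from `p` to `q` in `N` steps. -/
def linearPath (N : ℕ) (p q : Fin d → ℝ) (j : Fin (N + 1)) (i : Fin d) : ℝ :=
  p i + (j : ℝ) / N * (q i - p i)

/-- The energy levels of the bath systems whose thermal probabilities interpolate between `p` and
`q`. -/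
def linearLevels (k T : ℝ) (N : ℕ) (p q : Fin d → ℝ) (j : Fin N) (i : Fin d) : ℝ :=
  -(k * T) * Real.log (linearPath N p q j.succ i)

variable {N : ℕ} {p q : Fin d → ℝ}

theorem linearPath_zero : linearPath N p q 0 = p := by
  funext i; simp [linearPath]

theorem linearPath_last (hN : N ≠ 0) : linearPath N p q (Fin.last N) = q := by
  have : (N : ℝ) ≠ 0 := Nat.cast_ne_zero.2 hN
  funext i; simp [linearPath, this]

theorem sum_linearPath (hp1 : ∑ i, p i = 1) (hq1 : ∑ i, q i = 1) (j : Fin (N + 1)) :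
    ∑ i, linearPath N p q j i = 1 := by
  simp only [linearPath]
  rw [Finset.sum_add_distrib, ← Finset.mul_sum, Finset.sum_sub_distrib, hp1, hq1]
  ring

theorem linearPath_ratio_mem (j : Fin (N + 1)) : 0 ≤ (j : ℝ) / N ∧ (j : ℝ) / N ≤ 1 := by
  have h : ((j : ℕ) : ℝ) ≤ N := by exact_mod_cast Nat.lt_succ_iff.1 j.2
  exact ⟨by positivity, div_le_one_of_le₀ h (Nat.cast_nonneg _)⟩

/-- The lower bound that keeps the χ² denominators under control when `p` has zeros; it degenerates
only at the starting point, which never occurs as a denominator. -/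
theorem mul_le_linearPath (hp : ∀ i, 0 ≤ p i) (j : Fin (N + 1)) (i : Fin d) :
    (j : ℝ) / N * q i ≤ linearPath N p q j i := by
  rw [linearPath]
  nlinarith [hp i, (linearPath_ratio_mem j).2]

theorem linearPath_succ_pos (hp : ∀ i, 0 ≤ p i) (hq : ∀ i, 0 < q i) (j : Fin N) (i : Fin d) :
    0 < linearPath N p q j.succ i := by
  refine lt_of_lt_of_le ?_ (mul_le_linearPath hp j.succ i)
  have : 0 < (N : ℝ) := by exact_mod_cast j.pos
  have h2 : (0 : ℝ) < ((j.succ : Fin (N + 1)) : ℕ) := by simp; positivity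
  have := hq i
  positivity

theorem linearPath_nonneg (hp : ∀ i, 0 ≤ p i) (hq : ∀ i, 0 < q i) (j : Fin (N + 1)) (i : Fin d) :
    0 ≤ linearPath N p q j i :=
  (mul_nonneg (linearPath_ratio_mem j).1 (hq i).le).trans (mul_le_linearPath hp j i)

/-- Any strictly positive distribution is thermal for the levels -kT log r; the partition function
is then 1. -/
theorem boltzmann_linearLevels {k T : ℝ} (hk : 0 < k) (hT : 0 < T) (hp : ∀ i, 0 ≤ p i)
    (hq : ∀ i, 0 < q i) (hp1 : ∑ i, p i = 1) (hq1 : ∑ i, q i = 1) (j : Fin N) :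
    boltzmann k T (linearLevels k T N p q j) = linearPath N p q j.succ := by
  have h : ∀ i, Real.exp (-linearLevels k T N p q j i / (k * T)) = linearPath N p q j.succ i :=
    fun i => by
      rw [linearLevels, neg_mul, neg_neg, mul_div_cancel_left₀ _ (by positivity),
        Real.exp_log (linearPath_succ_pos hp hq j i)]
  funext i
  simp only [boltzmann, h]
  rw [sum_linearPath hp1 hq1, div_one]

theorem probabilityPath_linearLevels {k T : ℝ} (hk : 0 < k) (hT : 0 < T) (hp : ∀ i, 0 ≤ p i)
    (hq : ∀ i, 0 < q i) (hp1 : ∑ i, p i = 1) (hq1 : ∑ i, q i = 1) :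
    probabilityPath k T p (linearLevels k T N p q) = linearPath N p q := by
  funext j
  refine Fin.cases ?_ (fun j => ?_) j
  · rw [probabilityPath, Fin.cons_zero, linearPath_zero]
  · rw [probabilityPath, Fin.cons_succ, boltzmann_linearLevels hk hT hp hq hp1 hq1]

theorem linearPath_succ_sub (j : Fin N) (i : Fin d) :
    linearPath N p q j.succ i - linearPath N p q j.castSucc i = (q i - p i) / N := by
  simp only [linearPath, Fin.val_succ, Fin.val_castSucc]
  push_cast
  ring

/-- Strict because `q` has full rank. An increase by 1 would force `q` to be concentrated on a
single index; then that index is the only one, and `p` equals 1 there as well. The strictness allows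
steps below δp with exactly ⌈1/δp⌉ systems. -/
theorem abs_sub_lt_one (hp : ∀ i, 0 ≤ p i) (hq : ∀ i, 0 < q i) (hp1 : ∑ i, p i = 1)
    (hq1 : ∑ i, q i = 1) (i : Fin d) : |q i - p i| < 1 := by
  have hpi : p i ≤ 1 := hp1 ▸ Finset.single_le_sum (fun i _ => hp i) (Finset.mem_univ i)
  have hqi : q i ≤ 1 := hq1 ▸ Finset.single_le_sum (fun i _ => (hq i).le) (Finset.mem_univ i)
  rw [abs_lt]
  refine ⟨by linarith [hq i], ?_⟩
  by_contra! h
  have hi : ∀ j ∈ Finset.univ, j ≠ i → p j = 0 := fun j _ hj => by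
    exfalso
    have h1 : q i + q j ≤ 1 := by
      rw [← hq1, ← Finset.sum_pair hj.symm]
      exact Finset.sum_le_sum_of_subset_of_nonneg (Finset.subset_univ _) fun k _ _ => (hq k).le
    linarith [hq j, hp i]
  rw [Finset.sum_eq_single i hi (by simp)] at hp1
  linarith

theorem isGradual_linearLevels {k T δp : ℝ} (hk : 0 < k) (hT : 0 < T) (hp : ∀ i, 0 ≤ p i)
    (hq : ∀ i, 0 < q i) (hp1 : ∑ i, p i = 1) (hq1 : ∑ i, q i = 1) (hN : N ≠ 0)
    (hδ : 1 / (N : ℝ) ≤ δp) : IsGradual k T δp p q (linearLevels k T N p q) := by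
  rw [IsGradual, probabilityPath_linearLevels hk hT hp hq hp1 hq1]
  have hN' : 0 < (N : ℝ) := by exact_mod_cast Nat.pos_of_ne_zero hN
  refine ⟨fun j i => ⟨?_, ?_⟩, linearPath_last hN⟩
  · rw [linearPath_succ_sub, abs_div, abs_of_pos hN']
    refine lt_of_lt_of_le ?_ hδ
    gcongr
    exact abs_sub_lt_one hp hq hp1 hq1 i
  · obtain ⟨h1, h2⟩ := linearPath_ratio_mem j.succ
    rw [Set.mem_uIcc, linearPath]
    rcases le_total (p i) (q i) with h | h
    · left; constructor <;> nlinarith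
    · right; constructor <;> nlinarith

/-- Each numerator is at most 1/N² and the denominator at the end of step j + 1 is at least (j + 1)
q / N, so the sum over the steps is a harmonic sum divided by N. -/
theorem dissipation_linearPath_le (hp : ∀ i, 0 ≤ p i)
    (hq : ∀ i, 0 < q i) (hp1 : ∑ i, p i = 1) (hq1 : ∑ i, q i = 1) (hN : N ≠ 0) :
    dissipation (linearPath N p q) ≤ (∑ i, 1 / q i) * ((1 + Real.log N) / N) := by
  have hN' : 0 < (N : ℝ) := by exact_mod_cast Nat.pos_of_ne_zero hN
  refine (dissipation_le (linearPath_nonneg hp hq) (linearPath_succ_pos hp hq)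
    (sum_linearPath hp1 hq1)).trans ?_
  have h1 : ∀ (j : Fin N) i, (linearPath N p q j.castSucc i - linearPath N p q j.succ i) ^ 2 /
      linearPath N p q j.succ i ≤ 1 / q i * (((j : ℝ) + 1)⁻¹ / N) := fun j i => by
    have h2 := mul_le_linearPath (N := N) (q := q) hp j.succ i
    have h3 : (linearPath N p q j.castSucc i - linearPath N p q j.succ i) ^ 2 ≤ (1 / N) ^ 2 := by
      rw [← neg_sub, neg_sq, linearPath_succ_sub, div_pow, div_pow]
      refine div_le_div_of_nonneg_right ?_ (by positivity)
      rw [one_pow, ← sq_abs]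
      exact pow_le_one₀ (abs_nonneg _) (abs_sub_lt_one hp hq hp1 hq1 i).le
    have hqi := hq i
    have h4 : 0 < ((j.succ : Fin (N + 1)) : ℝ) / N * q i := by
      simp only [Fin.val_succ]; push_cast; positivity
    refine (div_le_div₀ (by positivity) h3 h4 h2).trans (le_of_eq ?_)
    simp only [Fin.val_succ]; push_cast
    field_simp
  have h5 : ∑ j : Fin N, ((j : ℝ) + 1)⁻¹ = (harmonic N : ℝ) := by
    rw [harmonic, Fin.sum_univ_eq_sum_range fun j : ℕ => ((j : ℝ) + 1)⁻¹]
    push_cast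
    rfl
  calc _ ≤ ∑ j : Fin N, ∑ i, 1 / q i * (((j : ℝ) + 1)⁻¹ / N) :=
        Finset.sum_le_sum fun j _ => Finset.sum_le_sum fun i _ => h1 j i
    _ = (∑ i, 1 / q i) * ((harmonic N : ℝ) / N) := by
        simp only [← Finset.sum_mul, ← Finset.mul_sum, ← Finset.sum_div, h5]
    _ ≤ _ := by
        have h6 := harmonic_le_one_add_log N
        have h7 : 0 ≤ ∑ i, 1 / q i := Finset.sum_nonneg fun i _ => (one_div_pos.2 (hq i)).le
        gcongr

theorem tendsto_one_add_log_div :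
    Filter.Tendsto (fun N : ℕ => (1 + Real.log N) / (N : ℝ)) Filter.atTop (nhds 0) := by
  have h1 : Filter.Tendsto (fun x : ℝ => (1 + Real.log x) / x) Filter.atTop (nhds 0) := by
    have h2 := Real.isLittleO_log_id_atTop.tendsto_div_nhds_zero
    have h3 := tendsto_inv_atTop_zero (𝕜 := ℝ)
    have h4 := h3.add h2
    rw [add_zero] at h4
    refine h4.congr fun x => ?_
    simp only [id]
    ring
  exact h1.comp tendsto_natCast_atTop_atTop

/-- The dissipation vanishes in the limit of many small steps. -/
theorem exists_step_dissipation_le (hp : ∀ i, 0 ≤ p i) (hq : ∀ i, 0 < q i) (hp1 : ∑ i, p i = 1)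
    (hq1 : ∑ i, q i = 1) {c ε : ℝ} (hc : 0 < c) (hε : 0 < ε) :
    ∃ δp₀ : ℝ, 0 < δp₀ ∧ ∀ N : ℕ, 1 / δp₀ ≤ (N : ℝ) → c * dissipation (linearPath N p q) ≤ ε := by
  have h1 := (tendsto_one_add_log_div.const_mul (c * ∑ i, 1 / q i))
  rw [mul_zero] at h1
  obtain ⟨N₀, hN₀⟩ := Filter.eventually_atTop.1 (h1.eventually (gt_mem_nhds hε))
  -- The additional 1 makes δp₀ well defined and forces N ≠ 0.
  refine ⟨1 / ((N₀ : ℝ) + 1), by positivity, fun N hN => ?_⟩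
  rw [one_div_one_div] at hN
  have h2 : N₀ + 1 ≤ N := by exact_mod_cast hN
  have h3 := hN₀ N (by omega)
  have h4 := dissipation_linearPath_le hp hq hp1 hq1 (N := N) (by omega)
  have h5 := mul_le_mul_of_nonneg_left h4 hc.le
  rw [← mul_assoc] at h5
  exact h5.trans h3.le

end Path


/-! ### Free evolution of subsystem and bath -/

section FreeEvolution

variable {n : Type} [Fintype n] [DecidableEq n]

theorem exp_smul_conj_diagonal {C : Matrix n n ℂ} (hC : C ∈ Matrix.unitaryGroup n ℂ) (c : n → ℂ)
    (s : ℂ) : NormedSpace.exp (s • (C * diagonal c * Cᴴ)) =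
      C * diagonal (fun i => cexp (s * c i)) * Cᴴ := by
  have h1 : C * Cᴴ = 1 := Matrix.mem_unitaryGroup_iff.1 hC
  have hB : C⁻¹ = Cᴴ := Matrix.inv_eq_right_inv h1
  have hU : IsUnit C := (Matrix.isUnit_iff_isUnit_det _).2 (Matrix.isUnit_det_of_right_inverse h1)
  have : s • (C * diagonal c * Cᴴ) = C * diagonal (fun i => s * c i) * C⁻¹ := by
    rw [hB, ← Matrix.smul_mul, ← Matrix.mul_smul, ← Matrix.diagonal_smul]
    rfl
  rw [this, Matrix.exp_conj _ _ hU, Matrix.exp_diagonal, hB, Pi.exp_def, Complex.exp_eq_exp_ℂ]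

theorem propagator_mem_unitary {H : Matrix n n ℂ} (hH : H.IsHermitian) (ħ t : ℝ) :
    propagator ħ H t ∈ Matrix.unitaryGroup n ℂ := by
  have hen : IsEigenbasis H hH.eigenvectorBasis hH.eigenvalues := fun i => by
    ext j
    simpa using congrFun (hH.mulVec_eigenvectorBasis i) j
  have h1 := Unitary.mem_iff.1 (toEuclideanCLM_propagator_mem_unitary hen ħ t)
  rw [← map_star, ← map_mul, ← map_mul] at h1
  rw [Matrix.mem_unitaryGroup_iff]
  exact (Matrix.toEuclideanCLM (n := n) (𝕜 := ℂ)).injective (h1.2.trans (map_one _).symm)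

theorem energy_freeEvolution {H : Matrix n n ℂ} (hH : H.IsHermitian) (ħ t : ℝ) (ρ : Matrix n n ℂ) :
    energy H (freeEvolution ħ H t ρ) = energy H ρ := by
  have hc : Commute H (propagator ħ H t) := ((Commute.refl H).smul_right _).exp_right
  have hU : (propagator ħ H t)ᴴ * propagator ħ H t = 1 :=
    Matrix.mem_unitaryGroup_iff'.1 (propagator_mem_unitary hH ħ t)
  rw [energy, freeEvolution, ← mul_assoc, ← mul_assoc, hc.eq, Matrix.trace_mul_comm, ← mul_assoc,
    ← mul_assoc, hU, one_mul, energy]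

theorem abs_energy_le (H : Matrix n n ℂ) {M : Matrix n n ℂ} {η : ℝ} (h : ∀ a b, ‖M a b‖ ≤ η) :
    |energy H M| ≤ (∑ a, ∑ b, ‖H a b‖) * η := by
  rw [energy, Matrix.trace]
  refine (Complex.abs_re_le_norm _).trans ?_
  simp only [Matrix.diag_apply, Matrix.mul_apply, Finset.sum_mul]
  refine (norm_sum_le _ _).trans (Finset.sum_le_sum fun a _ => (norm_sum_le _ _).trans
    (Finset.sum_le_sum fun b _ => ?_))
  rw [norm_mul]
  exact mul_le_mul_of_nonneg_left (h b a) (norm_nonneg _)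

theorem energy_sub (H M M' : Matrix n n ℂ) : energy H (M - M') = energy H M - energy H M' := by
  rw [energy, mul_sub, Matrix.trace_sub, Complex.sub_re, energy, energy]

theorem norm_partialTrace_le {m : Type} [Fintype m] {M : Matrix (n × m) (n × m) ℂ} {η : ℝ}
    (h : ∀ a b, ‖M a b‖ ≤ η) (i j : n) : ‖partialTrace M i j‖ ≤ Fintype.card m * η := by
  rw [partialTrace, Matrix.of_apply, ← nsmul_eq_mul]
  exact (norm_sum_le _ _).trans (Finset.sum_le_card_nsmul _ _ _ fun b _ => h _ _)

theorem partialTrace_sub {m : Type} [Fintype m] (M M' : Matrix (n × m) (n × m) ℂ) :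
    partialTrace (M - M') = partialTrace M - partialTrace M' := by
  ext i j
  simp [partialTrace]

variable {d N : ℕ}

theorem isHermitian_systemHamiltonian {Hu : Matrix (Fin d) (Fin d) ℂ} (hHu : Hu.IsHermitian)
    (e : Fin N → Fin d → ℝ) : (systemHamiltonian Hu e).IsHermitian := by
  have h : (bathHamiltonian e)ᴴ = bathHamiltonian e := by
    rw [bathHamiltonian, diagonal_conjTranspose]
    congr 1
    funext b
    simp
  rw [Matrix.IsHermitian, systemHamiltonian, conjTranspose_add, conjTranspose_kronecker,
    conjTranspose_kronecker, conjTranspose_one, conjTranspose_one, hHu.eq, h]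

/-- Both summands of the Hamiltonian are diagonal in the same product basis, so the exponential
factorizes. -/
theorem propagator_systemHamiltonian {Hu : Matrix (Fin d) (Fin d) ℂ}
    {E : OrthonormalBasis (Fin d) ℂ (EuclideanSpace ℂ (Fin d))} {ε : Fin d → ℝ}
    (hE : IsEigenbasis Hu E ε) (e : Fin N → Fin d → ℝ) (ħ t : ℝ) :
    propagator ħ (systemHamiltonian Hu e) t = propagator ħ Hu t ⊗ₖ
      diagonal fun b : Bath d N => cexp (-(I * ((t * (∑ j, e j (b j)) / ħ : ℝ) : ℂ))) := by
  have h1 : ∀ (c : Fin d → ℂ) (w : Bath d N → ℂ),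
      (basisMatrix E * diagonal c * (basisMatrix E)ᴴ) ⊗ₖ diagonal w =
        frame N E * diagonal (fun x => c x.1 * w x.2) * (frame N E)ᴴ := fun c w => by
    rw [frame_conjTranspose, frame, ← diagonal_kronecker_diagonal, ← mul_kronecker_mul,
      ← mul_kronecker_mul, one_mul, mul_one]
  have hone : (1 : Matrix (Fin d) (Fin d) ℂ) =
      basisMatrix E * diagonal (fun _ => 1) * (basisMatrix E)ᴴ := by
    rw [diagonal_one, mul_one, basisMatrix_mul_conjTranspose_self]
  have hHu := eq_basisMatrix_mul_diagonal hE
  have hs : systemHamiltonian Hu e = frame N E *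
      diagonal (fun x => ((ε x.1 : ℝ) : ℂ) + ((∑ j, e j (x.2 j) : ℝ) : ℂ)) * (frame N E)ᴴ := by
    rw [systemHamiltonian, bathHamiltonian, ← diagonal_one (n := Bath d N), hHu, h1, hone, h1,
      ← add_mul, ← mul_add, diagonal_add]
    simp
  have hu : propagator ħ Hu t = basisMatrix E *
      diagonal (fun i => cexp (-(I * t / ħ) * ε i)) * (basisMatrix E)ᴴ := by
    rw [propagator, hHu, exp_smul_conj_diagonal (basisMatrix_mem_unitary E)]
  rw [hu, h1, propagator, hs, exp_smul_conj_diagonal (frame_mem_unitary E)]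
  congr 3
  funext x
  rw [← Complex.exp_add]
  congr 1
  push_cast
  ring

/-- The bath state is diagonal in the energy basis, so its phases cancel and the trace of the bath
factor remains 1. -/
theorem partialTrace_freeEvolution {Hu : Matrix (Fin d) (Fin d) ℂ}
    {E : OrthonormalBasis (Fin d) ℂ (EuclideanSpace ℂ (Fin d))} {ε : Fin d → ℝ}
    (hE : IsEigenbasis Hu E ε) (e : Fin N → Fin d → ℝ) (ħ t : ℝ) (σ : Matrix (Fin d) (Fin d) ℂ)
    {f : Fin N → Fin d → ℝ} (hf : ∀ j, ∑ i, f j i = 1) :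
    partialTrace (freeEvolution ħ (systemHamiltonian Hu e) t
      (σ ⊗ₖ diagonal fun b => (bathWeight f b : ℂ))) = freeEvolution ħ Hu t σ := by
  rw [freeEvolution, propagator_systemHamiltonian hE, conjTranspose_kronecker, ← mul_kronecker_mul,
    ← mul_kronecker_mul, partialTrace_kronecker, diagonal_conjTranspose, diagonal_mul_diagonal,
    diagonal_mul_diagonal, freeEvolution]
  have h : ∀ b : Bath d N, cexp (-(I * ((t * (∑ j, e j (b j)) / ħ : ℝ) : ℂ))) * (bathWeight f b : ℂ) *
      star (fun b : Bath d N => cexp (-(I * ((t * (∑ j, e j (b j)) / ħ : ℝ) : ℂ)))) b =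
      (bathWeight f b : ℂ) := fun b => by
    rw [Pi.star_apply, mul_right_comm, RCLike.star_def, Complex.mul_conj,
      Complex.normSq_eq_norm_sq, norm_cexp_neg_I_mul, one_pow, ofReal_one, one_mul]
  simp only [h]
  rw [trace_diagonal_bathWeight hf, one_smul]

end FreeEvolution

/-! ### The clock-driven engine -/

section Engine

variable {d N : ℕ}

theorem posSemidef_kronecker_bathWeight {ρ : Matrix (Fin d) (Fin d) ℂ} (hρ : ρ.PosSemidef)
    {f : Fin N → Fin d → ℝ} (hf : ∀ j i, 0 ≤ f j i) :
    (ρ ⊗ₖ diagonal fun b => (bathWeight f b : ℂ)).PosSemidef :=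
  hρ.kronecker (PosSemidef.diagonal fun b => by
    have : 0 ≤ bathWeight f b := Finset.prod_nonneg fun j _ => hf j _
    exact Complex.zero_le_real.2 this)

/-- The free-energy balance of the protocol. -/
theorem energy_balance {k T : ℝ} {Hu ρ σ : Matrix (Fin d) (Fin d) ℂ}
    {ψ φ : OrthonormalBasis (Fin d) ℂ (EuclideanSpace ℂ (Fin d))} {p q : Fin d → ℝ}
    (hρ : ρ.IsHermitian) (hσ : σ.IsHermitian) (hρ1 : ρ.trace = 1) (hσ1 : σ.trace = 1)
    (hψ : IsEigenbasis ρ ψ p) (hφ : IsEigenbasis σ φ q) (hN : N ≠ 0) :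
    energy (systemHamiltonian Hu (linearLevels k T N p q))
        (σ ⊗ₖ diagonal fun b => (bathWeight (fun j => linearPath N p q j.castSucc) b : ℂ)) -
      energy (systemHamiltonian Hu (linearLevels k T N p q))
        (ρ ⊗ₖ diagonal fun b => (bathWeight (fun j => linearPath N p q j.succ) b : ℂ)) -
      (freeEnergy k T Hu σ hσ - freeEnergy k T Hu ρ hρ) =
    k * T * dissipation (linearPath N p q) := by
  have hs := sum_linearPath (N := N) (hψ.sum_eq_one hρ hρ1) (hφ.sum_eq_one hσ hσ1)
  rw [energy_kronecker_bathWeight _ _ hσ1 fun j => hs _,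
    energy_kronecker_bathWeight _ _ hρ1 fun j => hs _, ← work_sub_freeEnergy_eq, freeEnergy,
    freeEnergy, entropy, entropy, sum_eigenvalues_eq hσ hφ, sum_eigenvalues_eq hρ hψ,
    linearPath_zero, linearPath_last hN]
  simp only [linearLevels]
  ring

/-- An error for the matrix entries that controls the trace norms and the mean energy. -/
theorem exists_entry_tolerance {n m : Type} [Fintype n] [Fintype m] [DecidableEq n] [DecidableEq m]
    (H : Matrix (n × m) (n × m) ℂ) {ε : ℝ} (hε : 0 < ε) : ∃ η > 0,
    ∀ M : Matrix (n × m) (n × m) ℂ, (∀ a b, ‖M a b‖ ≤ η) →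
      traceNorm M ≤ ε ∧ traceNorm (partialTrace M) ≤ ε ∧ |energy H M| ≤ ε / 2 := by
  set A : ℝ := (Fintype.card (n × m) : ℝ) ^ 2 with hA
  set B : ℝ := (Fintype.card n : ℝ) ^ 2 * Fintype.card m with hB
  set C : ℝ := ∑ a, ∑ b, ‖H a b‖ with hC
  have hA0 : 0 ≤ A := by positivity
  have hB0 : 0 ≤ B := by positivity
  have hC0 : 0 ≤ C := Finset.sum_nonneg fun _ _ => Finset.sum_nonneg fun _ _ => norm_nonneg _
  -- One denominator dominates the constants of all three bounds, each of which then becomes at most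
  -- ε/2.
  set η := ε / (2 * (A + B + C + 1)) with hη
  have hη0 : 0 < η := by positivity
  have hs : (A + B + C + 1) * η = ε / 2 := by rw [hη]; field_simp
  have h1 : A * η ≤ ε / 2 := by nlinarith [mul_nonneg hB0 hη0.le, mul_nonneg hC0 hη0.le]
  have h2 : B * η ≤ ε / 2 := by nlinarith [mul_nonneg hA0 hη0.le, mul_nonneg hC0 hη0.le]
  have h3 : C * η ≤ ε / 2 := by nlinarith [mul_nonneg hB0 hη0.le, mul_nonneg hA0 hη0.le]
  refine ⟨η, hη0, fun M hM => ⟨?_, ?_, (abs_energy_le H hM).trans h3⟩⟩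
  · exact (traceNorm_le_of_entries hη0.le hM).trans (by linarith)
  · refine (traceNorm_le_of_entries (by positivity) (norm_partialTrace_le hM)).trans ?_
    rw [← mul_assoc]
    linarith

end Engine

end ClockEngine

end

theorem mainTheorem5 (ħ k T : ℝ) (hħ : 0 < ħ) (hk : 0 < k) (hT : 0 < T) (d : ℕ)
    -- the subsystem: Hamiltonian, initial state, full-rank target state
    (Hu ρu σu : Matrix (Fin d) (Fin d) ℂ) (hHu : Hu.IsHermitian)
    (hρu : ρu.PosSemidef) (hρu1 : ρu.trace = 1) (hσu : σu.PosDef) (hσu1 : σu.trace = 1)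
    -- eigenbases and eigenvalues, in any labelling
    (E ψ φ : OrthonormalBasis (Fin d) ℂ (EuclideanSpace ℂ (Fin d))) (ε p q : Fin d → ℝ)
    (hE : IsEigenbasis Hu E ε) (hψ : IsEigenbasis ρu ψ p) (hφ : IsEigenbasis σu φ q)
    -- the admitted error
    (ε' : ℝ) (hε' : 0 < ε') :
    ∃ δp₀ > 0, ∀ δp, 0 < δp → δp ≤ δp₀ →
      -- a gradual protocol with `⌈1 / δp⌉` swap steps, given by the energy levels of the bath
      ∃ e : Fin ⌈1 / δp⌉₊ → Fin d → ℝ, IsGradual k T δp p q e ∧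
      ∀ Hs V ρub, Hs = systemHamiltonian Hu e → V = protocolUnitary ⌈1 / δp⌉₊ ψ E φ →
        ρub = ρu ⊗ₖ thermalState k T (bathHamiltonian e) →
      ∀ ΔF, ΔF = freeEnergy k T Hu σu hσu.isHermitian - freeEnergy k T Hu ρu hρu.isHermitian →
      -- the protocol unitary on subsystem and bath
      V ∈ Matrix.unitaryGroup _ ℂ ∧
      partialTrace (V * ρub * Vᴴ) = σu ∧
      0 ≤ energy Hs (V * ρub * Vᴴ) - energy Hs ρub - ΔF ∧
      energy Hs (V * ρub * Vᴴ) - energy Hs ρub - ΔF ≤ ε' ∧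
      -- its autonomous implementation, for any initial clock region `[a, a + K]`, length `L` of
      -- the interaction region and central momentum `p₀` of the weight
      ∀ a K L p₀ : ℝ, 0 < K → 0 < L →
        ∃ (Hint : Total (Fin d × Bath d ⌈1 / δp⌉₊) →L[ℂ] Total (Fin d × Bath d ⌈1 / δp⌉₊))
          (U : ℝ → Total (Fin d × Bath d ⌈1 / δp⌉₊) ≃ₗᵢ[ℂ] Total (Fin d × Bath d ⌈1 / δp⌉₊)),
          IsInteraction ħ Hs (a + K) L Hint ∧ IsEvolution ħ Hs Hint U ∧
          ∃ δ > 0, (∃ ρw, IsNarrowWeight ħ p₀ δ ρw) ∧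
          ∀ ρw ρc, IsNarrowWeight ħ p₀ δ ρw → IsClockState a K ρc →
            ∃ ρ₀, IsDensity ρ₀ ∧ IsProductState ρ₀ ρub ρw ρc ∧
            ∀ t, K + L ≤ t →
              ∃ ρs : Matrix (Fin d × Bath d ⌈1 / δp⌉₊) (Fin d × Bath d ⌈1 / δp⌉₊) ℂ,
                IsReducedState (evolve (U t) ρ₀) ρs ∧
                -- the protocol unitary is implemented, and the subsystem is close to the freely
                -- evolving target state
                traceNorm (ρs - freeEvolution ħ Hs t (V * ρub * Vᴴ)) ≤ ε' ∧
                traceNorm (partialTrace ρs - freeEvolution ħ Hu t σu) ≤ ε' ∧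
                -- the extracted work, the gain in mean energy of the weight
                ∃ m₀ m, HasMean Prod.fst ρ₀ m₀ ∧ HasMean Prod.fst (evolve (U t) ρ₀) m ∧
                  m - m₀ ≥ -ΔF - ε' := by
  have hp0 : ∀ i, 0 ≤ p i :=
    hψ.forall_of_eigenvalues hρu.isHermitian (Q := fun x => 0 ≤ x) hρu.eigenvalues_nonneg
  have hq0 : ∀ i, 0 < q i :=
    hφ.forall_of_eigenvalues hσu.isHermitian (Q := fun x => 0 < x) hσu.eigenvalues_pos
  have hp1 : ∑ i, p i = 1 := hψ.sum_eq_one hρu.isHermitian hρu1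
  have hq1 : ∑ i, q i = 1 := hφ.sum_eq_one hσu.isHermitian hσu1
  -- Half of the admitted error goes to the dissipation of the protocol; the other half is kept for
  -- the mean energy error of the machine.
  obtain ⟨δp₀, hδp₀, hdiss⟩ := exists_step_dissipation_le hp0 hq0 hp1 hq1 (mul_pos hk hT)
    (half_pos hε')
  refine ⟨δp₀, hδp₀, fun δp hδp hle => ?_⟩
  have hN : ⌈1 / δp⌉₊ ≠ 0 := (Nat.ceil_pos.2 (one_div_pos.2 hδp)).ne'
  have hle' : 1 / δp ≤ (⌈1 / δp⌉₊ : ℝ) := Nat.le_ceil _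
  -- Only `N ≠ 0` and `1 / δp ≤ N` are used about the number of steps.
  generalize ⌈1 / δp⌉₊ = N at hN hle' ⊢
  have hD := hdiss N ((one_div_le_one_div_of_le hδp hle).trans hle')
  have hD0 : 0 ≤ k * T * dissipation (linearPath N p q) :=
    mul_nonneg (mul_pos hk hT).le (dissipation_nonneg (linearPath_nonneg hp0 hq0)
      (linearPath_succ_pos hp0 hq0) (sum_linearPath hp1 hq1))
  have hstep : 1 / (N : ℝ) ≤ δp := by
    have hN' : 0 < (N : ℝ) := by exact_mod_cast Nat.pos_of_ne_zero hN
    rw [div_le_iff₀ hδp] at hle'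
    rw [div_le_iff₀ hN']
    linarith
  refine ⟨linearLevels k T N p q, isGradual_linearLevels hk hT hp0 hq0 hp1 hq1 hN hstep, ?_⟩
  intro Hs V ρub hHs hV hρub ΔF hΔF
  simp only [thermalState_bathHamiltonian, boltzmann_linearLevels hk hT hp0 hq0 hp1 hq1] at hρub
  have hVu : V ∈ Matrix.unitaryGroup _ ℂ := hV ▸ protocolUnitary_mem_unitary ψ E φ
  have hfinal : V * ρub * Vᴴ =
      σu ⊗ₖ diagonal fun b => (bathWeight (fun j => linearPath N p q j.castSucc) b : ℂ) := by
    rw [hV, hρub]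
    exact protocolUnitary_conj (linearPath N p q) (linearPath_zero ▸ hψ) ((linearPath_last hN).symm ▸ hφ)
  have hbalance : energy Hs (V * ρub * Vᴴ) - energy Hs ρub - ΔF =
      k * T * dissipation (linearPath N p q) := by
    rw [hfinal, hΔF, hHs, hρub]
    exact energy_balance hρu.isHermitian hσu.isHermitian hρu1 hσu1 hψ hφ hN
  have hsum : ∀ j : Fin N, ∑ i, linearPath N p q j.castSucc i = 1 :=
    fun j => sum_linearPath hp1 hq1 _
  have hHsH : Hs.IsHermitian := hHs ▸ isHermitian_systemHamiltonian hHu _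
  have hρ : ρub.PosSemidef := hρub ▸ posSemidef_kronecker_bathWeight hρu
    fun j i => linearPath_nonneg hp0 hq0 _ i
  have hρ1 : ρub.trace = 1 := by
    rw [hρub, Matrix.trace_kronecker, hρu1,
      trace_diagonal_bathWeight fun j => sum_linearPath hp1 hq1 _, one_mul]
  refine ⟨hVu, ?_, hbalance ▸ hD0, hbalance ▸ hD.trans (half_le_self hε'.le), ?_⟩
  · rw [hfinal, partialTrace_kronecker, trace_diagonal_bathWeight hsum, one_smul]
  intro a K L p₀ _ hL
  obtain ⟨η, hη, htol⟩ := exists_entry_tolerance Hs hε'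
  obtain ⟨Hint, U, hI, hU, δ, hδ, hex, hrun⟩ := exists_machine hħ hHsH hVu hρ hρ1 hη a K p₀ hL
  refine ⟨Hint, U, hI, hU, δ, hδ, hex, fun ρw ρc hw hc => ?_⟩
  obtain ⟨ρ₀, hρ₀, hprod, ht⟩ := hrun ρw ρc hw hc
  refine ⟨ρ₀, hρ₀, hprod, fun t htL => ?_⟩
  obtain ⟨ρs, hρs, hclose, m₀, m, hm₀, hm, hmean⟩ := ht t htL
  obtain ⟨h1, h2, h3⟩ := htol _ hclose
  refine ⟨ρs, hρs, h1, ?_, m₀, m, hm₀, hm, ?_⟩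
  · rwa [partialTrace_sub, hfinal, hHs, partialTrace_freeEvolution hE _ _ _ _ hsum] at h2
  -- The work is the exact energy loss of the system. Free evolution does not change the mean
  -- energy, so the loss differs from -ΔE by at most ε'/2, and ΔE exceeds ΔF by at most ε'/2.
  · rw [energy_sub, energy_freeEvolution hHsH] at h3
    have h4 := (abs_le.1 h3).2
    linarith
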